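/- **Setting.** Let $\mathcal V$ be a symmetric monoidal closed category with all small limits and colimits, equipped with a model structure, such that: - (pushout-product axiom) for cofibrations $i:A\to B$ and $j:X\to Y$, the map $(B\otimes X)\sqcup_{A\otimes X}(A\otimes Y)\to B\otimes Y$ is a cofibration, which is a weak equivalence if $i$ or $j$ is; - the unit $I$ is cofibrant; - (monoid axiom) every transfinite composition of pushouts of coproducts of maps $j\otimes Y$, with $j$ a trivial cofibration and $Y\in\mathcal V$, is a weak equivalence; - (cofibrant generation) there are sets $\mathbf I,\mathbf J$ of maps such that the trivial fibrations (fibrations) are the maps with the right lifting property with respect to $\mathbf I$ ($\mathbf J$), and the domains of $\mathbf I$ ($\mathbf J$) are small relative to the transfinite compositions of pushouts of coproducts of maps $i\otimes Y$ with $i$ a cofibration (a trivial cofibration) and $Y\in\mathcal V$. (This smallness holds, for example, if every object of $\mathcal V$ is small.) Equip $Ho(\mathcal V)$ with the derived tensor product, so that $\mathcal V\to Ho(\mathcal V)$ is lax monoidal. For a small $\mathcal V$-category $\mathcal A$ let $[\mathcal A]_{\mathcal V}$ be the category with the objects of $\mathcal A$ and with $[\mathcal A]_{\mathcal V}(x,y)=Ho(\mathcal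 V)(I,\mathcal A(x,y))$; a $\mathcal V$-functor $f:\mathcal A\to\mathcal B$ induces a functor $[f]_{\mathcal V}:[\mathcal A]_{\mathcal V}\to[\mathcal B]_{\mathcal V}$. Let $\mathcal V\text{-}\mathbf{Cat}$ be the category of small $\mathcal V$-categories and $\mathcal V$-functors. A $\mathcal V$-functor $f:\mathcal A\to\mathcal B$ is - in $\mathrm W^{\mathcal G}$ if every $\mathcal A(x,y)\to\mathcal B(fx,fy)$ is a weak equivalence of $\mathcal V$ and $[f]_{\mathcal V}$ is essentially surjective; - in $\mathrm F^{\mathcal G}$ if every $\mathcal A(x,y)\to\mathcal B(fx,fy)$ is a fibration of $\mathcal V$ and, for every object $x$ of $\mathcal A$ and every isomorphism $v:y'\to [f]_{\mathcal V}(x)$ in $[\mathcal B]_{\mathcal V}$, there is an isomorphism $u:x'\to x$ in $[\mathcal A]_{\mathcal V}$ with $[f]_{\mathcal V}(u)=v$ (in particular $fx'=y'$); - in $\mathrm C^{\mathcal G}$ if it has the left lifting property with respect to $\mathrm F^{\mathcal G}\cap \mathrm W^{\mathcal G}$. **Theorem 3.1.** Suppose furthermore that $\mathcal V$ is right proper and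 that, for every small $\mathcal V$-category $\mathcal A$ all of whose hom-objects $\mathcal A(x,y)$ are fibrant, the diagonal $\mathcal A\to\mathcal A\times\mathcal A$ factors as $\mathcal A\xrightarrow{s}\mathrm{Path}\,\mathcal A\xrightarrow{p}\mathcal A\times\mathcal A$ with $s\in\mathrm W^{\mathcal G}$ and $p\in\mathrm F^{\mathcal G}$. Then $\mathrm W^{\mathcal G}$, $\mathrm C^{\mathcal G}$ and $\mathrm F^{\mathcal G}$ are the weak equivalences, cofibrations and fibrations of a right proper model structure on $\mathcal V\text{-}\mathbf{Cat}$. -/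

import Mathlib

open CategoryTheory Limits MonoidalCategory HomotopicalAlgebra

universe w u

namespace EnrichedModel

/-! ### Lax monoidal structures obtained by resolutions -/

section Derived

open Functor.LaxMonoidal Functor.OplaxMonoidal

variable {K C D : Type*} [Category* K] [Category* C] [Category* D]
  (i : K ⥤ C) (L : C ⥤ D) (Lc : K ⥤ D) (e : Lc ⟶ i ⋙ L)

/-- The morphism `Lc.obj k ⟶ L.obj X` induced by `a : i.obj k ⟶ X`. -/
def elt {k : K} {X : C} (a : i.obj k ⟶ X) : Lc.obj k ⟶ L.obj X := e.app k ≫ L.map a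

lemma elt_map {k : K} {X Y : C} (a : i.obj k ⟶ X) (f : X ⟶ Y) :
    elt i L Lc e a ≫ L.map f = elt i L Lc e (a ≫ f) := by simp [elt]

lemma map_elt {k l : K} {X : C} (f : k ⟶ l) (a : i.obj l ⟶ X) :
    Lc.map f ≫ elt i L Lc e a = elt i L Lc e (i.map f ≫ a) := by
  have := e.naturality_assoc f (L.map a)
  simp [elt, this]

variable [MonoidalCategory K] [MonoidalCategory C] [MonoidalCategory D] [i.Monoidal]
  [Lc.LaxMonoidal] (r : C → K) (p : ∀ X, i.obj (r X) ⟶ X) [∀ X, IsIso (elt i L Lc e (p X))]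

/-- The tensorator of `derivedLax`: the composite
`L X ⊗ L Y ≅ Lc (r X) ⊗ Lc (r Y) ⟶ Lc (r X ⊗ r Y) ⟶ L (i (r X) ⊗ i (r Y)) ⟶ L (X ⊗ Y)`. -/
noncomputable def derivedμ (X Y : C) : L.obj X ⊗ L.obj Y ⟶ L.obj (X ⊗ Y) :=
  (inv (elt i L Lc e (p X)) ⊗ₘ inv (elt i L Lc e (p Y))) ≫ μ Lc (r X) (r Y) ≫
    elt i L Lc e (δ i _ _ ≫ (p X ⊗ₘ p Y))

lemma elt_derivedμ
    (lift : ∀ {k : K} {X : C} (a : i.obj k ⟶ X), ∃ b : k ⟶ r X, i.map b ≫ p X = a) {k l : K} {X Y : C} (a : i.obj k ⟶ X) (b : i.obj l ⟶ Y) :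
    (elt i L Lc e a ⊗ₘ elt i L Lc e b) ≫ derivedμ i L Lc e r p X Y =
      μ Lc k l ≫ elt i L Lc e (δ i k l ≫ (a ⊗ₘ b)) := by
  obtain ⟨a, rfl⟩ := lift a
  obtain ⟨b, rfl⟩ := lift b
  rw [← map_elt, ← map_elt, derivedμ, tensorHom_comp_tensorHom_assoc, Category.assoc,
    Category.assoc, IsIso.hom_inv_id, IsIso.hom_inv_id, Category.comp_id, Category.comp_id,
    μ_natural_assoc, map_elt, ← δ_natural_assoc, tensorHom_comp_tensorHom]

/-- Suppose that every object `X` has a resolution `p X : i (r X) ⟶ X` which becomes invertible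
in `D` and through which all morphisms `i k ⟶ X` factor. If `i` is monoidal and `Lc` (which
agrees with `i ⋙ L`) is lax monoidal, then `L` is lax monoidal. -/
@[reducible]
noncomputable def derivedLax
    (lift : ∀ {k : K} {X : C} (a : i.obj k ⟶ X), ∃ b : k ⟶ r X, i.map b ≫ p X = a) : L.LaxMonoidal := by
  have key {k l : K} {X Y : C} (a : i.obj k ⟶ X) (b : i.obj l ⟶ Y) :=
    elt_derivedμ i L Lc e r p lift a b
  exact Functor.LaxMonoidal.ofTensorHom
    (ε := ε Lc ≫ elt i L Lc e (η i))
    (μ := derivedμ i L Lc e r p)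
    (μ_natural := fun {X Y X' Y'} f g => by
      rw [← cancel_epi (elt i L Lc e (p X) ⊗ₘ elt i L Lc e (p X')),
        tensorHom_comp_tensorHom_assoc, elt_map, elt_map, key, reassoc_of% (key (p X) (p X')),
        elt_map, Category.assoc, tensorHom_comp_tensorHom])
    (associativity := fun X Y Z => by
      rw [← cancel_epi ((elt i L Lc e (p X) ⊗ₘ elt i L Lc e (p Y)) ⊗ₘ elt i L Lc e (p Z)),
        tensorHom_comp_tensorHom_assoc, key, associator_naturality_assoc,
        tensorHom_comp_tensorHom_assoc, key, Category.comp_id, Category.comp_id,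
        ← Category.id_comp (elt i L Lc e (p Z)), ← tensorHom_comp_tensorHom_assoc,
        reassoc_of% (key (δ i (r X) (r Y) ≫ (p X ⊗ₘ p Y)) (p Z)), elt_map,
        ← Category.id_comp (elt i L Lc e (p X)), ← tensorHom_comp_tensorHom_assoc,
        key]
      have h := associativity_assoc Lc (r X) (r Y) (r Z)
        (elt i L Lc e (δ i _ _ ≫ ((p X) ⊗ₘ (δ i _ _ ≫ (p Y ⊗ₘ p Z)))))
      rw [map_elt] at h
      rw [tensorHom_id, id_tensorHom, ← h]
      congr 3
      have h2 := Functor.OplaxMonoidal.associativity_assoc i (r X) (r Y) (r Z)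
        (p X ⊗ₘ p Y ⊗ₘ p Z)
      rw [← Category.id_comp (p Z), ← tensorHom_comp_tensorHom, tensorHom_id, Category.assoc,
        Category.assoc, Category.id_comp, associator_naturality, h2,
        ← Category.id_comp (p X), ← tensorHom_comp_tensorHom, id_tensorHom, Category.id_comp])
    (left_unitality := fun X => by
      rw [← cancel_epi (𝟙 _ ⊗ₘ elt i L Lc e (p X)), tensorHom_comp_tensorHom_assoc,
        Category.id_comp, Category.comp_id, ← Category.id_comp (elt i L Lc e (p X)),
        ← tensorHom_comp_tensorHom_assoc, reassoc_of% (key (η i) (p X)), elt_map, Category.id_comp,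
        id_tensorHom, leftUnitor_naturality, left_unitality Lc, tensorHom_id, Category.assoc,
        Category.assoc, map_elt]
      congr 3
      rw [Category.assoc, MonoidalCategory.tensorHom_def, Category.assoc, leftUnitor_naturality]
      simp)
    (right_unitality := fun X => by
      rw [← cancel_epi (elt i L Lc e (p X) ⊗ₘ 𝟙 _), tensorHom_comp_tensorHom_assoc,
        Category.id_comp, Category.comp_id, ← Category.id_comp (elt i L Lc e (p X)),
        ← tensorHom_comp_tensorHom_assoc, reassoc_of% (key (p X) (η i)), elt_map, Category.id_comp,
        tensorHom_id, rightUnitor_naturality, right_unitality Lc, id_tensorHom, Category.assoc,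
        Category.assoc, map_elt]
      congr 3
      rw [Category.assoc, MonoidalCategory.tensorHom_def', Category.assoc, rightUnitor_naturality]
      simp)

end Derived
/-! ### Cofibrant resolutions -/

section Resolution

variable {V : Type u} [Category.{w} V] [ModelCategory V]

open CofibrantObject.HoCat

/-- A cofibrant resolution of `X`. -/
noncomputable def res (X : V) : CofibrantObject V := .mk (resolutionObj X)

/-- The trivial fibration from the cofibrant resolution of `X` to `X`. -/
noncomputable def resp (X : V) : CofibrantObject.ι.obj (res X) ⟶ X := pResolutionObj X

instance (X : V) : WeakEquivalence (resp X) :=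
  inferInstanceAs (WeakEquivalence (pResolutionObj X))

lemma exists_lift {K : CofibrantObject V} {X : V} (a : CofibrantObject.ι.obj K ⟶ X) :
    ∃ b : K ⟶ res X, CofibrantObject.ι.map b ≫ resp X = a := by
  have sq : CommSq (initial.to (resolutionObj X)) (initial.to K.obj) (pResolutionObj X) a :=
    ⟨by simp⟩
  exact ⟨ObjectProperty.homMk sq.lift, sq.fac_right⟩

end Resolution

/-! ### Monoidal model categories and their homotopy categories -/

section MonoidalModel

variable (V : Type u) [Category.{w} V] [MonoidalCategory V] [ModelCategory V]

/-- The pushout-product axiom: for cofibrations `i : A ⟶ B` and `j : X ⟶ Y`, the canonical map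
`(B ⊗ X) ⨿_{A ⊗ X} (A ⊗ Y) ⟶ B ⊗ Y` is a cofibration, and it is a weak equivalence
as soon as `i` or `j` is one. -/
class IsMonoidalModel : Prop where
  cofibration {A B X Y : V} (i : A ⟶ B) (j : X ⟶ Y) [Cofibration i] [Cofibration j]
    (sq : (curriedTensor V).PushoutObjObj i j) : Cofibration sq.ι
  weakEquivalence_left {A B X Y : V} (i : A ⟶ B) (j : X ⟶ Y) [Cofibration i] [Cofibration j]
    [WeakEquivalence i] (sq : (curriedTensor V).PushoutObjObj i j) : WeakEquivalence sq.ι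
  weakEquivalence_right {A B X Y : V} (i : A ⟶ B) (j : X ⟶ Y) [Cofibration i] [Cofibration j]
    [WeakEquivalence j] (sq : (curriedTensor V).PushoutObjObj i j) : WeakEquivalence sq.ι

variable {V}

section

variable [MonoidalClosed V] [SymmetricCategory V]

/-- `X ⊗ ∅` is initial. -/
noncomputable def isInitialTensorLeft (X : V) : IsInitial (X ⊗ ⊥_ V) :=
  IsInitial.isInitialObj (tensorLeft X) _ initialIsInitial

/-- `∅ ⊗ X` is initial. -/
noncomputable def isInitialTensorRight (X : V) : IsInitial ((⊥_ V) ⊗ X) :=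
  (isInitialTensorLeft X).ofIso (β_ _ _)

/-- The pushout-product of `∅ ⟶ A` and `j` is `A ◁ j`. -/
noncomputable def initialSquare (A : V) {X Y : V} (j : X ⟶ Y) :
    (curriedTensor V).PushoutObjObj (initial.to A) j where
  pt := A ⊗ X
  inl := 𝟙 _
  inr := (isInitialTensorRight Y).to _
  isPushout := by
    have : IsIso ((⊥_ V) ◁ j) :=
      ⟨(isInitialTensorRight Y).to _, (isInitialTensorRight X).hom_ext _ _,
        (isInitialTensorRight Y).hom_ext _ _⟩
    have : IsIso (((curriedTensor V).obj (⊥_ V)).map j) := this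
    exact IsPushout.of_vert_isIso ⟨(isInitialTensorRight X).hom_ext _ _⟩
  ι := A ◁ j
  inl_ι := by simp
  inr_ι := (isInitialTensorRight Y).hom_ext _ _

variable [IsMonoidalModel V]

instance cofibration_whiskerLeft (A : V) [IsCofibrant A] {X Y : V} (j : X ⟶ Y) [Cofibration j] :
    Cofibration (A ◁ j) :=
  IsMonoidalModel.cofibration (initial.to A) j (initialSquare A j)

lemma weakEquivalence_whiskerLeft_of_cofibration (A : V) [IsCofibrant A] {X Y : V} (j : X ⟶ Y)
    [Cofibration j] [WeakEquivalence j] : WeakEquivalence (A ◁ j) :=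
  IsMonoidalModel.weakEquivalence_right (initial.to A) j (initialSquare A j)

instance isCofibrant_tensor (A X : V) [IsCofibrant A] [IsCofibrant X] : IsCofibrant (A ⊗ X) := by
  rw [isCofibrant_iff_of_isInitial (A ◁ initial.to X) (isInitialTensorLeft A)]
  infer_instance

lemma weakEquivalence_whiskerLeft (A : V) [IsCofibrant A] {X Y : V} [IsCofibrant X]
    [IsCofibrant Y] (f : X ⟶ Y) [WeakEquivalence f] : WeakEquivalence (A ◁ f) := by
  obtain ⟨h⟩ := (inferInstance : Nonempty (CofibrantBrownFactorization f))
  have : WeakEquivalence (A ◁ h.i) := weakEquivalence_whiskerLeft_of_cofibration A h.i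
  have : WeakEquivalence (A ◁ h.s) := weakEquivalence_whiskerLeft_of_cofibration A h.s
  have : WeakEquivalence (A ◁ h.p) :=
    weakEquivalence_of_precomp_of_fac (f := A ◁ h.s) (fg := 𝟙 _)
      (by rw [← MonoidalCategory.whiskerLeft_comp, h.s_p, MonoidalCategory.whiskerLeft_id])
  rw [← h.fac, MonoidalCategory.whiskerLeft_comp]
  infer_instance

lemma weakEquivalence_whiskerRight {X Y : V} [IsCofibrant X] [IsCofibrant Y] (f : X ⟶ Y)
    [WeakEquivalence f] (A : V) [IsCofibrant A] : WeakEquivalence (f ▷ A) := by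
  have := weakEquivalence_whiskerLeft A f
  have e : f ▷ A = (β_ X A).hom ≫ (A ◁ f) ≫ (β_ Y A).inv := by simp
  rw [e]
  infer_instance

variable [IsCofibrant (𝟙_ V)]

instance : (cofibrantObjects V).IsMonoidal where
  prop_unit := inferInstanceAs (IsCofibrant (𝟙_ V))
  prop_tensor X Y hX hY := by
    have : IsCofibrant X := hX
    have : IsCofibrant Y := hY
    exact isCofibrant_tensor X Y

instance : (weakEquivalences (CofibrantObject V)).IsMonoidal where
  whiskerLeft X {Y₁ Y₂} g hg := by
    have : WeakEquivalence g.hom := (weakEquivalence_iff _).2 hg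
    have := weakEquivalence_whiskerLeft X.obj g.hom
    exact mem_weakEquivalences (X.obj ◁ g.hom)
  whiskerRight {X₁ X₂} f hf Y := by
    have : WeakEquivalence f.hom := (weakEquivalence_iff _).2 hf
    have := weakEquivalence_whiskerRight f.hom Y.obj
    exact mem_weakEquivalences (f.hom ▷ Y.obj)

variable (V) in
/-- The homotopy category `Ho(V)`: the localization of `V` at its weak equivalences. As the
restriction of `V ⥤ Ho(V)` to cofibrant objects is also a localization functor, `Ho(V)` is
equipped with the derived tensor product, i.e. the monoidal structure for which this restriction
is a (strong) monoidal functor. The unit is the image of the unit of `V`. -/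
abbrev Ho : Type u :=
  LocalizedMonoidal (CofibrantObject.ι ⋙ (weakEquivalences V).Q)
    (weakEquivalences (CofibrantObject V)) (Iso.refl _)

variable (V) in
/-- The localization functor on cofibrant objects. -/
noncomputable abbrev toHoc : CofibrantObject V ⥤ Ho V :=
  Localization.Monoidal.toMonoidalCategory _ _ _

variable (V) in
/-- The localization functor `V ⥤ Ho(V)`. -/
def toHo : V ⥤ Ho V := (weakEquivalences V).Q

instance isIso_toHo_map {X Y : V} (f : X ⟶ Y) [WeakEquivalence f] : IsIso ((toHo V).map f) :=
  Localization.inverts (weakEquivalences V).Q _ f (mem_weakEquivalences f)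

variable (V) in
/-- `toHoc` is the restriction of `toHo`. -/
noncomputable def toHocIso : toHoc V ⟶ CofibrantObject.ι ⋙ toHo V := 𝟙 _

instance (X : V) : IsIso (elt CofibrantObject.ι (toHo V) (toHoc V) (toHocIso V) (resp X)) := by
  have : elt CofibrantObject.ι (toHo V) (toHoc V) (toHocIso V) (resp X) = (toHo V).map (resp X) :=
    Category.id_comp _
  rw [this]
  exact isIso_toHo_map (resp X)

/-- The localization functor `V ⥤ Ho(V)` is lax monoidal for the derived tensor product. -/
noncomputable instance : (toHo V).LaxMonoidal :=
  derivedLax CofibrantObject.ι (toHo V) (toHoc V) (toHocIso V) res resp exists_lift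

end

end MonoidalModel

/-! ### Change of base for enriched functors -/

section ChangeOfBase

open Functor.LaxMonoidal

variable {V W : Type*} [Category* V] [Category* W] [MonoidalCategory V] [MonoidalCategory W]
  (F : V ⥤ W) [F.LaxMonoidal] {A B : Type*} [EnrichedCategory V A] [EnrichedCategory V B]

/-- Change of base of an enriched functor along a lax monoidal functor. -/
def changeOfBase (G : EnrichedFunctor V A B) :
    EnrichedFunctor W (TransportEnrichment F A) (TransportEnrichment F B) where
  obj := G.obj
  map X Y := F.map (G.map X Y)
  map_id (X : A) := by
    have h : (ε F ≫ F.map (eId V X)) ≫ F.map (G.map X X) =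
        ε F ≫ F.map (eId V (G.obj X)) := by
      rw [Category.assoc, ← F.map_comp, G.map_id]
    exact h
  map_comp (X Y Z : A) := by
    have h : (μ F _ _ ≫ F.map (eComp V X Y Z)) ≫ F.map (G.map X Z) =
        (F.map (G.map X Y) ⊗ₘ F.map (G.map Y Z)) ≫ μ F _ _ ≫
          F.map (eComp V (G.obj X) (G.obj Y) (G.obj Z)) := by
      rw [Category.assoc, ← F.map_comp, G.map_comp, μ_natural_assoc, F.map_comp]
    exact h

end ChangeOfBase

/-! ### The category of small `V`-categories -/

section VCat

variable (V : Type u) [Category.{w} V] [MonoidalCategory V]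

/-- Small `V`-categories. -/
structure VCat where
  /-- the set of objects -/
  carrier : Type w
  [str : EnrichedCategory V carrier]

namespace VCat

instance : CoeSort (VCat V) (Type w) := ⟨carrier⟩

attribute [instance] str

variable {V}

/-- The category `V-Cat` of small `V`-categories and `V`-functors. -/
instance : Category (VCat V) where
  Hom A B := EnrichedFunctor V A B
  id A := EnrichedFunctor.id V A
  comp f g := EnrichedFunctor.comp V f g
  id_comp _ := EnrichedFunctor.ext V (fun _ => rfl)
    (fun _ _ => (Category.comp_id _).trans (Category.id_comp _))
  comp_id _ := EnrichedFunctor.ext V (fun _ => rfl)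
    (fun _ _ => (Category.comp_id _).trans (Category.comp_id _))
  assoc _ _ _ := EnrichedFunctor.ext V (fun _ => rfl)
    (fun _ _ => (Category.comp_id _).trans (Category.assoc _ _ _))

/-- The `V`-functor underlying a morphism in `V-Cat`. -/
def toFunctor {A B : VCat V} (f : A ⟶ B) : EnrichedFunctor V A B := f

section

variable [HasBinaryProducts V] (A B : VCat V)

/-- The product of two `V`-categories. -/
noncomputable instance prodStr : EnrichedCategory V (A × B) where
  Hom x y := (x.1 ⟶[V] y.1) ⨯ (x.2 ⟶[V] y.2)
  id x := prod.lift (eId V x.1) (eId V x.2)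
  comp x y z := prod.lift ((prod.fst ⊗ₘ prod.fst) ≫ eComp V x.1 y.1 z.1)
    ((prod.snd ⊗ₘ prod.snd) ≫ eComp V x.2 y.2 z.2)
  id_comp x y := by
    ext
    · rw [Category.assoc, Category.assoc, prod.lift_fst, ← tensorHom_id,
        tensorHom_comp_tensorHom_assoc, prod.lift_fst, Category.id_comp,
        MonoidalCategory.tensorHom_def', Category.assoc, ← leftUnitor_inv_naturality_assoc,
        e_id_comp, Category.comp_id]
    · rw [Category.assoc, Category.assoc, prod.lift_snd, ← tensorHom_id,
        tensorHom_comp_tensorHom_assoc, prod.lift_snd, Category.id_comp,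
        MonoidalCategory.tensorHom_def', Category.assoc, ← leftUnitor_inv_naturality_assoc,
        e_id_comp, Category.comp_id]
  comp_id x y := by
    ext
    · rw [Category.assoc, Category.assoc, prod.lift_fst, ← id_tensorHom,
        tensorHom_comp_tensorHom_assoc, prod.lift_fst, Category.id_comp,
        MonoidalCategory.tensorHom_def, Category.assoc, ← rightUnitor_inv_naturality_assoc,
        e_comp_id, Category.comp_id]
    · rw [Category.assoc, Category.assoc, prod.lift_snd, ← id_tensorHom,
        tensorHom_comp_tensorHom_assoc, prod.lift_snd, Category.id_comp,
        MonoidalCategory.tensorHom_def, Category.assoc, ← rightUnitor_inv_naturality_assoc,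
        e_comp_id, Category.comp_id]
  assoc x y z t := by
    have h₁ {X₁ X₂ X₃ Y₁ Y₂ Y₃ Z T : V} (f : X₁ ⟶ Y₁) (g : X₂ ⟶ Y₂) (h : X₃ ⟶ Y₃)
        (c : Y₁ ⊗ Y₂ ⟶ Z) (d : Z ⊗ Y₃ ⟶ T) :
        (α_ _ _ _).inv ≫ ((f ⊗ₘ g) ≫ c ⊗ₘ h) ≫ d =
          (f ⊗ₘ g ⊗ₘ h) ≫ (α_ _ _ _).inv ≫ c ▷ _ ≫ d := by
      rw [associator_inv_naturality_assoc, ← tensorHom_id, tensorHom_comp_tensorHom_assoc,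
        Category.comp_id]
    have h₂ {X₁ X₂ X₃ Y₁ Y₂ Y₃ Z T : V} (f : X₁ ⟶ Y₁) (g : X₂ ⟶ Y₂) (h : X₃ ⟶ Y₃)
        (c : Y₂ ⊗ Y₃ ⟶ Z) (d : Y₁ ⊗ Z ⟶ T) :
        (f ⊗ₘ (g ⊗ₘ h) ≫ c) ≫ d = (f ⊗ₘ g ⊗ₘ h) ≫ _ ◁ c ≫ d := by
      rw [← id_tensorHom, tensorHom_comp_tensorHom_assoc, Category.comp_id]
    ext
    · simp only [Category.assoc, prod.lift_fst]
      rw [← tensorHom_id, ← id_tensorHom, tensorHom_comp_tensorHom_assoc,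
        tensorHom_comp_tensorHom_assoc, prod.lift_fst, prod.lift_fst, Category.id_comp,
        Category.id_comp, h₁, h₂, e_assoc]
    · simp only [Category.assoc, prod.lift_snd]
      rw [← tensorHom_id, ← id_tensorHom, tensorHom_comp_tensorHom_assoc,
        tensorHom_comp_tensorHom_assoc, prod.lift_snd, prod.lift_snd, Category.id_comp,
        Category.id_comp, h₁, h₂, e_assoc]

/-- The product of two `V`-categories, as an object of `V-Cat`. -/
noncomputable def prodObj : VCat V := ⟨A × B⟩

/-- The first projection. -/
noncomputable def prodFst : prodObj A B ⟶ A :=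
  show EnrichedFunctor V (A × B) A from
  { obj x := x.1
    map _ _ := prod.fst
    map_id _ := prod.lift_fst _ _
    map_comp _ _ _ := prod.lift_fst _ _ }

/-- The second projection. -/
noncomputable def prodSnd : prodObj A B ⟶ B :=
  show EnrichedFunctor V (A × B) B from
  { obj x := x.2
    map _ _ := prod.snd
    map_id _ := prod.lift_snd _ _
    map_comp _ _ _ := prod.lift_snd _ _ }

/-- The `V`-functor to a product induced by two `V`-functors. -/
noncomputable def prodLift {A B T : VCat V} (f : T ⟶ A) (g : T ⟶ B) : T ⟶ prodObj A B :=
  let f' : EnrichedFunctor V T A := f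
  let g' : EnrichedFunctor V T B := g
  show EnrichedFunctor V T (A × B) from
  { obj x := (f'.obj x, g'.obj x)
    map x y := prod.lift (f'.map x y) (g'.map x y)
    map_id x := by
      apply prod.hom_ext
      · rw [Category.assoc, prod.lift_fst, EnrichedFunctor.map_id]
        exact (prod.lift_fst _ _).symm
      · rw [Category.assoc, prod.lift_snd, EnrichedFunctor.map_id]
        exact (prod.lift_snd _ _).symm
    map_comp x y z := by
      apply prod.hom_ext
      · rw [Category.assoc, prod.lift_fst, EnrichedFunctor.map_comp, Category.assoc]
        refine Eq.trans ?_ ((prod.lift (f'.map x y) (g'.map x y) ⊗ₘ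
          prod.lift (f'.map y z) (g'.map y z)) ≫= (prod.lift_fst _ _).symm)
        rw [tensorHom_comp_tensorHom_assoc, prod.lift_fst, prod.lift_fst]
      · rw [Category.assoc, prod.lift_snd, EnrichedFunctor.map_comp, Category.assoc]
        refine Eq.trans ?_ ((prod.lift (f'.map x y) (g'.map x y) ⊗ₘ
          prod.lift (f'.map y z) (g'.map y z)) ≫= (prod.lift_snd _ _).symm)
        rw [tensorHom_comp_tensorHom_assoc, prod.lift_snd, prod.lift_snd] }

lemma prodLift_fst {A B T : VCat V} (f : T ⟶ A) (g : T ⟶ B) :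
    prodLift f g ≫ prodFst A B = f :=
  EnrichedFunctor.ext V (fun _ => rfl)
    (fun _ _ => (Category.comp_id _).trans (prod.lift_fst _ _))

lemma prodLift_snd {A B T : VCat V} (f : T ⟶ A) (g : T ⟶ B) :
    prodLift f g ≫ prodSnd A B = g :=
  EnrichedFunctor.ext V (fun _ => rfl)
    (fun _ _ => (Category.comp_id _).trans (prod.lift_snd _ _))

lemma prodLift_comp {A B T : VCat V} (h : T ⟶ prodObj A B) :
    prodLift (h ≫ prodFst A B) (h ≫ prodSnd A B) = h :=
  EnrichedFunctor.ext V (fun _ => rfl)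
    (fun _ _ => (Category.comp_id _).trans
      (prod.hom_ext (prod.lift_fst _ _) (prod.lift_snd _ _)))

/-- `prodObj A B` is the product of `A` and `B` in `V-Cat`. -/
noncomputable def prodIsLimit (A B : VCat V) :
    IsLimit (BinaryFan.mk (prodFst A B) (prodSnd A B)) :=
  BinaryFan.isLimitMk (fun s => prodLift s.fst s.snd) (fun s => prodLift_fst _ _)
    (fun s => prodLift_snd _ _) (fun s m h₁ h₂ => by rw [← h₁, ← h₂, prodLift_comp])

instance : HasBinaryProducts (VCat V) :=
  have (A B : VCat V) : HasLimit (pair A B) := ⟨⟨_, prodIsLimit A B⟩⟩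
  hasBinaryProducts_of_hasLimit_pair _

end
end VCat
end VCat

/-! ### Further conditions on a monoidal model category -/

section Conditions

/-- Given a class `P` of morphisms in a monoidal category, this is the class `P ⊗ V` of the
morphisms `i ⊗ Y` for `i` in `P` and `Y` an object. -/
inductive tensored {V : Type u} [Category.{w} V] [MonoidalCategory V] (P : MorphismProperty V) :
    MorphismProperty V
  | mk {A B : V} (i : A ⟶ B) (hi : P i) (Y : V) : tensored P (i ▷ Y)

/-- Relative cell complexes: transfinite compositions of pushouts of (small) coproducts
of morphisms in `P`. -/
def cells {V : Type u} [Category.{w} V] (P : MorphismProperty V) : MorphismProperty V :=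
  MorphismProperty.transfiniteCompositions.{w} (MorphismProperty.coproducts.{w} P).pushouts

/-- The object `A` is small relative to the class `P`: for some cardinal `κ` and all regular
cardinals `μ ≥ κ`, the functor `Hom(A, -)` commutes with the colimits of the
`μ`-sequences of morphisms in `P`. -/
def IsSmallRelativeTo {V : Type u} [Category.{w} V] (P : MorphismProperty V) (A : V) : Prop :=
  ∃ κ : Cardinal.{w}, ∀ μ : Cardinal.{w}, μ.IsRegular → κ ≤ μ →
    ∀ [OrderBot μ.ord.ToType] {X Y : V} (f : X ⟶ Y)
      (h : P.TransfiniteCompositionOfShape μ.ord.ToType f),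
      PreservesColimit h.F (coyoneda.obj (Opposite.op A))

variable (V : Type u) [Category.{w} V] [MonoidalCategory V] [ModelCategory V]

/-- The model category `V` is cofibrantly generated, by sets `I` and `J` of morphisms
whose domains are small relative to `(cofibrations ⊗ V)`-cell complexes and
`(trivial cofibrations ⊗ V)`-cell complexes respectively. -/
def IsCofibrantlyGeneratedMonoidal : Prop :=
  ∃ I J : MorphismProperty V,
    MorphismProperty.IsSmall.{w} I ∧ MorphismProperty.IsSmall.{w} J ∧
    trivialFibrations V = I.rlp ∧ fibrations V = J.rlp ∧
    (∀ {A B : V} (i : A ⟶ B), I i → IsSmallRelativeTo (cells (tensored (cofibrations V))) A) ∧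
    (∀ {A B : V} (j : A ⟶ B), J j →
      IsSmallRelativeTo (cells (tensored (trivialCofibrations V))) A)

/-- The monoid axiom: all `(trivial cofibrations ⊗ V)`-cell complexes are weak equivalences. -/
def MonoidAxiom : Prop := cells (tensored (trivialCofibrations V)) ≤ weakEquivalences V

end Conditions

/-- Right properness: `W` is stable under pullback along morphisms in `F`. -/
def IsRightProper {C : Type*} [Category* C] (W F : MorphismProperty C) : Prop :=
  ∀ {P X Y Z : C} {fst : P ⟶ X} {snd : P ⟶ Y} {f : X ⟶ Z} {g : Y ⟶ Z},
    IsPullback fst snd f g → F f → W g → W fst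

/-- The classes `W`, `C` and `F` are the weak equivalences, the cofibrations and the fibrations
of a right proper model structure on the category `M`. -/
def IsRightProperModelStructure {M : Type*} [Category* M] (W C F : MorphismProperty M) : Prop :=
  (∃ _ : ModelCategory M,
    weakEquivalences M = W ∧ cofibrations M = C ∧ fibrations M = F) ∧ IsRightProper W F

/-! ### Weak equivalences, fibrations and cofibrations of `V`-categories -/

section Classes

variable {V : Type u} [Category.{w} V] [MonoidalCategory V]

/-- The `V`-functors which are locally in a class `P` of morphisms of `V`. -/
def locally (P : MorphismProperty V) : MorphismProperty (VCat V) :=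
  fun A _ f => ∀ x y : A, P ((VCat.toFunctor f).map x y)

variable [ModelCategory V]

/-- A `V`-category is locally fibrant if all its hom-objects are fibrant. -/
def IsLocallyFibrant (A : VCat V) : Prop := ∀ x y : A, IsFibrant (x ⟶[V] y)

variable [MonoidalClosed V] [SymmetricCategory V] [IsMonoidalModel V] [IsCofibrant (𝟙_ V)]

/-- The category `[A]_V`: it has the objects of `A`, the morphisms from `x` to `y` are the
morphisms from the unit to `A(x, y)` in `Ho(V)`. -/
abbrev HoCat (A : VCat V) : Type w := ForgetEnrichment (Ho V) (TransportEnrichment (toHo V) A)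

/-- The functor `[f]_V : [A]_V ⥤ [B]_V` induced by a `V`-functor `f : A ⟶ B`. -/
noncomputable def hoFunctor {A B : VCat V} (f : A ⟶ B) : HoCat A ⥤ HoCat B :=
  (changeOfBase (toHo V) (VCat.toFunctor f)).forget

variable (V)

/-- Weak equivalences in `V-Cat`. -/
def weqs : MorphismProperty (VCat V) :=
  fun _ _ f => locally (weakEquivalences V) f ∧ (hoFunctor f).EssSurj

/-- Fibrations in `V-Cat`. -/
def fibs : MorphismProperty (VCat V) :=
  fun A B f => locally (fibrations V) f ∧
    ∀ (x : HoCat A) (y' : HoCat B) (v : y' ≅ (hoFunctor f).obj x),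
      ∃ (x' : HoCat A) (u : x' ≅ x) (h : (hoFunctor f).obj x' = y'),
        (hoFunctor f).map u.hom = eqToHom h ≫ v.hom

/-- Cofibrations in `V-Cat`. -/
def cofs : MorphismProperty (VCat V) := (fibs V ⊓ weqs V).llp

end Classes

end EnrichedModel

/-! The proof is Quillen's path object argument for the classes `weqs V` and `fibs V`; its formal
part is `isRightProperModelStructure_of_path`. A morphism between locally fibrant `V`-categories
factors through its mapping path object as a weak equivalence followed by a fibration. A general `f
: A ⟶ B` is replaced by `A' ⟶ B'` with `A'` and `B'` locally fibrant, and the factorization of the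
latter is pulled back along `B ⟶ B'`; right properness keeps the first factor a weak equivalence.
Combined with the factorization into a cofibration followed by a trivial fibration, this gives the
second factorization and the remaining lifting axiom. Three inputs are not formal.

Factorizations. The trivial fibrations are the local trivial fibrations which are surjective on
objects (`surjTrivFibs_eq`). Surjectivity is arranged by adding a discrete `V`-category; the rest is
a small object argument for `V`-categories with a fixed set of objects
(`FixCat.exists_factorization`). For this one has to control the hom-objects of the free extension
`E` of `A` by cells `j s : X s ⟶ Y s` attached along `X s ⟶ A(src s, tgt s)`. The module `E(x, -)`
is the free `A`-module on `A(x, -)` with additional actions `M (src s) ⊗ Y s ⟶ M (tgt s)` extending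
those of `X s`. It is the colimit of a sequence of stages, each of which after the first attaches
the pushout-products of the preceding transition morphism with the `j s`. Composition in `E` and its
universal property follow from freeness, by means of cotensors of modules. So `A(x, y) ⟶ E(x, y)` is
a countable composition of attachments of cells `i ⊗ W`, with `i` in any class containing the `j s`
and closed under pushout-products. Refining a transfinite sequence of such morphisms along a
lexicographic order (`LexNat`) gives an honest cell complex, to which the monoid axiom and the
smallness hypotheses apply.

Colimits of `V`-categories. The same free extensions, for the cells `∅ ⟶ Y` and `R ⨿ R ⟶ R`, provide
generators and relations, and hence all colimits (`CatDiagram.exists_colimit`).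

Base change of fibrations (`fibs_pbSnd`). Isomorphisms of `[A]_V` live in `Ho(V)`, which does not
see pullbacks. But the unit is cofibrant, so over fibrant hom-objects such an isomorphism is
represented by a point `𝟙_ V ⟶ A(x, y)`, and it can be lifted strictly through a fibration. A point
is invertible in `[A]_V` exactly when all postcompositions with it are weak equivalences
(`isIso_hoMk_iff`); this uses that localization reflects weak equivalences. In a pullback,
postcomposition with a point is a morphism between pullbacks along fibrations, and the gluing lemma
for right proper model categories (`weakEquivalence_of_isPullback`) concludes. The general case
reduces to this one by locally fibrant replacements which do not change the objects. -/

namespace EnrichedModel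

/-! ### Cell attachments -/

section CellAttachment

variable {C D : Type*} [Category* C] [Category* D]

/-- The morphism `f : A ⟶ B` is obtained by attaching the cells `g s : X s ⟶ Y s` to `A` along
`a s : X s ⟶ A`: this is a pushout of the coproduct of the `g s`, expressed by its universal
property. -/
structure IsCellAttachment {S : Type*} {A B : C} (f : A ⟶ B) {X Y : S → C}
    (g : ∀ s, X s ⟶ Y s) (a : ∀ s, X s ⟶ A) (b : ∀ s, Y s ⟶ B) : Prop where
  w (s : S) : g s ≫ b s = a s ≫ f
  hom_ext {Z : C} {p q : B ⟶ Z} : f ≫ p = f ≫ q → (∀ s, b s ≫ p = b s ≫ q) → p = q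
  exists_desc {Z : C} (p : A ⟶ Z) (q : ∀ s, Y s ⟶ Z) : (∀ s, g s ≫ q s = a s ≫ p) →
    ∃ d : B ⟶ Z, f ≫ d = p ∧ ∀ s, b s ≫ d = q s

namespace IsCellAttachment

section

variable {S : Type*} {A B : C} {f : A ⟶ B} {X Y : S → C} {g : ∀ s, X s ⟶ Y s}
  {a : ∀ s, X s ⟶ A} {b : ∀ s, Y s ⟶ B}

/-- Left adjoints preserve cell attachments. -/
lemma map (h : IsCellAttachment f g a b) (F : C ⥤ D) [F.IsLeftAdjoint] :
    IsCellAttachment (F.map f) (fun s => F.map (g s)) (fun s => F.map (a s))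
      (fun s => F.map (b s)) where
  w s := by rw [← F.map_comp, ← F.map_comp, h.w]
  hom_ext {Z p q} hp hq := by
    let adj := Adjunction.ofIsLeftAdjoint F
    apply (adj.homEquiv _ _).injective
    apply h.hom_ext
    · rw [← adj.homEquiv_naturality_left, hp, adj.homEquiv_naturality_left]
    · intro s
      rw [← adj.homEquiv_naturality_left, hq, adj.homEquiv_naturality_left]
  exists_desc {Z} p q hpq := by
    let adj := Adjunction.ofIsLeftAdjoint F
    obtain ⟨d, hd, hd'⟩ := h.exists_desc (adj.homEquiv _ _ p) (fun s => adj.homEquiv _ _ (q s))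
      (fun s => by rw [← adj.homEquiv_naturality_left, hpq, adj.homEquiv_naturality_left])
    refine ⟨(adj.homEquiv _ _).symm d, ?_, fun s => ?_⟩
    · rw [← adj.homEquiv_naturality_left_symm, hd, Equiv.symm_apply_apply]
    · rw [← adj.homEquiv_naturality_left_symm, hd', Equiv.symm_apply_apply]

/-- If the cells are themselves obtained by attaching cells, then one may directly attach
these finer cells. -/
lemma trans (h : IsCellAttachment f g a b) {T : S → Type*} {P Q : ∀ s, T s → C}
    {k : ∀ s t, P s t ⟶ Q s t} {c : ∀ s t, P s t ⟶ X s} {d : ∀ s t, Q s t ⟶ Y s}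
    (h' : ∀ s, IsCellAttachment (g s) (k s) (c s) (d s)) :
    IsCellAttachment f (fun x : Σ s, T s => k x.1 x.2) (fun x => c x.1 x.2 ≫ a x.1)
      (fun x => d x.1 x.2 ≫ b x.1) where
  w x := by rw [← Category.assoc, (h' x.1).w, Category.assoc, h.w, Category.assoc]
  hom_ext {Z p q} hp hq := h.hom_ext hp (fun s => (h' s).hom_ext
    (by rw [← Category.assoc, ← Category.assoc, h.w, Category.assoc, hp, Category.assoc])
    (fun t => by simpa using hq ⟨s, t⟩))
  exists_desc {Z} p q hpq := by
    choose e he he' using fun s => (h' s).exists_desc (a s ≫ p) (fun t => q ⟨s, t⟩)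
      (fun t => by simpa using hpq ⟨s, t⟩)
    obtain ⟨l, hl, hl'⟩ := h.exists_desc p e he
    exact ⟨l, hl, fun x => by rw [Category.assoc, hl', he']⟩

end

section

variable {S : Type w} {A : C} {X Y : S → C} (g : ∀ s, X s ⟶ Y s) (a : ∀ s, X s ⟶ A)

variable (A) in
lemma sigma_desc [HasCoproducts.{w} C] [HasPushouts C] :
    IsCellAttachment (pushout.inr (Limits.Sigma.map g) (Sigma.desc a)) g a
      (fun s => Sigma.ι Y s ≫ pushout.inl (Limits.Sigma.map g) (Sigma.desc a)) where
  w s := by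
    rw [← Sigma.ι_map_assoc, pushout.condition, Sigma.ι_desc_assoc]
  hom_ext hp hq := pushout.hom_ext (Sigma.hom_ext _ _ (fun s => by have := hq s; rwa [Category.assoc, Category.assoc] at this)) hp
  exists_desc p q hpq := by
    have h : Limits.Sigma.map g ≫ Limits.Sigma.desc q = Limits.Sigma.desc a ≫ p :=
      Sigma.hom_ext _ _ (fun s => by simp [hpq])
    refine ⟨pushout.desc (Limits.Sigma.desc q) p h, pushout.inr_desc _ _ _, fun s => ?_⟩
    rw [Category.assoc, pushout.inl_desc, Sigma.ι_desc]

variable {g a}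

/-- Cell attachments are pushouts of coproducts. -/
lemma mem_pushouts_coproducts [HasCoproducts.{w} C] {W : MorphismProperty C} {B : C} {f : A ⟶ B}
    {b : ∀ s, Y s ⟶ B} (h : IsCellAttachment f g a b) (hg : ∀ s, W (g s)) :
    (MorphismProperty.coproducts.{w} W).pushouts f := by
  have sq : CommSq (Sigma.desc a) (Limits.Sigma.map g) f (Sigma.desc b) :=
    ⟨Sigma.hom_ext _ _ (fun s => by simp [h.w])⟩
  have hd (s : PushoutCocone (Sigma.desc a) (Limits.Sigma.map g)) :=
    h.exists_desc s.inl (fun t => Sigma.ι Y t ≫ s.inr) (fun t => by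
        rw [← Sigma.ι_map_assoc, ← s.condition, Sigma.ι_desc_assoc])
  have hpo : IsPushout (Sigma.desc a) (Limits.Sigma.map g) f (Sigma.desc b) := by
    refine ⟨sq, ⟨PushoutCocone.IsColimit.mk _ (fun s => (hd s).choose)
      (fun s => (hd s).choose_spec.1) (fun s => Sigma.hom_ext _ _ (fun t => ?_))
      (fun s m h₁ h₂ => ?_)⟩⟩
    · rw [Sigma.ι_desc_assoc, (hd s).choose_spec.2]
    · refine h.hom_ext (h₁.trans (hd s).choose_spec.1.symm) (fun t => ?_)
      rw [(hd s).choose_spec.2, ← h₂, Sigma.ι_desc_assoc]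
  refine MorphismProperty.pushouts_mk _ hpo
    (MorphismProperty.colimitsOfShape_le_coproducts _ S _ ?_)
  exact MorphismProperty.colimitsOfShape_colimMap (W := W)
    (X := Discrete.functor X) (Y := Discrete.functor Y) (Discrete.natTrans (fun s => g s.as)) (fun s => hg s.as)

/-- Pushouts of coproducts are cell attachments. -/
lemma exists_of_mem_pushouts_coproducts {W : MorphismProperty C} {A B : C} {f : A ⟶ B}
    (hf : (MorphismProperty.coproducts.{w} W).pushouts f) :
    ∃ (S : Type w) (X Y : S → C) (g : ∀ s, X s ⟶ Y s) (a : ∀ s, X s ⟶ A) (b : ∀ s, Y s ⟶ B),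
      (∀ s, W (g s)) ∧ IsCellAttachment f g a b := by
  obtain ⟨A', B', f', t, l, hf', sq⟩ := hf
  rw [MorphismProperty.coproducts_iff] at hf'
  obtain ⟨S, ⟨X, Y, c₁, c₂, hc₁, hc₂, φ, hφ⟩⟩ := hf'
  refine ⟨S, fun s => X.obj ⟨s⟩, fun s => Y.obj ⟨s⟩, fun s => φ.app ⟨s⟩,
    fun s => c₁.ι.app ⟨s⟩ ≫ t, fun s => c₂.ι.app ⟨s⟩ ≫ l, fun s => hφ ⟨s⟩, ?_, ?_, ?_⟩
  · intro s
    simp [sq.w, hc₁.fac_assoc]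
  · intro Z p q hp hq
    refine sq.hom_ext hp (hc₂.hom_ext fun ⟨s⟩ => ?_)
    simpa using hq s
  · intro Z p q hpq
    refine ⟨sq.desc p (hc₂.desc (Cocone.mk Z (Discrete.natTrans (fun s => q s.as))))
      (hc₁.hom_ext fun ⟨s⟩ => ?_), by simp, fun s => ?_⟩
    · have := hpq s
      simp only [Category.assoc] at this
      rw [← this, hc₁.fac_assoc]
      simp [hc₂.fac]
    · simp [hc₂.fac]

end

section Monoidal

variable {V : Type u} [Category.{w} V] [MonoidalCategory V]

section

variable [MonoidalClosed V] {S : Type*} {A B : V} {f : A ⟶ B} {X Y : S → V}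
  {g : ∀ s, X s ⟶ Y s} {a : ∀ s, X s ⟶ A} {b : ∀ s, Y s ⟶ B}

variable [SymmetricCategory V]

instance isLeftAdjoint_tensorRight (W : V) : (tensorRight W).IsLeftAdjoint :=
  have : (tensorLeft W).IsLeftAdjoint := (ihom.adjunction W).isLeftAdjoint
  Functor.isLeftAdjoint_of_iso (BraidedCategory.tensorLeftIsoTensorRight W)

lemma whiskerRight (h : IsCellAttachment f g a b) (W : V) :
    IsCellAttachment (f ▷ W) (fun s => g s ▷ W) (fun s => a s ▷ W) (fun s => b s ▷ W) :=
  h.map (tensorRight W)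

/-- The pushout-product with `j` of a cell attachment is obtained by attaching the
pushout-products of the cells with `j`. -/
lemma pushoutProduct (h : IsCellAttachment f g a b) {K L : V} (j : K ⟶ L)
    (sq : (curriedTensor V).PushoutObjObj f j)
    (sq' : ∀ s, (curriedTensor V).PushoutObjObj (g s) j) :
    IsCellAttachment sq.ι (fun s => (sq' s).ι)
      (fun s => (sq' s).isPushout.desc (b s ▷ K ≫ sq.inl) (a s ▷ L ≫ sq.inr) (by
        have := a s ▷ K ≫= sq.isPushout.w
        dsimp at this ⊢
        rw [← comp_whiskerRight_assoc, h.w, comp_whiskerRight_assoc, this,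
          ← whisker_exchange_assoc]))
      (fun s => b s ▷ L) where
  w s := by
    apply (sq' s).isPushout.hom_ext
    · rw [Functor.PushoutObjObj.inl_ι_assoc, IsPushout.inl_desc_assoc, Category.assoc,
        Functor.PushoutObjObj.inl_ι]
      exact whisker_exchange _ _
    · rw [Functor.PushoutObjObj.inr_ι_assoc, IsPushout.inr_desc_assoc, Category.assoc,
        Functor.PushoutObjObj.inr_ι]
      dsimp
      rw [← comp_whiskerRight, h.w, comp_whiskerRight]
  hom_ext {Z p q} hp hq := by
    refine (h.whiskerRight L).hom_ext ?_ hq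
    have := sq.inr ≫= hp
    simpa using this
  exists_desc {Z} p q hpq := by
    have hpq₁ (s : S) : g s ▷ L ≫ q s = a s ▷ L ≫ sq.inr ≫ p := by
      have := (sq' s).inr ≫= hpq s
      rw [Functor.PushoutObjObj.inr_ι_assoc, IsPushout.inr_desc_assoc, Category.assoc] at this
      exact this
    have hpq₂ (s : S) : Y s ◁ j ≫ q s = b s ▷ K ≫ sq.inl ≫ p := by
      have := (sq' s).inl ≫= hpq s
      rw [Functor.PushoutObjObj.inl_ι_assoc, IsPushout.inl_desc_assoc, Category.assoc] at this
      exact this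
    obtain ⟨d, hd, hd'⟩ := (h.whiskerRight L).exists_desc (sq.inr ≫ p) q hpq₁
    refine ⟨d, sq.isPushout.hom_ext ?_ ?_, hd'⟩
    · rw [Functor.PushoutObjObj.inl_ι_assoc]
      refine (h.whiskerRight K).hom_ext ?_ (fun s => ?_)
      · dsimp
        rw [← whisker_exchange_assoc, hd]
        exact (sq.isPushout.w_assoc p).symm
      · dsimp
        rw [← whisker_exchange_assoc, hd', hpq₂]
    · rw [Functor.PushoutObjObj.inr_ι_assoc]
      exact hd

end

end Monoidal

end IsCellAttachment

end CellAttachment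

end EnrichedModel

namespace EnrichedModel

/-! ### Iterated transfinite compositions -/

/-- The lexicographic product of `J` and `ℕ`. -/
@[ext]
structure LexNat (J : Type*) where
  /-- the first coordinate -/
  fst : J
  /-- the second coordinate -/
  snd : ℕ

namespace LexNat

variable {J : Type*} [LinearOrder J]

noncomputable instance : LinearOrder (LexNat J) :=
  LinearOrder.lift' (fun p => toLex (p.fst, p.snd)) (fun p q h => by
    have := toLex.injective h
    ext
    · exact congrArg Prod.fst this
    · exact congrArg Prod.snd this)

lemma le_iff {p q : LexNat J} : p ≤ q ↔ p.fst < q.fst ∨ p.fst = q.fst ∧ p.snd ≤ q.snd :=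
  Prod.Lex.toLex_le_toLex

lemma lt_iff {p q : LexNat J} : p < q ↔ p.fst < q.fst ∨ p.fst = q.fst ∧ p.snd < q.snd :=
  Prod.Lex.toLex_lt_toLex

noncomputable instance : SuccOrder (LexNat J) :=
  SuccOrder.ofSuccLeIff (fun p => ⟨p.fst, p.snd + 1⟩) (by
    intro a b
    rw [le_iff, lt_iff]
    rfl)

noncomputable instance [OrderBot J] : OrderBot (LexNat J) where
  bot := ⟨⊥, 0⟩
  bot_le p := by
    rw [le_iff]
    rcases eq_or_lt_of_le (bot_le : ⊥ ≤ p.fst) with h | h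
    · exact Or.inr ⟨h, Nat.zero_le _⟩
    · exact Or.inl h

instance [WellFoundedLT J] : WellFoundedLT (LexNat J) :=
  ⟨InvImage.wf (fun p : LexNat J => (p.fst, p.snd))
    (WellFounded.prod_lex (wellFounded_lt (α := J)) (wellFounded_lt (α := ℕ))) |>.mono
      (fun {p q} h => by
        rcases lt_iff.1 h with h | h
        · exact Prod.Lex.left _ _ h
        · obtain ⟨j, n⟩ := p
          obtain ⟨k, m⟩ := q
          obtain ⟨rfl, h⟩ := h
          exact Prod.Lex.right _ h)⟩

/-- The place `(j, n + 1)` covers `(j, n)`, hence is not a limit: the limits of the lexicographic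
order are beginnings of rows. -/
lemma snd_eq_zero {p : LexNat J} (hp : Order.IsSuccLimit p) : p.snd = 0 := by
  by_contra h
  refine hp.isSuccPrelimit ⟨p.fst, p.snd - 1⟩ ⟨lt_iff.2 (Or.inr ⟨rfl, by dsimp; omega⟩), ?_⟩
  intro q h₁ h₂
  rw [lt_iff] at h₁ h₂
  dsimp at h₁ h₂
  rcases h₁ with h₁ | h₁ <;> rcases h₂ with h₂ | h₂
  · exact lt_asymm h₁ h₂
  · exact h₁.ne h₂.1.symm
  · exact h₂.ne h₁.1.symm
  · omega

variable [SuccOrder J] {C : Type*} [Category* C] {F : J ⥤ C}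

section

variable (h : ∀ j, CategoryTheory.TransfiniteCompositionOfShape ℕ
  (F.map (homOfLE (Order.le_succ j))))

/-- The morphism from the place `(j, n)` to the next stage. -/
def out (j : J) (n : ℕ) : (h j).F.obj n ⟶ F.obj (Order.succ j) :=
  (h j).incl.app n

/-- The morphism from the stage `j` to the place `(j, n)`. -/
def inn (j : J) (n : ℕ) : F.obj j ⟶ (h j).F.obj n :=
  (h j).isoBot.inv ≫ (h j).F.map (homOfLE bot_le)

lemma map_out (j : J) {n m : ℕ} (hnm : n ≤ m) :
    (h j).F.map (homOfLE hnm) ≫ out h j m = out h j n := by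
  exact ((h j).incl.naturality (homOfLE hnm)).trans (Category.comp_id _)

lemma inn_map (j : J) {n m : ℕ} (hnm : n ≤ m) :
    inn h j n ≫ (h j).F.map (homOfLE hnm) = inn h j m := by
  rw [inn, Category.assoc, ← Functor.map_comp]
  rfl

lemma inn_out (j : J) (n : ℕ) : inn h j n ≫ out h j n = F.map (homOfLE (Order.le_succ j)) := by
  rw [inn, Category.assoc, map_out, out]
  exact (h j).fac

/-- The transition morphisms. -/
noncomputable def map (p q : LexNat J) (hpq : p ≤ q) :
    (h p.fst).F.obj p.snd ⟶ (h q.fst).F.obj q.snd :=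
  if e : p.fst = q.fst then
    (h p.fst).F.map (homOfLE (by
      rcases le_iff.1 hpq with h' | h'
      · exact (h'.ne e).elim
      · exact h'.2)) ≫ eqToHom (by rw [e])
  else out h p.fst p.snd ≫ F.map (homOfLE (Order.succ_le_of_lt (by
      rcases le_iff.1 hpq with h' | h'
      · exact h'
      · exact (e h'.1).elim))) ≫ inn h q.fst q.snd

lemma map_eq (j : J) {n m : ℕ} (hnm : n ≤ m) (hpq : LexNat.mk j n ≤ LexNat.mk j m) :
    map h ⟨j, n⟩ ⟨j, m⟩ hpq = (h j).F.map (homOfLE hnm) := by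
  rw [map, dif_pos rfl, eqToHom_refl, Category.comp_id]

lemma map_of_lt {j k : J} (n m : ℕ) (hlt : j < k) (hpq : LexNat.mk j n ≤ LexNat.mk k m) :
    map h ⟨j, n⟩ ⟨k, m⟩ hpq =
      out h j n ≫ F.map (homOfLE (Order.succ_le_of_lt hlt)) ≫ inn h k m := by
  rw [map, dif_neg hlt.ne]

lemma map_map (p q r : LexNat J) (hpq : p ≤ q) (hqr : q ≤ r) :
    map h p q hpq ≫ map h q r hqr = map h p r (hpq.trans hqr) := by
  obtain ⟨j, n⟩ := p
  obtain ⟨k, m⟩ := q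
  obtain ⟨l, o⟩ := r
  rcases le_iff.1 hpq with h₁ | ⟨h₁, h₁'⟩ <;>
  rcases le_iff.1 hqr with h₂ | ⟨h₂, h₂'⟩ <;> dsimp at h₁ h₂
  · rw [map_of_lt h _ _ h₁, map_of_lt h _ _ h₂, map_of_lt h _ _ (h₁.trans h₂)]
    have := inn_out h k m =≫ F.map (homOfLE (Order.succ_le_of_lt h₂))
    simp only [Category.assoc] at this
    simp only [Category.assoc]
    rw [reassoc_of% this, ← F.map_comp_assoc, ← F.map_comp_assoc]
    rfl
  · subst h₂
    rw [map_of_lt h _ _ h₁, map_of_lt h _ _ h₁, map_eq h _ h₂', Category.assoc, Category.assoc,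
      inn_map]
  · subst h₁
    rw [map_of_lt h _ _ h₂, map_of_lt h _ _ h₂, map_eq h _ h₁', ← Category.assoc, map_out]
  · subst h₁ h₂
    rw [map_eq h _ h₁', map_eq h _ h₂', map_eq h _ (le_trans h₁' h₂'), ← Functor.map_comp]
    rfl

/-- The functor which refines `F` by the given compositions of shape `ℕ`. -/
@[simps]
noncomputable def functor : LexNat J ⥤ C where
  obj p := (h p.fst).F.obj p.snd
  map f := map h _ _ (leOfHom f)
  map_id p := (map_eq h p.fst le_rfl le_rfl).trans ((h _).F.map_id _)
  map_comp _ _ := (map_map h _ _ _ _ _).symm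

lemma inn_zero (j : J) : inn h j 0 = (h j).isoBot.inv := by
  have : (h j).F.map (homOfLE (bot_le : ⊥ ≤ 0)) = 𝟙 _ := (h j).F.map_id _
  exact ((h j).isoBot.inv ≫= this).trans (Category.comp_id _)

lemma inn_zero_map_inv {j k : J} (hjk : j < k) :
    inn h j 0 ≫ map h ⟨j, 0⟩ ⟨k, 0⟩ (le_iff.2 (Or.inl hjk)) = F.map (homOfLE hjk.le) ≫ inn h k 0 := by
  rw [map_of_lt h _ _ hjk, ← Category.assoc, inn_out, ← F.map_comp_assoc]
  rfl

/-- The cocone on `F` with point `s.pt` induced by a compatible family of morphisms. -/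
lemma inn_naturality {Z : C} {j : J} (s : ∀ p : LexNat J, p.fst < j → ((h p.fst).F.obj p.snd ⟶ Z))
    (hs : ∀ p q (hp : p.fst < j) (hq : q.fst < j) (hpq : p ≤ q), map h p q hpq ≫ s q hq = s p hp)
    {k l : J} (hk : k < j) (hl : l < j) (hkl : k ≤ l) :
    F.map (homOfLE hkl) ≫ inn h l 0 ≫ s ⟨l, 0⟩ hl = inn h k 0 ≫ s ⟨k, 0⟩ hk := by
  rcases eq_or_lt_of_le hkl with rfl | hkl
  · rw [show F.map (homOfLE hkl) = 𝟙 _ from F.map_id _, Category.id_comp]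
  · rw [← hs ⟨k, 0⟩ ⟨l, 0⟩ hk hl (le_iff.2 (Or.inl hkl)), ← Category.assoc, ← inn_zero_map_inv h hkl,
      Category.assoc]

/-- The place `(j, 0)` with `j ≠ ⊥` is a limit for one of two reasons. If `j` is a limit, the rows
below `j` are cofinal and the continuity of `F` applies; if `j` is the successor of `k`, the row `k`
is cofinal and its colimit is `F.obj j`. Both give the same universal property. -/
lemma exists_desc [OrderBot J] [WellFoundedLT J] [F.IsWellOrderContinuous] {Z : C} {j : J}
    (hj : j ≠ ⊥) (s : ∀ p : LexNat J, p.fst < j → ((h p.fst).F.obj p.snd ⟶ Z))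
    (hs : ∀ p q (hp : p.fst < j) (hq : q.fst < j) (hpq : p ≤ q), map h p q hpq ≫ s q hq = s p hp) :
    ∃ d : F.obj j ⟶ Z, (∀ (k : J) (n : ℕ) (hk : k < j),
      out h k n ≫ F.map (homOfLE (Order.succ_le_of_lt hk)) ≫ d = s ⟨k, n⟩ hk) ∧
      ∀ d', (∀ (k : J) (n : ℕ) (hk : k < j),
      out h k n ≫ F.map (homOfLE (Order.succ_le_of_lt hk)) ≫ d' = s ⟨k, n⟩ hk) → d' = d := by
  by_cases hl : Order.IsSuccLimit j
  · have hc := F.isColimitOfIsWellOrderContinuous j hl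
    let t : Cocone ((Set.principalSegIio j).monotone.functor ⋙ F) :=
      { pt := Z
        ι := { app := fun k => inn h k.1 0 ≫ s ⟨k.1, 0⟩ k.2
               naturality := fun k l f => by
                refine (inn_naturality h s hs k.2 l.2 (leOfHom f)).trans (Category.comp_id _).symm } }
    have ht (k : J) (hk : k < j) : F.map (homOfLE hk.le) ≫ hc.desc t = inn h k 0 ≫ s ⟨k, 0⟩ hk :=
      hc.fac t ⟨k, hk⟩
    refine ⟨hc.desc t, fun k n hk => ?_, fun d' hd' => hc.hom_ext fun k => ?_⟩
    · have hk' : Order.succ k < j := hl.succ_lt hk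
      have hkn : k < Order.succ k := Order.lt_succ_of_not_isMax (fun hm => hk.not_isMax hm)
      have := map_of_lt h n 0 hkn (le_iff.2 (Or.inl hkn))
      rw [ht _ hk', ← hs ⟨k, n⟩ ⟨Order.succ k, 0⟩ hk hk' (le_iff.2 (Or.inl hkn)), this,
        show F.map (homOfLE (Order.succ_le_of_lt hkn)) = 𝟙 _ from F.map_id _, Category.id_comp,
        Category.assoc]
    · refine Eq.trans ?_ (ht k.1 k.2).symm
      rw [← hd' k.1 0 k.2, ← Category.assoc, inn_out, ← F.map_comp_assoc]
      rfl
  · have : ¬ Order.IsSuccPrelimit j := fun h' => hl (by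
      refine ⟨fun hm => hj (hm.eq_bot), h'⟩)
    obtain ⟨k, hk⟩ := Order.not_isSuccPrelimit_iff.1 this
    obtain rfl := hk.succ_eq
    let t : Cocone (h k).F :=
      { pt := Z
        ι := { app := fun n => s ⟨k, n⟩ hk.lt
               naturality := fun n m f => by
                have := hs ⟨k, n⟩ ⟨k, m⟩ hk.lt hk.lt (le_iff.2 (Or.inr ⟨rfl, leOfHom f⟩))
                rw [map_eq h k (leOfHom f)] at this
                exact this.trans (Category.comp_id _).symm } }
    have ht (n : ℕ) : out h k n ≫ (h k).isColimit.desc t = s ⟨k, n⟩ hk.lt :=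
      (h k).isColimit.fac t n
    refine ⟨(h k).isColimit.desc t, fun l n hl => ?_, fun d' hd' => (h k).isColimit.hom_ext fun n => ?_⟩
    · rcases eq_or_lt_of_le (Order.le_of_lt_succ hl) with rfl | hlk
      · rw [show F.map (homOfLE (Order.succ_le_of_lt hl)) = 𝟙 _ from F.map_id _, Category.id_comp, ht]
      · rw [← hs ⟨l, n⟩ ⟨k, 0⟩ hl hk.lt (le_iff.2 (Or.inl hlk)), map_of_lt h n 0 hlk, ← ht,
          Category.assoc, Category.assoc, ← Category.assoc (inn h k 0), inn_out,
          ← F.map_comp_assoc]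
        rfl
    · refine Eq.trans ?_ (ht n).symm
      rw [← hd' k n hk.lt, show F.map (homOfLE (Order.succ_le_of_lt hk.lt)) = 𝟙 _ from F.map_id _,
        Category.id_comp]
      rfl

/-- Through `isoBot`, the place `(j, 0)` is a copy of `F.obj j`, so continuity there is the
universal property of `exists_desc`. -/
instance isWellOrderContinuous_functor [OrderBot J] [WellFoundedLT J] [F.IsWellOrderContinuous] :
    (functor h).IsWellOrderContinuous where
  nonempty_isColimit p hp := by
    obtain ⟨j, n⟩ := p
    obtain rfl : n = 0 := snd_eq_zero hp
    have hj : j ≠ ⊥ := fun e => hp.not_isMin (by subst e; exact isMin_bot)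
    have hlt {q : LexNat J} : q < ⟨j, 0⟩ ↔ q.fst < j := by simp [lt_iff]
    have key (s : Cocone ((Set.principalSegIio (LexNat.mk j 0)).monotone.functor ⋙ functor h)) :=
      exists_desc h hj (fun q hq => s.ι.app ⟨q, hlt.2 hq⟩)
        (fun p q hp hq hpq => by
          let f : (⟨p, hlt.2 hp⟩ : Set.Iio (LexNat.mk j 0)) ⟶ ⟨q, hlt.2 hq⟩ := homOfLE hpq
          exact s.w f)
    refine ⟨{ desc := fun s => (h j).isoBot.hom ≫ (key s).choose, fac := ?_, uniq := ?_ }⟩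
    · rintro s ⟨⟨k, n⟩, hq⟩
      have hk : k < j := hlt.1 hq
      refine Eq.trans ?_ ((key s).choose_spec.1 k n hk)
      have : map h ⟨k, n⟩ ⟨j, 0⟩ (le_of_lt hq) ≫ (h j).isoBot.hom =
          out h k n ≫ F.map (homOfLE (Order.succ_le_of_lt hk)) := by
        rw [map_of_lt h n 0 hk, inn_zero, Category.assoc, Category.assoc]
        exact (_ ≫= (_ ≫= (h j).isoBot.inv_hom_id)).trans (_ ≫= Category.comp_id _)
      exact (reassoc_of% this) _
    · intro s m hm
      have : (h j).isoBot.inv ≫ m = (key s).choose := by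
        refine (key s).choose_spec.2 _ (fun k n hk => ?_)
        refine Eq.trans ?_ (hm ⟨⟨k, n⟩, hlt.2 hk⟩)
        have := map_of_lt h n 0 hk (le_of_lt (hlt.2 hk))
        rw [inn_zero] at this
        exact Eq.trans ((Category.assoc _ _ _).trans (_ ≫= Category.assoc _ _ _)).symm
          (this =≫ m).symm
      exact (Iso.inv_comp_eq _).1 this

end

section

variable [OrderBot J] [WellFoundedLT J] [NoMaxOrder J] [F.IsWellOrderContinuous]
  {W : MorphismProperty C}
  (h : ∀ j, W.TransfiniteCompositionOfShape ℕ (F.map (homOfLE (Order.le_succ j))))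

include h in
/-- A transfinite composition of compositions of shape `ℕ` of morphisms in `W` is a transfinite
composition of morphisms in `W`. -/
theorem transfiniteCompositionsOfShape {c : Cocone F} (hc : IsColimit c) :
    W.transfiniteCompositionsOfShape (LexNat J) (c.ι.app ⊥) := by
  let h' := fun j => (h j).toTransfiniteCompositionOfShape
  let i : functor h' ⟶ (Functor.const _).obj c.pt :=
    { app := fun p => out h' p.fst p.snd ≫ c.ι.app (Order.succ p.fst)
      naturality := fun p q f => by
        refine Eq.trans ?_ (Category.comp_id _).symm
        obtain ⟨j, n⟩ := p
        obtain ⟨k, m⟩ := q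
        change map h' _ _ (leOfHom f) ≫ out h' k m ≫ c.ι.app (Order.succ k) =
          out h' j n ≫ c.ι.app (Order.succ j)
        rcases le_iff.1 (leOfHom f) with hlt | ⟨e, hle⟩
        · dsimp at hlt
          rw [map_of_lt h' n m hlt, Category.assoc, Category.assoc, ← Category.assoc (inn h' k m),
            inn_out, ← F.map_comp_assoc]
          congr 1
          exact c.w (homOfLE _)
        · dsimp at e
          subst e
          dsimp at hle
          rw [map_eq h' j hle, ← Category.assoc, map_out] }
  refine ⟨{ F := functor h', isoBot := (h ⊥).isoBot, incl := i, isColimit := ?_, fac := ?_,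
            map_mem := ?_ }⟩
  · have key (s : Cocone (functor h')) : ∃ d : c.pt ⟶ s.pt, (∀ j, c.ι.app j ≫ d =
        inn h' j 0 ≫ s.ι.app ⟨j, 0⟩) :=
      ⟨hc.desc ⟨s.pt, { app := fun j => inn h' j 0 ≫ s.ι.app ⟨j, 0⟩
                        naturality := fun j k f => by
                          -- `inn_naturality` concerns places strictly below a bound; the absence of
                          -- a maximum provides a bound above `k`.
                          obtain ⟨l, hl⟩ := exists_gt k
                          exact (inn_naturality h' (fun p _ => s.ι.app p)
                            (fun p q _ _ hpq => s.w (homOfLE hpq)) ((leOfHom f).trans_lt hl) hl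
                            (leOfHom f)).trans (Category.comp_id _).symm }⟩, fun j => hc.fac _ j⟩
    have hsucc (j : J) (n : ℕ) : map h' ⟨j, n⟩ ⟨Order.succ j, 0⟩
        (le_iff.2 (Or.inl (Order.lt_succ j))) = out h' j n ≫ inn h' (Order.succ j) 0 := by
      rw [map_of_lt h' n 0 (Order.lt_succ j),
        show F.map (homOfLE (Order.succ_le_of_lt (Order.lt_succ j))) = 𝟙 _ from F.map_id _,
        Category.id_comp]
    refine { desc := fun s => (key s).choose, fac := ?_, uniq := ?_ }
    · rintro s ⟨j, n⟩
      have := s.w (homOfLE (le_iff.2 (Or.inl (Order.lt_succ j)) : LexNat.mk j n ≤ ⟨Order.succ j, 0⟩))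
      refine Eq.trans ?_ this
      refine Eq.trans ?_ (hsucc j n =≫ _).symm
      refine Eq.trans (Category.assoc _ _ _) (Eq.trans ?_ (Category.assoc _ _ _).symm)
      exact out h' j n ≫= (key s).choose_spec (Order.succ j)
    · intro s m hm
      refine hc.hom_ext fun j => ?_
      have h₁ : c.ι.app j ≫ m = inn h' j 0 ≫ (out h' j 0 ≫ c.ι.app (Order.succ j)) ≫ m := by
        rw [Category.assoc, ← Category.assoc (inn h' j 0), inn_out, ← Category.assoc, c.w]
      exact h₁.trans ((inn h' j 0 ≫= hm ⟨j, 0⟩).trans ((key s).choose_spec j).symm)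
  · change (h ⊥).isoBot.inv ≫ out h' ⊥ 0 ≫ c.ι.app (Order.succ ⊥) = _
    have := inn_out h' ⊥ 0
    rw [inn_zero] at this
    rw [← Category.assoc]
    exact (this =≫ _).trans (c.w _)
  · rintro ⟨j, n⟩ -
    have := (h j).map_mem n (not_isMax n)
    have e : map h' ⟨j, n⟩ ⟨j, n + 1⟩ (Order.le_succ (LexNat.mk j n)) =
      (h j).F.map (homOfLE (Order.le_succ n)) := map_eq h' j (Order.le_succ n) _
    have this' : W (map h' ⟨j, n⟩ ⟨j, n + 1⟩ (Order.le_succ (LexNat.mk j n))) := by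
      rw [e]
      exact this
    exact this'

end

end LexNat
end EnrichedModel

namespace EnrichedModel

/-! ### Cell attachments with tensored cells -/

/-- Cells may be replaced by isomorphic ones. -/
lemma IsCellAttachment.of_iso {C : Type*} [Category* C] {S : Type*} {A B : C} {f : A ⟶ B}
    {X Y X' Y' : S → C} {g : ∀ s, X s ⟶ Y s} {a : ∀ s, X s ⟶ A} {b : ∀ s, Y s ⟶ B}
    (h : IsCellAttachment f g a b) (g' : ∀ s, X' s ⟶ Y' s) (e : ∀ s, X' s ≅ X s)
    (e' : ∀ s, Y' s ≅ Y s) (he : ∀ s, g' s ≫ (e' s).hom = (e s).hom ≫ g s) :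
    IsCellAttachment f g' (fun s => (e s).hom ≫ a s) (fun s => (e' s).hom ≫ b s) where
  w s := by rw [← Category.assoc, he, Category.assoc, h.w, Category.assoc]
  hom_ext hp hq := h.hom_ext hp (fun s => by
    have := hq s
    rwa [Category.assoc, Category.assoc, cancel_epi] at this)
  exists_desc p q hpq := by
    obtain ⟨d, hd, hd'⟩ := h.exists_desc p (fun s => (e' s).inv ≫ q s) (fun s => by
      have h₁ := hpq s
      have h₂ : g s ≫ (e' s).inv = (e s).inv ≫ g' s := by
        rw [Iso.comp_inv_eq, Category.assoc, he, Iso.inv_hom_id_assoc]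
      rw [← Category.assoc, h₂, Category.assoc, h₁, Category.assoc, Iso.inv_hom_id_assoc])
    exact ⟨d, hd, fun s => by rw [Category.assoc, hd', Iso.hom_inv_id_assoc]⟩

variable {V : Type u} [Category.{w} V] [MonoidalCategory V]

/-- The morphisms obtained by attaching cells of the form `i ▷ W` for `i` in `P`. -/
def tensoredCells (P : MorphismProperty V) : MorphismProperty V := fun A B f =>
  ∃ (S : Type w) (X Y W : S → V) (i : ∀ s, X s ⟶ Y s) (a : ∀ s, X s ⊗ W s ⟶ A)
    (b : ∀ s, Y s ⊗ W s ⟶ B), (∀ s, P (i s)) ∧ IsCellAttachment f (fun s => i s ▷ W s) a b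

namespace tensoredCells

variable {P : MorphismProperty V}

lemma le_pushouts [HasColimits V] :
    tensoredCells P ≤ (MorphismProperty.coproducts.{w} (tensored P)).pushouts := by
  rintro A B f ⟨S, X, Y, W, i, a, b, hi, h⟩
  exact h.mem_pushouts_coproducts (fun s => .mk _ (hi s) _)

lemma of_isCellAttachment {S : Type w} {A B : V} {f : A ⟶ B} {X Y : S → V}
    {g : ∀ s, X s ⟶ Y s} {a : ∀ s, X s ⟶ A} {b : ∀ s, Y s ⟶ B} (h : IsCellAttachment f g a b)
    (hg : ∀ s, tensoredCells P (g s)) : tensoredCells P f := by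
  choose T X' Y' W i a' b' hi h' using hg
  exact ⟨_, _, _, _, _, _, _, fun x => hi x.1 x.2, h.trans h'⟩

section

variable [SymmetricCategory V]

/-- The isomorphism `(X ⊗ Y) ⊗ W ≅ (X ⊗ W) ⊗ Y`. -/
def swap (X Y W : V) : (X ⊗ Y) ⊗ W ≅ (X ⊗ W) ⊗ Y :=
  α_ X Y W ≪≫ whiskerLeftIso X (β_ Y W) ≪≫ (α_ X W Y).symm

lemma swap_naturality_left {X X' : V} (f : X ⟶ X') (Y W : V) :
    (f ▷ Y) ▷ W ≫ (swap X' Y W).hom = (swap X Y W).hom ≫ (f ▷ W) ▷ Y := by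
  simp only [swap, Iso.trans_hom, whiskerLeftIso_hom, Iso.symm_hom, associator_naturality_left_assoc,
    Category.assoc]
  rw [← whisker_exchange_assoc, associator_inv_naturality_left]

lemma swap_naturality_middle (X : V) {Y Y' : V} (f : Y ⟶ Y') (W : V) :
    (X ◁ f) ▷ W ≫ (swap X Y' W).hom = (swap X Y W).hom ≫ (X ⊗ W) ◁ f := by
  simp only [swap, Iso.trans_hom, whiskerLeftIso_hom, Iso.symm_hom,
    associator_naturality_middle_assoc, Category.assoc]
  rw [← associator_inv_naturality_right, ← MonoidalCategory.whiskerLeft_comp_assoc,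
    BraidedCategory.braiding_naturality_left, MonoidalCategory.whiskerLeft_comp_assoc]

variable [MonoidalClosed V]

lemma whiskerRight {A B : V} {f : A ⟶ B} (hf : tensoredCells P f) (Z : V) :
    tensoredCells P (f ▷ Z) := by
  obtain ⟨S, X, Y, W, i, a, b, hi, h⟩ := hf
  exact ⟨S, X, Y, fun s => W s ⊗ Z, i, _, _, hi, (h.whiskerRight Z).of_iso _
    (fun s => (α_ (X s) (W s) Z).symm) (fun s => (α_ (Y s) (W s) Z).symm) (fun s => by simp)⟩

/-- The pushout-product of `i ▷ W` and `j` is isomorphic to the pushout-product of `i` and `j`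
tensored with `W`. -/
def pushoutObjObj {X Y K L : V} {i : X ⟶ Y} {j : K ⟶ L}
    (sq : (curriedTensor V).PushoutObjObj i j) (W : V) :
    (curriedTensor V).PushoutObjObj (i ▷ W) j where
  pt := sq.pt ⊗ W
  inl := (swap Y K W).inv ≫ sq.inl ▷ W
  inr := (swap X L W).inv ≫ sq.inr ▷ W
  isPushout := by
    have : PreservesColimit (span (((curriedTensor V).map i).app K)
      (((curriedTensor V).obj X).map j)) (tensorRight W) := inferInstance
    refine (sq.isPushout.map (tensorRight W)).of_iso (swap X K W) (swap Y K W) (swap X L W)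
      (Iso.refl _) ?_ ?_ ?_ ?_
    · exact swap_naturality_left i K W
    · exact swap_naturality_middle X j W
    · simp
    · simp
  ι := sq.ι ▷ W ≫ (swap Y L W).hom
  inl_ι := by
    rw [Category.assoc, ← comp_whiskerRight_assoc, Functor.PushoutObjObj.inl_ι, Iso.inv_comp_eq]
    exact swap_naturality_middle Y j W
  inr_ι := by
    rw [Category.assoc, ← comp_whiskerRight_assoc, Functor.PushoutObjObj.inr_ι, Iso.inv_comp_eq]
    exact swap_naturality_left i L W

/-- The pushout-product with a fixed `j` sends cell attachments to cell attachments, and a cell `i s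
▷ W s` to the pushout-product of `i s` and `j` tensored with `W s`. Closure of `P` under
pushout-products then keeps the new cells of the required form. -/
lemma pushoutProduct [HasColimits V]
    (hP : ∀ {X Y K L : V} (i : X ⟶ Y) (j : K ⟶ L) (sq : (curriedTensor V).PushoutObjObj i j),
      P i → P j → P sq.ι) {A B K L : V} {f : A ⟶ B} {j : K ⟶ L}
    (sq : (curriedTensor V).PushoutObjObj f j) (hf : tensoredCells P f) (hj : P j) :
    tensoredCells P sq.ι := by
  obtain ⟨S, X, Y, W, i, a, b, hi, h⟩ := hf
  let sq' (s : S) : (curriedTensor V).PushoutObjObj (i s) j := .ofHasPushout _ _ _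
  exact ⟨S, _, _, W, fun s => (sq' s).ι, _, _, fun s => hP _ _ _ (hi s) hj,
    (h.pushoutProduct j sq (fun s => pushoutObjObj (sq' s) (W s))).of_iso _
      (fun s => Iso.refl _) (fun s => swap _ _ _) (fun s => (Category.id_comp _).symm)⟩

end

/-- The index types allowed in `cells` live in the universe `w`, whence the copy of `ℕ` in that
universe. -/
lemma cells_of_nat [HasColimits V] {A B : V} {f : A ⟶ B}
    (hf : (tensoredCells P).transfiniteCompositionsOfShape ℕ f) : cells (tensored P) f :=
  MorphismProperty.transfiniteCompositionsOfShape_le_transfiniteCompositions _ (Shrink.{w} ℕ) _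
    (by
      rw [← MorphismProperty.transfiniteCompositionsOfShape_eq_of_orderIso _ (orderIsoShrink.{w} ℕ)]
      exact MorphismProperty.transfiniteCompositionsOfShape_monotone ℕ le_pushouts _ hf)

/-- Transfinite compositions of `ℕ`-indexed compositions of tensored cells are relative cell
complexes. -/
lemma cells_of_transfinite [HasColimits V] {J : Type w} [LinearOrder J] [SuccOrder J] [OrderBot J]
    [WellFoundedLT J] [NoMaxOrder J] {F : J ⥤ V} [F.IsWellOrderContinuous]
    (h : ∀ j, (tensoredCells P).transfiniteCompositionsOfShape ℕ
      (F.map (homOfLE (Order.le_succ j)))) {c : Cocone F} (hc : IsColimit c) :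
    cells (tensored P) (c.ι.app ⊥) :=
  MorphismProperty.transfiniteCompositionsOfShape_le_transfiniteCompositions _ (LexNat J) _
    (MorphismProperty.transfiniteCompositionsOfShape_monotone _ le_pushouts _
      (LexNat.transfiniteCompositionsOfShape (fun j => (h j).some) hc))

end tensoredCells

end EnrichedModel

namespace EnrichedModel

variable {V : Type u} [Category.{w} V] [MonoidalCategory V]

/-! ### Modules over enriched categories -/

/-- A (right) module over a `V`-category `A`. -/
structure RMod (A : VCat V) where
  /-- the underlying family of objects -/
  obj : A → V
  /-- the action of `A` -/
  act (x y : A) : obj x ⊗ (x ⟶[V] y) ⟶ obj y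
  act_id (x : A) : (ρ_ _).inv ≫ obj x ◁ eId V x ≫ act x x = 𝟙 _
  act_comp (x y z : A) : (α_ (obj x) _ _).hom ≫ obj x ◁ eComp V x y z ≫ act x z =
    act x y ▷ (y ⟶[V] z) ≫ act y z

namespace RMod

variable {A : VCat V}

lemma act_id_assoc (M : RMod A) (x : A) {Z : V} (h : M.obj x ⟶ Z) :
    (ρ_ _).inv ≫ M.obj x ◁ eId V x ≫ M.act x x ≫ h = h := by
  rw [reassoc_of% M.act_id x]

lemma act_comp_assoc (M : RMod A) (x y z : A) {Z : V} (h : M.obj z ⟶ Z) :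
    (α_ (M.obj x) _ _).hom ≫ M.obj x ◁ eComp V x y z ≫ M.act x z ≫ h =
      M.act x y ▷ (y ⟶[V] z) ≫ M.act y z ≫ h := by
  rw [reassoc_of% M.act_comp x y z]

/-- Morphisms of modules. -/
@[ext]
structure Hom (M N : RMod A) where
  /-- the underlying family of morphisms -/
  app (x : A) : M.obj x ⟶ N.obj x
  act_app (x y : A) : M.act x y ≫ app y = app x ▷ (x ⟶[V] y) ≫ N.act x y

lemma Hom.act_app_assoc {M N : RMod A} (f : Hom M N) (x y : A) {Z : V} (h : N.obj y ⟶ Z) :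
    M.act x y ≫ f.app y ≫ h = f.app x ▷ (x ⟶[V] y) ≫ N.act x y ≫ h := by
  rw [reassoc_of% f.act_app x y]

instance : Category (RMod A) where
  Hom := Hom
  id M := { app := fun _ => 𝟙 _, act_app := by simp }
  comp f g := { app := fun x => f.app x ≫ g.app x
                act_app := fun x y => by
                  rw [f.act_app_assoc, g.act_app, comp_whiskerRight_assoc] }

@[ext]
lemma hom_ext {M N : RMod A} {f g : M ⟶ N} (h : ∀ x, f.app x = g.app x) : f = g :=
  Hom.ext (funext h)

@[simp] lemma id_app (M : RMod A) (x : A) : Hom.app (𝟙 M) x = 𝟙 _ := rfl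

@[simp] lemma comp_app {M N P : RMod A} (f : M ⟶ N) (g : N ⟶ P) (x : A) :
    (f ≫ g).app x = f.app x ≫ g.app x := rfl

/-- The evaluation of a diagram of modules at an object. -/
@[reducible]
def ev {J : Type*} [Category* J] (F : J ⥤ RMod A) (x : A) : J ⥤ V where
  obj j := (F.obj j).obj x
  map φ := (F.map φ).app x
  map_id _ := by rw [F.map_id, id_app]
  map_comp _ _ := by rw [F.map_comp, comp_app]

/-- The representable module. -/
@[reducible]
def rep (z : A) : RMod A where
  obj x := z ⟶[V] x
  act x y := eComp V z x y
  act_id x := e_comp_id V z x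
  act_comp x y t := e_assoc' V z x y t

/-- The Yoneda lemma. -/
def yoneda {M : RMod A} {z : A} (a : 𝟙_ V ⟶ M.obj z) : rep z ⟶ M where
  app x := (λ_ _).inv ≫ a ▷ _ ≫ M.act z x
  act_app x y := by
    rw [comp_whiskerRight, comp_whiskerRight, Category.assoc, Category.assoc, ← M.act_comp,
      associator_naturality_left_assoc, ← whisker_exchange_assoc, leftUnitor_inv_naturality_assoc]
    simp

lemma eId_yoneda {M : RMod A} {z : A} (a : 𝟙_ V ⟶ M.obj z) :
    eId V z ≫ (yoneda a).app z = a := by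
  dsimp [yoneda]
  rw [← Category.assoc, leftUnitor_inv_naturality, Category.assoc, whisker_exchange_assoc,
    unitors_inv_equal, ← rightUnitor_inv_naturality_assoc a, M.act_id, Category.comp_id]

lemma yoneda_eId {M : RMod A} {z : A} (f : rep z ⟶ M) : yoneda (eId V z ≫ f.app z) = f := by
  ext x
  dsimp [yoneda]
  have := f.act_app z x
  rw [comp_whiskerRight, Category.assoc, ← this]
  simp

/-! #### Colimits of modules -/

lemma ev_map_act {J : Type*} [Category* J] [HasColimitsOfShape J V] (F : J ⥤ RMod A) {i j : J} (φ : i ⟶ j) (x y : A) :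
    (ev F x).map φ ▷ _ ≫ (F.obj j).act x y ≫ colimit.ι (ev F y) j =
      (F.obj i).act x y ≫ colimit.ι (ev F y) i := by
  have := (F.map φ).act_app x y
  dsimp
  rw [← reassoc_of% this]
  congr 1
  exact colimit.w (ev F y) φ

section Attach

variable [HasColimits V] (M : RMod A) {S : Type w} {D Z : S → V} (k : ∀ s, D s ⟶ Z s)
  (t : S → A) (a : ∀ s, D s ⟶ M.obj (t s))

/-- The object obtained by attaching `k s ▷ A(t s, x)` for all `s`. -/
noncomputable abbrev attachObj (x : A) : V :=
  pushout (Limits.Sigma.map (fun s => k s ▷ (t s ⟶[V] x)))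
    (Limits.Sigma.desc (fun s => a s ▷ (t s ⟶[V] x) ≫ M.act (t s) x))

/-- The canonical morphism. -/
noncomputable def attachIncl (x : A) : M.obj x ⟶ attachObj M k t a x := pushout.inr _ _

/-- The cells. -/
noncomputable def attachCell (s : S) (x : A) : Z s ⊗ (t s ⟶[V] x) ⟶ attachObj M k t a x :=
  Sigma.ι (fun s => Z s ⊗ (t s ⟶[V] x)) s ≫ pushout.inl _ _

lemma isCellAttachment_attachIncl (x : A) :
    IsCellAttachment (attachIncl M k t a x) (fun s => k s ▷ (t s ⟶[V] x))
      (fun s => a s ▷ (t s ⟶[V] x) ≫ M.act (t s) x) (fun s => attachCell M k t a s x) :=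
  IsCellAttachment.sigma_desc _ _ _

end Attach

variable [MonoidalClosed V] [SymmetricCategory V]

section Colimit

variable {J : Type*} [Category* J] [HasColimitsOfShape J V] (F : J ⥤ RMod A)

/-- Extensionality for morphisms from `colimit G ⊗ B`. -/
lemma colimit_tensor_hom_ext {G : J ⥤ V} {B Z : V} {f g : colimit G ⊗ B ⟶ Z}
    (h : ∀ j, colimit.ι G j ▷ B ≫ f = colimit.ι G j ▷ B ≫ g) : f = g :=
  (isColimitOfPreserves (tensorRight B) (colimit.isColimit G)).hom_ext h

/-- Morphisms from `colimit G ⊗ B`. -/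
noncomputable def colimitTensorDesc {G : J ⥤ V} {B Z : V} (f : ∀ j, G.obj j ⊗ B ⟶ Z)
    (h : ∀ {i j} (φ : i ⟶ j), G.map φ ▷ B ≫ f j = f i) : colimit G ⊗ B ⟶ Z :=
  (isColimitOfPreserves (tensorRight B) (colimit.isColimit G)).desc
    ⟨Z, { app := f, naturality := fun _ _ φ => (h φ).trans (Category.comp_id _).symm }⟩

@[simp]
lemma ι_colimitTensorDesc {G : J ⥤ V} {B Z : V} (f : ∀ j, G.obj j ⊗ B ⟶ Z)
    (h : ∀ {i j} (φ : i ⟶ j), G.map φ ▷ B ≫ f j = f i) (j : J) :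
    colimit.ι G j ▷ B ≫ colimitTensorDesc f h = f j :=
  (isColimitOfPreserves (tensorRight B) (colimit.isColimit G)).fac _ j

/-- The colimit of a functor to modules. -/
@[reducible]
noncomputable def colim : RMod A where
  obj x := colimit (ev F x)
  act x y := colimitTensorDesc (fun j => (F.obj j).act x y ≫ colimit.ι (ev F y) j)
    (fun φ => ev_map_act F φ x y)
  act_id x := by
    refine colimit.hom_ext fun j => ?_
    rw [Category.comp_id, rightUnitor_inv_naturality_assoc, ← whisker_exchange_assoc,
      ι_colimitTensorDesc]
    exact (F.obj j).act_id_assoc x _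
  act_comp x y z := by
    have h : ∀ {f g : (colimit (ev F x) ⊗ (x ⟶[V] y)) ⊗ (y ⟶[V] z) ⟶ colimit (ev F z)},
        (∀ j, colimit.ι (ev F x) j ▷ (x ⟶[V] y) ▷ (y ⟶[V] z) ≫ f =
          colimit.ι (ev F x) j ▷ (x ⟶[V] y) ▷ (y ⟶[V] z) ≫ g) → f = g := fun h =>
      (isColimitOfPreserves (tensorRight (y ⟶[V] z)) (isColimitOfPreserves (tensorRight (x ⟶[V] y))
        (colimit.isColimit (ev F x)))).hom_ext h
    refine h fun j => ?_
    rw [associator_naturality_left_assoc, ← whisker_exchange_assoc, ι_colimitTensorDesc,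
      ← comp_whiskerRight_assoc, ι_colimitTensorDesc, comp_whiskerRight_assoc, ι_colimitTensorDesc]
    exact (F.obj j).act_comp_assoc x y z _

/-- The canonical morphism to the colimit. -/
noncomputable def colimι (j : J) : F.obj j ⟶ colim F where
  app x := colimit.ι (ev F x) j
  act_app x y := (ι_colimitTensorDesc (G := ev F x)
    (fun j => (F.obj j).act x y ≫ colimit.ι (ev F y) j) (fun φ => ev_map_act F φ x y) j).symm

lemma colimι_app (j : J) (x : A) : (colimι F j).app x = colimit.ι (ev F x) j := rfl

lemma map_colimι {i j : J} (φ : i ⟶ j) : F.map φ ≫ colimι F j = colimι F i := by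
  ext x
  exact colimit.w (ev F x) φ

variable {F} in
lemma colim_hom_ext {N : RMod A} {f g : colim F ⟶ N}
    (h : ∀ j, colimι F j ≫ f = colimι F j ≫ g) : f = g := by
  refine hom_ext fun x => ?_
  exact colimit.hom_ext fun j => congrArg (fun k => Hom.app k x) (h j)

lemma exists_colim_desc {N : RMod A} (f : ∀ j, F.obj j ⟶ N)
    (h : ∀ {i j} (φ : i ⟶ j), F.map φ ≫ f j = f i) :
    ∃ d : colim F ⟶ N, ∀ j, colimι F j ≫ d = f j := by
  let c (x : A) : Cocone (ev F x) := ⟨N.obj x,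
    { app := fun j => (f j).app x
      naturality := fun _ _ φ => (congrArg (fun k => Hom.app k x) (h φ)).trans
        (Category.comp_id _).symm }⟩
  refine ⟨{ app := fun x => colimit.desc _ (c x), act_app := fun x y => ?_ }, fun j => ?_⟩
  · refine colimit_tensor_hom_ext fun j => ?_
    have h₁ := (f j).act_app x y
    have h₂ (x) : (colimι F j).app x ≫ colimit.desc _ (c x) = (f j).app x := colimit.ι_desc (c x) j
    have h₃ := (colimι F j).act_app_assoc x y (colimit.desc _ (c y))
    rw [← colimι_app, ← h₃, h₂, h₁, ← comp_whiskerRight_assoc, h₂]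
  · ext x
    exact colimit.ι_desc (c x) j

end Colimit

section Attach

variable [HasColimits V] (M : RMod A) {S : Type w} {D Z : S → V} (k : ∀ s, D s ⟶ Z s)
  (t : S → A) (a : ∀ s, D s ⟶ M.obj (t s))

/-- Tensoring on the right is a left adjoint, so the source is again a cell attachment and the
action may be defined on `M` and on the cells separately. On a cell it is the composition of `A`;
the two definitions agree by associativity of the action on `M`. -/
lemma exists_attachAct (x y : A) :
    ∃ d : attachObj M k t a x ⊗ (x ⟶[V] y) ⟶ attachObj M k t a y,
      attachIncl M k t a x ▷ _ ≫ d = M.act x y ≫ attachIncl M k t a y ∧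
      ∀ s, attachCell M k t a s x ▷ _ ≫ d =
        (α_ _ _ _).hom ≫ Z s ◁ eComp V (t s) x y ≫ attachCell M k t a s y := by
  refine ((isCellAttachment_attachIncl M k t a x).whiskerRight (x ⟶[V] y)).exists_desc
    (M.act x y ≫ attachIncl M k t a y)
    (fun s => (α_ _ _ _).hom ≫ Z s ◁ eComp V (t s) x y ≫ attachCell M k t a s y) (fun s => ?_)
  have := (isCellAttachment_attachIncl M k t a y).w s
  rw [comp_whiskerRight_assoc, ← M.act_comp_assoc, associator_naturality_left_assoc,
    associator_naturality_left_assoc, ← whisker_exchange_assoc, this, ← whisker_exchange_assoc]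
  simp

/-- The module obtained by attaching the free cells on `k s` at `t s` for all `s`. -/
@[reducible]
noncomputable def attach : RMod A where
  obj x := attachObj M k t a x
  act x y := (exists_attachAct M k t a x y).choose
  act_id x := by
    obtain ⟨h₁, h₂⟩ := (exists_attachAct M k t a x x).choose_spec
    refine (isCellAttachment_attachIncl M k t a x).hom_ext ?_ (fun s => ?_)
    · rw [rightUnitor_inv_naturality_assoc, ← whisker_exchange_assoc, h₁, M.act_id_assoc,
        Category.comp_id]
    · rw [rightUnitor_inv_naturality_assoc, ← whisker_exchange_assoc, h₂, Category.comp_id,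
        associator_naturality_right_assoc, rightUnitor_tensor_inv, Category.assoc,
        Iso.inv_hom_id_assoc, ← MonoidalCategory.whiskerLeft_comp_assoc,
        ← MonoidalCategory.whiskerLeft_comp_assoc, Category.assoc, e_comp_id V (t s) x,
        MonoidalCategory.whiskerLeft_id, Category.id_comp]
  act_comp x y z := by
    obtain ⟨h₁, h₂⟩ := (exists_attachAct M k t a x y).choose_spec
    obtain ⟨h₃, h₄⟩ := (exists_attachAct M k t a y z).choose_spec
    obtain ⟨h₅, h₆⟩ := (exists_attachAct M k t a x z).choose_spec
    refine (((isCellAttachment_attachIncl M k t a x).whiskerRight _).whiskerRight _).hom_ext ?_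
      (fun s => ?_)
    · rw [associator_naturality_left_assoc, ← whisker_exchange_assoc, h₅,
        ← comp_whiskerRight_assoc, h₁, comp_whiskerRight_assoc, h₃, M.act_comp_assoc]
    · rw [associator_naturality_left_assoc, ← whisker_exchange_assoc, h₆,
        ← comp_whiskerRight_assoc, h₂]
      have := e_assoc' V (t s) x y z
      simp only [comp_whiskerRight_assoc, h₄]
      rw [associator_naturality_right_assoc, ← MonoidalCategory.whiskerLeft_comp_assoc, 
        associator_naturality_middle_assoc,
        ← MonoidalCategory.whiskerLeft_comp_assoc, ← this]
      simp

lemma attachIncl_act (x y : A) : attachIncl M k t a x ▷ _ ≫ (attach M k t a).act x y =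
    M.act x y ≫ attachIncl M k t a y :=
  (exists_attachAct M k t a x y).choose_spec.1

lemma attachIncl_act_assoc (x y : A) {U : V} (h : (attach M k t a).obj y ⟶ U) :
    attachIncl M k t a x ▷ _ ≫ (attach M k t a).act x y ≫ h =
      M.act x y ≫ attachIncl M k t a y ≫ h := by
  rw [reassoc_of% attachIncl_act M k t a x y]

lemma attachCell_act (s : S) (x y : A) :
    attachCell M k t a s x ▷ _ ≫ (attach M k t a).act x y =
      (α_ _ _ _).hom ≫ Z s ◁ eComp V (t s) x y ≫ attachCell M k t a s y :=
  (exists_attachAct M k t a x y).choose_spec.2 s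

lemma attachCell_act_assoc (s : S) (x y : A) {U : V} (h : (attach M k t a).obj y ⟶ U) :
    attachCell M k t a s x ▷ _ ≫ (attach M k t a).act x y ≫ h =
      (α_ _ _ _).hom ≫ Z s ◁ eComp V (t s) x y ≫ attachCell M k t a s y ≫ h := by
  rw [reassoc_of% attachCell_act M k t a s x y]

/-- The inclusion of a module to the module obtained by attaching cells. -/
noncomputable def attachι : M ⟶ attach M k t a where
  app := attachIncl M k t a
  act_app x y := (attachIncl_act M k t a x y).symm

/-- The generators of the free cells. -/
noncomputable def attachGen (s : S) : Z s ⟶ (attach M k t a).obj (t s) :=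
  (ρ_ _).inv ≫ Z s ◁ eId V (t s) ≫ attachCell M k t a s (t s)

/-- A generator is its cell evaluated at the identity of `t s`. By the left unit law of `A`, acting
on it recovers the whole cell, which is why morphisms out of `attach` are determined by generators.
-/
lemma attachGen_act (s : S) (x : A) : attachGen M k t a s ▷ _ ≫ (attach M k t a).act (t s) x =
    attachCell M k t a s x := by
  rw [attachGen, comp_whiskerRight_assoc, comp_whiskerRight_assoc, attachCell_act,
    associator_naturality_middle_assoc, ← MonoidalCategory.whiskerLeft_comp_assoc]
  have := e_id_comp V (t s) x
  rw [Iso.inv_comp_eq, Category.comp_id] at this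
  rw [this]
  simp

lemma comp_attachGen (s : S) : k s ≫ attachGen M k t a s = a s ≫ (attachι M k t a).app (t s) := by
  have := (isCellAttachment_attachIncl M k t a (t s)).w s
  rw [attachGen, rightUnitor_inv_naturality_assoc, ← whisker_exchange_assoc, this,
    Category.assoc, whisker_exchange_assoc, ← rightUnitor_inv_naturality_assoc,
    M.act_id_assoc]
  rfl

variable {M k t a}

lemma attach_hom_ext {N : RMod A} {f g : attach M k t a ⟶ N}
    (h₁ : attachι M k t a ≫ f = attachι M k t a ≫ g)
    (h₂ : ∀ s, attachGen M k t a s ≫ f.app (t s) = attachGen M k t a s ≫ g.app (t s)) :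
    f = g := by
  refine hom_ext fun x => (isCellAttachment_attachIncl M k t a x).hom_ext
    (congrArg (fun k => Hom.app k x) h₁) fun s => ?_
  rw [← attachGen_act, Category.assoc, Category.assoc, f.act_app, g.act_app,
    ← comp_whiskerRight_assoc, ← comp_whiskerRight_assoc, h₂]

lemma exists_attach_desc {N : RMod A} (f : M ⟶ N) (q : ∀ s, Z s ⟶ N.obj (t s))
    (h : ∀ s, k s ≫ q s = a s ≫ f.app (t s)) :
    ∃ d : attach M k t a ⟶ N, attachι M k t a ≫ d = f ∧
      ∀ s, attachGen M k t a s ≫ d.app (t s) = q s := by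
  have (x : A) := (isCellAttachment_attachIncl M k t a x).exists_desc (f.app x)
    (fun s => q s ▷ _ ≫ N.act (t s) x) (fun s => by
      rw [← comp_whiskerRight_assoc, h, comp_whiskerRight_assoc, Category.assoc, f.act_app])
  choose d hd₁ hd₂ using this
  refine ⟨{ app := d, act_app := fun x y => ?_ }, hom_ext hd₁, fun s => ?_⟩
  · refine ((isCellAttachment_attachIncl M k t a x).whiskerRight _).hom_ext ?_ fun s => ?_
    · rw [attachIncl_act_assoc, hd₁, f.act_app, ← comp_whiskerRight_assoc, hd₁]
    · rw [attachCell_act_assoc, hd₂, ← comp_whiskerRight_assoc, hd₂, comp_whiskerRight_assoc,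
        ← N.act_comp, whisker_exchange_assoc, associator_naturality_left_assoc]
  · dsimp only
    rw [attachGen, Category.assoc, Category.assoc, hd₂, whisker_exchange_assoc,
      ← rightUnitor_inv_naturality_assoc, N.act_id, Category.comp_id]

end Attach
end RMod
end EnrichedModel

namespace EnrichedModel

variable {V : Type u} [Category.{w} V] [MonoidalCategory V]

/-! ### Pushout-products -/

section PushoutProduct

variable [HasColimits V] {A B X Y : V} (i : A ⟶ B) (j : X ⟶ Y)

/-- The canonical choice of a pushout-product. -/
noncomputable abbrev pushoutProd : (curriedTensor V).PushoutObjObj i j := .ofHasPushout _ _ _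

/-- The domain of the pushout-product. -/
noncomputable def ppDom : V := (pushoutProd i j).pt

/-- The first inclusion. -/
noncomputable def ppInl : B ⊗ X ⟶ ppDom i j := (pushoutProd i j).inl

/-- The second inclusion. -/
noncomputable def ppInr : A ⊗ Y ⟶ ppDom i j := (pushoutProd i j).inr

/-- The pushout-product. -/
noncomputable def ppMap : ppDom i j ⟶ B ⊗ Y := (pushoutProd i j).ι

@[simp]
lemma ppInl_ppMap : ppInl i j ≫ ppMap i j = B ◁ j := (pushoutProd i j).inl_ι

@[simp]
lemma ppInl_ppMap_assoc {Z : V} (h : B ⊗ Y ⟶ Z) : ppInl i j ≫ ppMap i j ≫ h = B ◁ j ≫ h := by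
  rw [reassoc_of% ppInl_ppMap i j]

@[simp]
lemma ppInr_ppMap : ppInr i j ≫ ppMap i j = i ▷ Y := (pushoutProd i j).inr_ι

@[simp]
lemma ppInr_ppMap_assoc {Z : V} (h : B ⊗ Y ⟶ Z) : ppInr i j ≫ ppMap i j ≫ h = i ▷ Y ≫ h := by
  rw [reassoc_of% ppInr_ppMap i j]

variable {i j}

lemma pp_hom_ext {Z : V} {f g : ppDom i j ⟶ Z} (h₁ : ppInl i j ≫ f = ppInl i j ≫ g)
    (h₂ : ppInr i j ≫ f = ppInr i j ≫ g) : f = g :=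
  (pushoutProd i j).isPushout.hom_ext h₁ h₂

/-- Morphisms from the domain of the pushout-product. -/
noncomputable def ppDesc {Z : V} (f : B ⊗ X ⟶ Z) (g : A ⊗ Y ⟶ Z) (h : i ▷ X ≫ f = A ◁ j ≫ g) :
    ppDom i j ⟶ Z :=
  (pushoutProd i j).isPushout.desc f g h

variable {Z : V} (f : B ⊗ X ⟶ Z) (g : A ⊗ Y ⟶ Z) (h : i ▷ X ≫ f = A ◁ j ≫ g)

@[simp]
lemma ppInl_ppDesc : ppInl i j ≫ ppDesc f g h = f :=
  (pushoutProd i j).isPushout.inl_desc _ _ h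

@[simp]
lemma ppInl_ppDesc_assoc {U : V} (k : Z ⟶ U) : ppInl i j ≫ ppDesc f g h ≫ k = f ≫ k := by
  rw [reassoc_of% ppInl_ppDesc f g h]

@[simp]
lemma ppInr_ppDesc : ppInr i j ≫ ppDesc f g h = g :=
  (pushoutProd i j).isPushout.inr_desc _ _ h

@[simp]
lemma ppInr_ppDesc_assoc {U : V} (k : Z ⟶ U) : ppInr i j ≫ ppDesc f g h ≫ k = g ≫ k := by
  rw [reassoc_of% ppInr_ppDesc f g h]

end PushoutProduct

/-! ### Free extensions of enriched categories: the underlying modules -/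

/-- A family of morphisms `j s : X s ⟶ Y s` of `V` together with attaching maps
from `X s` to hom-objects of `A`. -/
structure AttachingData (A : VCat V) where
  /-- the index set -/
  S : Type w
  /-- the sources -/
  src : S → A
  /-- the targets -/
  tgt : S → A
  /-- the domains -/
  X : S → V
  /-- the codomains -/
  Y : S → V
  /-- the cells -/
  j (s : S) : X s ⟶ Y s
  /-- the attaching maps -/
  g (s : S) : X s ⟶ (src s ⟶[V] tgt s)

namespace AttachingData

variable {A : VCat V} (Γ : AttachingData A)

/-- Modules with an additional action of the objects `Y s`, extending the action of the `X s`. -/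
structure Mod extends RMod A where
  /-- the additional action -/
  t (s : Γ.S) : obj (Γ.src s) ⊗ Γ.Y s ⟶ obj (Γ.tgt s)
  w (s : Γ.S) : obj (Γ.src s) ◁ Γ.j s ≫ t s = obj (Γ.src s) ◁ Γ.g s ≫ act _ _

variable {Γ}

/-- The condition that a morphism of modules is compatible with the additional actions. -/
def IsLinear (M N : Γ.Mod) (f : M.toRMod ⟶ N.toRMod) : Prop :=
  ∀ s, M.t s ≫ f.app (Γ.tgt s) = f.app (Γ.src s) ▷ Γ.Y s ≫ N.t s

variable (Γ)

/-- The stages of the construction of the free extension: a morphism of modules `M ⟶ M'`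
and morphisms `M (src s) ⊗ Y s ⟶ M' (tgt s)`. -/
structure Stage where
  /-- the source -/
  M : RMod A
  /-- the target -/
  M' : RMod A
  /-- the morphism -/
  m : M ⟶ M'
  /-- the partial action -/
  t (s : Γ.S) : M.obj (Γ.src s) ⊗ Γ.Y s ⟶ M'.obj (Γ.tgt s)
  w (s : Γ.S) : M.obj (Γ.src s) ◁ Γ.j s ≫ t s =
    M.obj (Γ.src s) ◁ Γ.g s ≫ M.act _ _ ≫ m.app (Γ.tgt s)

namespace Stage

variable {Γ}

lemma w_assoc (E : Γ.Stage) (s : Γ.S) {Z : V} (h : E.M'.obj (Γ.tgt s) ⟶ Z) :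
    E.M.obj (Γ.src s) ◁ Γ.j s ≫ E.t s ≫ h =
      E.M.obj (Γ.src s) ◁ Γ.g s ≫ E.M.act _ _ ≫ E.m.app (Γ.tgt s) ≫ h := by
  rw [reassoc_of% E.w s]

/-- A cocone over a stage. -/
structure Cone (E : Γ.Stage) (N : Γ.Mod) where
  /-- the morphism from the source -/
  d : E.M ⟶ N.toRMod
  /-- the morphism from the target -/
  d' : E.M' ⟶ N.toRMod
  w : E.m ≫ d' = d
  t_w (s : Γ.S) : E.t s ≫ d'.app _ = d.app _ ▷ _ ≫ N.t s

variable (E : Γ.Stage)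

/-- On `M ⊗ X s` the action of `A` on `M'` through `g s` agrees with the partial action restricted
along `j s`. The two therefore glue on the domain of the pushout-product, which is where the next
cells are attached. -/
lemma next_condition (s : Γ.S) : E.m.app (Γ.src s) ▷ Γ.X s ≫
    E.M'.obj (Γ.src s) ◁ Γ.g s ≫ E.M'.act (Γ.src s) (Γ.tgt s) =
      E.M.obj (Γ.src s) ◁ Γ.j s ≫ E.t s := by
  rw [E.w, ← whisker_exchange_assoc, E.m.act_app]

variable [HasColimits V] [MonoidalClosed V] [SymmetricCategory V]

/-- The initial stage. -/
@[reducible] noncomputable def init (M : RMod A) : Γ.Stage where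
  M := M
  M' := M.attach (fun s => M.obj (Γ.src s) ◁ Γ.j s) Γ.tgt
    (fun s => M.obj (Γ.src s) ◁ Γ.g s ≫ M.act _ _)
  m := M.attachι _ _ _
  t s := M.attachGen (fun s => M.obj (Γ.src s) ◁ Γ.j s) Γ.tgt
    (fun s => M.obj (Γ.src s) ◁ Γ.g s ≫ M.act _ _) s
  w s := by
    have := M.comp_attachGen (fun s => M.obj (Γ.src s) ◁ Γ.j s) Γ.tgt
      (fun s => M.obj (Γ.src s) ◁ Γ.g s ≫ M.act _ _) s
    rw [this, Category.assoc]

lemma exists_cone_init (M : RMod A) {N : Γ.Mod} (f : M ⟶ N.toRMod) :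
    ∃ c : (init M : Γ.Stage).Cone N, c.d = f := by
  obtain ⟨d, hd, hd'⟩ := RMod.exists_attach_desc
    (k := fun s => M.obj (Γ.src s) ◁ Γ.j s) (t := Γ.tgt)
    (a := fun s => M.obj (Γ.src s) ◁ Γ.g s ≫ M.act _ _) f (fun s => f.app _ ▷ _ ≫ N.t s)
    (fun s => by
      rw [whisker_exchange_assoc, N.w, ← whisker_exchange_assoc, Category.assoc, f.act_app])
  exact ⟨⟨f, d, hd, hd'⟩, rfl⟩

/-- The attaching maps for the next stage. -/
noncomputable abbrev nextAttach (s : Γ.S) :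
    ppDom (E.m.app (Γ.src s)) (Γ.j s) ⟶ E.M'.obj (Γ.tgt s) :=
  ppDesc (E.M'.obj (Γ.src s) ◁ Γ.g s ≫ E.M'.act _ _) (E.t s) (E.next_condition s)

/-- The next stage. -/
@[reducible] noncomputable def next : Γ.Stage where
  M := E.M'
  M' := E.M'.attach (fun s => ppMap (E.m.app (Γ.src s)) (Γ.j s)) Γ.tgt E.nextAttach
  m := E.M'.attachι _ _ _
  t s := E.M'.attachGen (fun s => ppMap (E.m.app (Γ.src s)) (Γ.j s)) Γ.tgt E.nextAttach s
  w s := by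
    have := E.M'.comp_attachGen (fun s => ppMap (E.m.app (Γ.src s)) (Γ.j s)) Γ.tgt E.nextAttach s
    rw [← ppInl_ppMap (E.m.app (Γ.src s)), Category.assoc, this, ppInl_ppDesc_assoc,
      Category.assoc]

/-- The next partial action extends the present one, because its cells are attached along
pushout-products whose domain contains `M ⊗ Y s`. -/
lemma next_t (s : Γ.S) :
    E.m.app (Γ.src s) ▷ Γ.Y s ≫ E.next.t s = E.t s ≫ E.next.m.app (Γ.tgt s) := by
  have := E.M'.comp_attachGen (fun s => ppMap (E.m.app (Γ.src s)) (Γ.j s)) Γ.tgt E.nextAttach s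
  have h := ppInr (E.m.app (Γ.src s)) (Γ.j s) ≫= this
  rw [ppInr_ppMap_assoc, ppInr_ppDesc_assoc] at h
  exact h

variable {E} in
lemma Cone.exists_next {N : Γ.Mod} (c : E.Cone N) : ∃ c' : E.next.Cone N, c'.d = c.d' := by
  obtain ⟨d, hd, hd'⟩ := RMod.exists_attach_desc
    (k := fun s => ppMap (E.m.app (Γ.src s)) (Γ.j s)) (t := Γ.tgt)
    (a := E.nextAttach) c.d' (fun s => c.d'.app _ ▷ _ ≫ N.t s)
    (fun s => by
      refine pp_hom_ext ?_ ?_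
      · rw [ppInl_ppMap_assoc, ppInl_ppDesc_assoc, whisker_exchange_assoc, N.w,
          ← whisker_exchange_assoc, Category.assoc, c.d'.act_app]
      · rw [ppInr_ppMap_assoc, ppInr_ppDesc_assoc, c.t_w, ← c.w, RMod.comp_app,
          comp_whiskerRight_assoc])
  exact ⟨⟨c.d', d, hd, hd'⟩, rfl⟩

lemma hom_ext_init {M N : RMod A} {f g : (init M : Γ.Stage).M' ⟶ N}
    (h₁ : (init M : Γ.Stage).m ≫ f = (init M : Γ.Stage).m ≫ g)
    (h₂ : ∀ s, (init M : Γ.Stage).t s ≫ f.app _ = (init M : Γ.Stage).t s ≫ g.app _) : f = g :=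
  RMod.attach_hom_ext h₁ h₂

lemma hom_ext_next {N : RMod A} {f g : E.next.M' ⟶ N}
    (h₁ : E.next.m ≫ f = E.next.m ≫ g)
    (h₂ : ∀ s, E.next.t s ≫ f.app _ = E.next.t s ≫ g.app _) : f = g :=
  RMod.attach_hom_ext h₁ h₂

end Stage

section

variable [HasColimits V] [MonoidalClosed V] [SymmetricCategory V]

/-- The sequence of stages. -/
@[reducible] noncomputable def stage (M : RMod A) : ℕ → Γ.Stage
  | 0 => .init M
  | n + 1 => (stage M n).next

/-- Into a module that already has the full action, a morphism extends over one stage after another: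
the value on each new generator is given by the action on `N`. -/
lemma exists_cone_stage {M : RMod A} {N : Γ.Mod} (f : M ⟶ N.toRMod) :
    ∃ c : ∀ n, (Γ.stage M n).Cone N, (c 0).d = f ∧ ∀ n, (c (n + 1)).d = (c n).d' := by
  obtain ⟨c₀, h₀⟩ := Stage.exists_cone_init (Γ := Γ) M f
  choose nx hnx using fun (E : Γ.Stage) (c : E.Cone N) => c.exists_next
  exact ⟨fun n => Nat.rec (motive := fun n => (Γ.stage M n).Cone N) c₀ (fun n c => nx _ c) n,
    h₀, fun n => hnx _ _⟩

/-- The functor given by the sequence of stages. -/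
noncomputable abbrev stageFunctor (M : RMod A) : ℕ ⥤ RMod A :=
  Functor.ofSequence (X := fun n => (Γ.stage M n).M) (fun n => (Γ.stage M n).m)

lemma stageFunctor_map_succ (M : RMod A) (n : ℕ) :
    (Γ.stageFunctor M).map (homOfLE (Nat.le_add_right n 1)) = (Γ.stage M n).m :=
  Functor.ofSequence_map_homOfLE_succ _ n

instance hasColimitsOfShape_nat : HasColimitsOfShape ℕ V :=
  have : HasColimitsOfSize.{0, 0} V := hasColimitsOfSizeShrink.{0, 0, w, w} V
  inferInstance

/-- The canonical morphism from a stage to the colimit. -/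
noncomputable abbrev stageι (M : RMod A) (n : ℕ) :
    (Γ.stage M n).M ⟶ RMod.colim (Γ.stageFunctor M) :=
  RMod.colimι (Γ.stageFunctor M) n

lemma m_stageι (M : RMod A) (n : ℕ) : (Γ.stage M n).m ≫ Γ.stageι M (n + 1) = Γ.stageι M n := by
  rw [← stageFunctor_map_succ]
  exact RMod.map_colimι (Γ.stageFunctor M) (homOfLE (Nat.le_add_right n 1))

lemma m_stageι_assoc (M : RMod A) (n : ℕ) {N : RMod A} (h : RMod.colim (Γ.stageFunctor M) ⟶ N) :
    (Γ.stage M n).m ≫ Γ.stageι M (n + 1) ≫ h = Γ.stageι M n ≫ h := by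
  rw [reassoc_of% Γ.m_stageι M n]

/-- The partial actions are compatible with one transition morphism by `next_t`, hence with all of
them; this lets them define an action on the colimit. -/
lemma stage_t_naturality (M : RMod A) (s : Γ.S) {n n' : ℕ} (φ : n ⟶ n') :
    (RMod.ev (Γ.stageFunctor M) (Γ.src s)).map φ ▷ Γ.Y s ≫ (Γ.stage M n').t s ≫
      (Γ.stageι M (n' + 1)).app (Γ.tgt s) =
    (Γ.stage M n).t s ≫ (Γ.stageι M (n + 1)).app (Γ.tgt s) := by
  let τ : RMod.ev (Γ.stageFunctor M) (Γ.src s) ⋙ tensorRight (Γ.Y s) ⟶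
      (Functor.const ℕ).obj ((RMod.colim (Γ.stageFunctor M)).obj (Γ.tgt s)) :=
    NatTrans.ofSequence (fun n => (Γ.stage M n).t s ≫ (Γ.stageι M (n + 1)).app (Γ.tgt s))
      (fun n => by
        refine Eq.trans ?_ (Category.comp_id _).symm
        have h : ((Γ.stageFunctor M).map (homOfLE (Nat.le_add_right n 1))).app (Γ.src s) =
            (Γ.stage M n).m.app (Γ.src s) :=
          congrArg (fun f => RMod.Hom.app f (Γ.src s)) (Γ.stageFunctor_map_succ M n)
        have h' := congrArg (fun f => RMod.Hom.app f (Γ.tgt s)) (Γ.m_stageι M (n + 1))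
        refine (congrArg (fun f => f ▷ Γ.Y s ≫ (Γ.stage M n).next.t s ≫
          (Γ.stageι M (n + 2)).app (Γ.tgt s)) h).trans ?_
        refine Eq.trans (Category.assoc _ _ _).symm ?_
        refine Eq.trans (Stage.next_t (Γ.stage M n) s =≫ _) ?_
        exact (Category.assoc _ _ _).trans (_ ≫= h'))
  exact (τ.naturality φ).trans (Category.comp_id _)

/-- The free module with additional action generated by a module. -/
@[reducible]
noncomputable def free (M : RMod A) : Γ.Mod where
  toRMod := RMod.colim (Γ.stageFunctor M)
  t s := RMod.colimitTensorDesc (G := RMod.ev (Γ.stageFunctor M) (Γ.src s))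
    (fun n => (Γ.stage M n).t s ≫ (Γ.stageι M (n + 1)).app (Γ.tgt s))
    (fun φ => Γ.stage_t_naturality M s φ)
  w s := by
    refine RMod.colimit_tensor_hom_ext fun n => ?_
    have h₁ := RMod.ι_colimitTensorDesc (G := RMod.ev (Γ.stageFunctor M) (Γ.src s))
      (fun n => (Γ.stage M n).t s ≫ (Γ.stageι M (n + 1)).app (Γ.tgt s))
      (fun φ => Γ.stage_t_naturality M s φ) n
    have h₂ := (Γ.stageι M n).act_app (Γ.src s) (Γ.tgt s)
    rw [← whisker_exchange_assoc, h₁, ← whisker_exchange_assoc]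
    refine Eq.trans ?_ (_ ≫= h₂)
    have h₃ := (Γ.stage M n).w_assoc s ((Γ.stageι M (n + 1)).app (Γ.tgt s))
    refine h₃.trans ?_
    have h₄ := congrArg (fun f => RMod.Hom.app f (Γ.tgt s)) (Γ.m_stageι M n)
    exact congrArg (fun f => _ ≫ _ ≫ f) h₄

lemma stageι_t (M : RMod A) (n : ℕ) (s : Γ.S) :
    (Γ.stageι M n).app (Γ.src s) ▷ Γ.Y s ≫ (Γ.free M).t s =
      (Γ.stage M n).t s ≫ (Γ.stageι M (n + 1)).app (Γ.tgt s) :=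
  RMod.ι_colimitTensorDesc (G := RMod.ev (Γ.stageFunctor M) (Γ.src s))
      (fun n => (Γ.stage M n).t s ≫ (Γ.stageι M (n + 1)).app (Γ.tgt s))
      (fun φ => Γ.stage_t_naturality M s φ) n

lemma stageι_t_assoc (M : RMod A) (n : ℕ) (s : Γ.S) {Z : V}
    (h : (Γ.free M).obj (Γ.tgt s) ⟶ Z) :
    (Γ.stageι M n).app (Γ.src s) ▷ Γ.Y s ≫ (Γ.free M).t s ≫ h =
      (Γ.stage M n).t s ≫ (Γ.stageι M (n + 1)).app (Γ.tgt s) ≫ h := by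
  rw [reassoc_of% Γ.stageι_t M n s]

/-- The inclusion of the generators of the free module with additional action. -/
noncomputable def freeι (M : RMod A) : M ⟶ (Γ.free M).toRMod := Γ.stageι M 0

variable {Γ} in
-- If two linear morphisms agree on a stage, linearity makes them agree on the partial action of
-- that stage, whose values generate the following stage; conclude by induction.
lemma free_hom_ext {M : RMod A} {N : Γ.Mod} {f g : (Γ.free M).toRMod ⟶ N.toRMod}
    (hf : IsLinear _ _ f) (hg : IsLinear _ _ g) (h : Γ.freeι M ≫ f = Γ.freeι M ≫ g) : f = g := by
  refine RMod.colim_hom_ext fun n => ?_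
  change Γ.stageι M n ≫ f = Γ.stageι M n ≫ g
  have ht (n : ℕ) (hn : Γ.stageι M n ≫ f = Γ.stageι M n ≫ g) (s : Γ.S) :
      (Γ.stage M n).t s ≫ (Γ.stageι M (n + 1) ≫ f).app (Γ.tgt s) =
        (Γ.stage M n).t s ≫ (Γ.stageι M (n + 1) ≫ g).app (Γ.tgt s) := by
    rw [RMod.comp_app, RMod.comp_app, ← stageι_t_assoc, ← stageι_t_assoc, hf, hg,
      ← comp_whiskerRight_assoc, ← comp_whiskerRight_assoc, ← RMod.comp_app, hn, RMod.comp_app]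
  induction n with
  | zero => exact h
  | succ n hn =>
    have hm : (Γ.stage M n).m ≫ Γ.stageι M (n + 1) ≫ f =
        (Γ.stage M n).m ≫ Γ.stageι M (n + 1) ≫ g := by
      rw [m_stageι_assoc, m_stageι_assoc, hn]
    cases n with
    | zero => exact Stage.hom_ext_init hm (ht 0 hn)
    | succ n => exact Stage.hom_ext_next _ hm (ht (n + 1) hn)

variable {Γ} in
lemma exists_free_desc {M : RMod A} {N : Γ.Mod} (f : M ⟶ N.toRMod) :
    ∃ d : (Γ.free M).toRMod ⟶ N.toRMod, IsLinear _ _ d ∧ Γ.freeι M ≫ d = f := by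
  obtain ⟨c, h₀, hc⟩ := Γ.exists_cone_stage f
  let τ : Γ.stageFunctor M ⟶ (Functor.const ℕ).obj N.toRMod :=
    NatTrans.ofSequence (fun n => (c n).d) (fun n => by
      rw [stageFunctor_map_succ]
      refine Eq.trans ?_ (Category.comp_id _).symm
      rw [hc]
      exact (c n).w)
  obtain ⟨d, hd⟩ := RMod.exists_colim_desc (F := Γ.stageFunctor M) (fun n => (c n).d)
    (fun φ => (τ.naturality φ).trans (Category.comp_id _))
  have hd' (n : ℕ) : Γ.stageι M n ≫ d = (c n).d := hd n
  refine ⟨d, fun s => ?_, (hd 0).trans h₀⟩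
  refine RMod.colimit_tensor_hom_ext fun n => ?_
  refine Eq.trans (Γ.stageι_t_assoc M n s (d.app (Γ.tgt s))) ?_
  refine Eq.trans ?_ (comp_whiskerRight_assoc _ _ _ _)
  change _ ≫ (Γ.stageι M (n + 1) ≫ d).app _ = (Γ.stageι M n ≫ d).app _ ▷ _ ≫ _
  rw [hd', hd', hc]
  exact (c n).t_w s

/-- The cells of the stages. -/
lemma stage_tensoredCells {P : MorphismProperty V}
    (hP : ∀ {X Y K L : V} (i : X ⟶ Y) (j : K ⟶ L) (sq : (curriedTensor V).PushoutObjObj i j),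
      P i → P j → P sq.ι) (hΓ : ∀ s, P (Γ.j s)) (M : RMod A) (n : ℕ) (x : A) :
    tensoredCells P ((Γ.stage M n).m.app x) := by
  induction n generalizing x with
  | zero =>
    refine tensoredCells.of_isCellAttachment (RMod.isCellAttachment_attachIncl M _ _ _ x)
      (fun s => tensoredCells.whiskerRight ?_ _)
    -- The cell of the first stage is `M ◁ j s`; the braiding identifies it with the single tensored
    -- cell `j s ▷ M`.
    refine ⟨PUnit, fun _ => Γ.X s, fun _ => Γ.Y s, fun _ => M.obj (Γ.src s), fun _ => Γ.j s,
      fun _ => (β_ _ _).hom, fun _ => (β_ _ _).hom, fun _ => hΓ s, ?_, ?_, ?_⟩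
    · simp
    · intro Z p q _ h
      simpa using h PUnit.unit
    · intro Z p q h
      refine ⟨(β_ _ _).inv ≫ q PUnit.unit, ?_, by simp⟩
      rw [BraidedCategory.braiding_inv_naturality_right_assoc]
      exact (_ ≫= h PUnit.unit).trans (Iso.inv_hom_id_assoc _ _)
  | succ n hn =>
    refine tensoredCells.of_isCellAttachment (RMod.isCellAttachment_attachIncl (Γ.stage M n).M'
      _ _ _ x) (fun s => tensoredCells.whiskerRight ?_ _)
    -- The cells of this stage are pushout-products of `j s` with the transition morphism of the
    -- preceding stage, to which the induction hypothesis applies at the object `src s`.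
    exact tensoredCells.pushoutProduct hP _ (hn _) (hΓ s)

lemma freeι_tensoredCells {P : MorphismProperty V}
    (hP : ∀ {X Y K L : V} (i : X ⟶ Y) (j : K ⟶ L) (sq : (curriedTensor V).PushoutObjObj i j),
      P i → P j → P sq.ι) (hΓ : ∀ s, P (Γ.j s)) (M : RMod A) (x : A) :
    (tensoredCells P).transfiniteCompositionsOfShape ℕ ((Γ.freeι M).app x) :=
  ⟨{ F := RMod.ev (Γ.stageFunctor M) x
     isoBot := Iso.refl _
     incl := (colimit.cocone (RMod.ev (Γ.stageFunctor M) x)).ι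
     isColimit := colimit.isColimit _
     fac := Category.id_comp _
     map_mem := fun n _ => by
      have h : (RMod.ev (Γ.stageFunctor M) x).map (homOfLE (Order.le_succ n)) =
          (Γ.stage M n).m.app x :=
        congrArg (fun f => RMod.Hom.app f x) (Γ.stageFunctor_map_succ M n)
      rw [h]
      exact Γ.stage_tensoredCells hP hΓ M n x }⟩

end

end AttachingData

end EnrichedModel

namespace EnrichedModel

variable {V : Type u} [Category.{w} V] [MonoidalCategory V]

/-! ### Enriched functors with a fixed underlying function -/

/-- The structure of a `V`-functor on a function between the sets of objects. -/
@[ext]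
structure VFun (A B : VCat V) (φ : A → B) where
  /-- the morphisms between hom-objects -/
  map (x y : A) : (x ⟶[V] y) ⟶ (φ x ⟶[V] φ y)
  map_id (x : A) : eId V x ≫ map x x = eId V (φ x)
  map_comp (x y z : A) :
    eComp V x y z ≫ map x z = (map x y ⊗ₘ map y z) ≫ eComp V (φ x) (φ y) (φ z)

lemma VFun.map_id_assoc {A B : VCat V} {φ : A → B} (F : VFun A B φ) (x : A) {Z : V}
    (h : (φ x ⟶[V] φ x) ⟶ Z) : eId V x ≫ F.map x x ≫ h = eId V (φ x) ≫ h := by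
  rw [reassoc_of% F.map_id x]

lemma VFun.map_comp_assoc {A B : VCat V} {φ : A → B} (F : VFun A B φ) (x y z : A) {Z : V}
    (h : (φ x ⟶[V] φ z) ⟶ Z) : eComp V x y z ≫ F.map x z ≫ h =
      (F.map x y ⊗ₘ F.map y z) ≫ eComp V (φ x) (φ y) (φ z) ≫ h := by
  rw [reassoc_of% F.map_comp x y z]

/-- The composition of `V`-functors. -/
def VFun.comp {A B C : VCat V} {φ : A → B} {ψ : B → C} (G : VFun A B φ) (H : VFun B C ψ) :
    VFun A C (fun x => ψ (φ x)) where
  map x y := G.map x y ≫ H.map _ _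
  map_id x := by rw [G.map_id_assoc, H.map_id]
  map_comp x y z := by
    rw [G.map_comp_assoc, H.map_comp, tensorHom_comp_tensorHom_assoc]

/-- A form of the interchange law. -/
lemma whiskerLeft_tensorHom_eq {X X' T Y Y' Z : V} (a : T ⟶ Y) (f : X ⟶ X') (h : Y ⟶ Y')
    (c : X' ⊗ Y' ⟶ Z) : X ◁ a ≫ (f ⊗ₘ h) ≫ c = f ▷ T ≫ X' ◁ (a ≫ h) ≫ c := by
  rw [MonoidalCategory.tensorHom_def, MonoidalCategory.whiskerLeft_comp, Category.assoc,
    Category.assoc, whisker_exchange_assoc]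

/-! ### Families of morphisms which are linear in the second variable -/

namespace AttachingData

variable {A : VCat V} {Γ : AttachingData A}

/-- A family of morphisms `W ⊗ M x ⟶ N x` is linear if it is compatible with the actions. -/
structure BiLinear (W : V) (M N : Γ.Mod) (φ : ∀ x, W ⊗ M.obj x ⟶ N.obj x) : Prop where
  act (x y : A) : W ◁ M.act x y ≫ φ y = (α_ _ _ _).inv ≫ φ x ▷ _ ≫ N.act x y
  t (s : Γ.S) : W ◁ M.t s ≫ φ _ = (α_ _ _ _).inv ≫ φ _ ▷ _ ≫ N.t s

/-! ### Cotensors of modules: linear families `W ⊗ M x ⟶ N x` as linear morphisms into a module. -/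

section Cotensor

variable [MonoidalClosed V]

/-- The action on the internal hom. -/
def ihomAct (W : V) {X H Z : V} (a : X ⊗ H ⟶ Z) : (ihom W).obj X ⊗ H ⟶ (ihom W).obj Z :=
  MonoidalClosed.curry ((α_ W _ _).inv ≫ (ihom.ev W).app _ ▷ _ ≫ a)

lemma ihomAct_ev (W : V) {X H Z : V} (a : X ⊗ H ⟶ Z) :
    W ◁ ihomAct W a ≫ (ihom.ev W).app _ = (α_ W _ _).inv ≫ (ihom.ev W).app _ ▷ _ ≫ a := by
  rw [← MonoidalClosed.uncurry_eq, ihomAct, MonoidalClosed.uncurry_curry]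

lemma whiskerLeft_ihomAct (W : V) {X H H' Z : V} (a : X ⊗ H ⟶ Z) (f : H' ⟶ H) :
    (ihom W).obj X ◁ f ≫ ihomAct W a = ihomAct W (X ◁ f ≫ a) := by
  apply MonoidalClosed.uncurry_injective
  rw [MonoidalClosed.uncurry_eq, MonoidalClosed.uncurry_eq, ihomAct_ev,
    MonoidalCategory.whiskerLeft_comp, Category.assoc, ihomAct_ev,
    associator_inv_naturality_right_assoc, whisker_exchange_assoc]
  rfl

lemma whiskerRight_ihomAct (W : V) {T X H Z : V} (f : W ⊗ T ⟶ X) (a : X ⊗ H ⟶ Z) :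
    MonoidalClosed.curry f ▷ H ≫ ihomAct W a =
      MonoidalClosed.curry ((α_ _ _ _).inv ≫ f ▷ H ≫ a) := by
  apply MonoidalClosed.uncurry_injective
  rw [MonoidalClosed.uncurry_curry, MonoidalClosed.uncurry_eq,
    MonoidalCategory.whiskerLeft_comp, Category.assoc, ihomAct_ev,
    associator_inv_naturality_middle_assoc, ← comp_whiskerRight_assoc,
    ← MonoidalClosed.uncurry_eq, MonoidalClosed.uncurry_curry]

lemma ihomAct_comp_ihomAct (W : V) {X H Y K Z : V} (a : X ⊗ H ⟶ Y) (b : Y ⊗ K ⟶ Z) :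
    ihomAct W a ▷ K ≫ ihomAct W b =
      (α_ _ _ _).hom ≫ ihomAct W ((α_ _ _ _).inv ≫ a ▷ K ≫ b) := by
  apply MonoidalClosed.uncurry_injective
  rw [MonoidalClosed.uncurry_eq, MonoidalClosed.uncurry_eq,
    MonoidalCategory.whiskerLeft_comp, Category.assoc, ihomAct_ev,
    associator_inv_naturality_middle_assoc, ← comp_whiskerRight_assoc, ihomAct_ev,
    MonoidalCategory.whiskerLeft_comp, Category.assoc, ihomAct_ev]
  simp

/-- The cotensor of a module. -/
@[reducible]
def cotensor (W : V) (N : Γ.Mod) : Γ.Mod where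
  obj x := (ihom W).obj (N.obj x)
  act x y := ihomAct W (N.act x y)
  act_id x := by
    rw [whiskerLeft_ihomAct]
    have h : N.obj x ◁ eId V x ≫ N.act x x = (ρ_ _).hom := by
      rw [← cancel_epi (ρ_ (N.obj x)).inv, Iso.inv_hom_id, N.act_id]
    rw [h, Iso.inv_comp_eq, Category.comp_id]
    apply MonoidalClosed.uncurry_injective
    rw [MonoidalClosed.uncurry_eq, MonoidalClosed.uncurry_eq, ihomAct_ev, rightUnitor_naturality]
    simp
  act_comp x y z := by
    rw [whiskerLeft_ihomAct, ihomAct_comp_ihomAct, ← N.act_comp, Iso.inv_hom_id_assoc]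
  t s := ihomAct W (N.t s)
  w s := by rw [whiskerLeft_ihomAct, whiskerLeft_ihomAct, N.w]

/-- Linear families as morphisms to the cotensor. -/
def BiLinear.curry {W : V} {M N : Γ.Mod} {φ : ∀ x, W ⊗ M.obj x ⟶ N.obj x} (h : BiLinear W M N φ) :
    M.toRMod ⟶ (cotensor W N).toRMod where
  app x := MonoidalClosed.curry (φ x)
  act_app x y := by
    rw [whiskerRight_ihomAct, ← h.act, MonoidalClosed.curry_natural_left]

lemma BiLinear.isLinear_curry {W : V} {M N : Γ.Mod} {φ : ∀ x, W ⊗ M.obj x ⟶ N.obj x}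
    (h : BiLinear W M N φ) : IsLinear M (cotensor W N) h.curry := fun s => by
  change _ ≫ MonoidalClosed.curry (φ _) = MonoidalClosed.curry (φ _) ▷ _ ≫ ihomAct W (N.t s)
  rw [whiskerRight_ihomAct, ← h.t, MonoidalClosed.curry_natural_left]

lemma bilinear_uncurry {W : V} {M N : Γ.Mod} {f : M.toRMod ⟶ (cotensor W N).toRMod}
    (hf : IsLinear M (cotensor W N) f) :
    BiLinear W M N (fun x => MonoidalClosed.uncurry (f.app x)) where
  act x y := by
    apply MonoidalClosed.curry_injective
    rw [← whiskerRight_ihomAct, MonoidalClosed.curry_natural_left, MonoidalClosed.curry_uncurry,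
      MonoidalClosed.curry_uncurry]
    exact f.act_app x y
  t s := by
    apply MonoidalClosed.curry_injective
    rw [← whiskerRight_ihomAct, MonoidalClosed.curry_natural_left, MonoidalClosed.curry_uncurry,
      MonoidalClosed.curry_uncurry]
    exact hf s

end Cotensor

namespace BiLinear

variable {W W' : V} {M N P : Γ.Mod}

lemma precomp {φ : ∀ x, W ⊗ M.obj x ⟶ N.obj x} (h : BiLinear W M N φ) (f : W' ⟶ W) :
    BiLinear W' M N (fun x => f ▷ _ ≫ φ x) where
  act x y := by
    rw [comp_whiskerRight_assoc, ← associator_inv_naturality_left_assoc, ← h.act,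
      whisker_exchange_assoc]
  t s := by
    rw [comp_whiskerRight_assoc, ← associator_inv_naturality_left_assoc, ← h.t,
      whisker_exchange_assoc]

lemma postcomp {φ : ∀ x, W ⊗ M.obj x ⟶ N.obj x} (h : BiLinear W M N φ)
    {f : N.toRMod ⟶ P.toRMod} (hf : IsLinear _ _ f) :
    BiLinear W M P (fun x => φ x ≫ f.app x) where
  act x y := by
    rw [comp_whiskerRight_assoc, reassoc_of% h.act, f.act_app]
  t s := by
    rw [comp_whiskerRight_assoc, reassoc_of% h.t, hf]

lemma whiskerLeft {φ : ∀ x, W ⊗ N.obj x ⟶ P.obj x} (h : BiLinear W N P φ)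
    {f : M.toRMod ⟶ N.toRMod} (hf : IsLinear _ _ f) :
    BiLinear W M P (fun x => W ◁ f.app x ≫ φ x) where
  act x y := by
    rw [comp_whiskerRight_assoc, ← associator_inv_naturality_middle_assoc, ← h.act,
      ← MonoidalCategory.whiskerLeft_comp_assoc, ← MonoidalCategory.whiskerLeft_comp_assoc,
      f.act_app]
  t s := by
    rw [comp_whiskerRight_assoc, ← associator_inv_naturality_middle_assoc, ← h.t,
      ← MonoidalCategory.whiskerLeft_comp_assoc, ← MonoidalCategory.whiskerLeft_comp_assoc, hf]

lemma comp {φ : ∀ x, W' ⊗ M.obj x ⟶ N.obj x} {ψ : ∀ x, W ⊗ N.obj x ⟶ P.obj x}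
    (hφ : BiLinear W' M N φ) (hψ : BiLinear W N P ψ) :
    BiLinear (W ⊗ W') M P (fun x => (α_ _ _ _).hom ≫ W ◁ φ x ≫ ψ x) where
  act x y := by
    rw [associator_naturality_right_assoc, ← MonoidalCategory.whiskerLeft_comp_assoc, hφ.act]
    simp only [comp_whiskerRight_assoc, MonoidalCategory.whiskerLeft_comp, Category.assoc, hψ.act,
      associator_inv_naturality_middle_assoc]
    simp
  t s := by
    rw [associator_naturality_right_assoc, ← MonoidalCategory.whiskerLeft_comp_assoc, hφ.t]
    simp only [comp_whiskerRight_assoc, MonoidalCategory.whiskerLeft_comp, Category.assoc, hψ.t,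
      associator_inv_naturality_middle_assoc]
    simp

lemma leftUnitor : BiLinear (𝟙_ V) M M (fun x => (λ_ _).hom) where
  act x y := by simp
  t s := by simp

end BiLinear

/-! #### The universal property of the free extension -/

variable {B : VCat V} {φ : A → B}

/-- The modules defined by a `V`-functor and compatible morphisms from the objects `Y s`. -/
@[reducible]
def targetMod (G : VFun A B φ) (y : ∀ s, Γ.Y s ⟶ (φ (Γ.src s) ⟶[V] φ (Γ.tgt s)))
    (hy : ∀ s, Γ.j s ≫ y s = Γ.g s ≫ G.map _ _) (b : B) : Γ.Mod where
  obj x := b ⟶[V] φ x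
  act x z := _ ◁ G.map x z ≫ eComp V b (φ x) (φ z)
  act_id x := by
    rw [← MonoidalCategory.whiskerLeft_comp_assoc, G.map_id, e_comp_id]
  act_comp x z t := by
    rw [← MonoidalCategory.whiskerLeft_comp_assoc, G.map_comp,
      MonoidalCategory.whiskerLeft_comp_assoc, MonoidalCategory.tensorHom_def,
      MonoidalCategory.whiskerLeft_comp_assoc, comp_whiskerRight_assoc, ← whisker_exchange_assoc,
      ← e_assoc']
    simp
  t s := _ ◁ y s ≫ eComp V b (φ _) (φ _)
  w s := by
    rw [← MonoidalCategory.whiskerLeft_comp_assoc, hy, MonoidalCategory.whiskerLeft_comp_assoc]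

lemma bilinear_eComp (G : VFun A B φ) (y : ∀ s, Γ.Y s ⟶ (φ (Γ.src s) ⟶[V] φ (Γ.tgt s)))
    (hy : ∀ s, Γ.j s ≫ y s = Γ.g s ≫ G.map _ _) (b c : B) :
    BiLinear (b ⟶[V] c) (targetMod G y hy c) (targetMod G y hy b)
      (fun x => eComp V b c (φ x)) where
  act x z := by
    rw [MonoidalCategory.whiskerLeft_comp_assoc, ← whisker_exchange_assoc, ← e_assoc]
    simp
  t s := by
    rw [MonoidalCategory.whiskerLeft_comp_assoc, ← whisker_exchange_assoc, ← e_assoc]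
    simp

variable (Γ) [HasColimits V] [MonoidalClosed V] [SymmetricCategory V]

/-- The free module with additional action on a representable module. -/
noncomputable abbrev freeRep (x : A) : Γ.Mod := Γ.free (RMod.rep x)

/-- The identities in the free extension. -/
noncomputable def extId (x : A) : 𝟙_ V ⟶ (Γ.freeRep x).obj x :=
  eId V x ≫ (Γ.freeι (RMod.rep x)).app x

lemma freeι_eq (x y : A) : (Γ.freeι (RMod.rep x)).app y =
    (λ_ _).inv ≫ Γ.extId x ▷ _ ≫ (Γ.freeRep x).act x y :=
  congrArg (fun f => RMod.Hom.app f y) (RMod.yoneda_eId (Γ.freeι (RMod.rep x))).symm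

variable {Γ} in
lemma freeRep_hom_ext {x : A} {N : Γ.Mod} {f g : (Γ.freeRep x).toRMod ⟶ N.toRMod}
    (hf : IsLinear _ _ f) (hg : IsLinear _ _ g)
    (h : Γ.extId x ≫ f.app x = Γ.extId x ≫ g.app x) : f = g := by
  refine Γ.free_hom_ext hf hg ?_
  rw [← RMod.yoneda_eId (Γ.freeι _ ≫ f), ← RMod.yoneda_eId (Γ.freeι _ ≫ g)]
  congr 1
  exact (Category.assoc _ _ _).symm.trans (h.trans (Category.assoc _ _ _))

variable {Γ} in
-- Currying turns bilinear families into linear morphisms from `freeRep x` to a cotensor, and these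
-- are determined by the image of the identity.
lemma bilinear_ext {x : A} {W : V} {N : Γ.Mod} {φ ψ : ∀ y, W ⊗ (Γ.freeRep x).obj y ⟶ N.obj y}
    (hφ : BiLinear W (Γ.freeRep x) N φ) (hψ : BiLinear W (Γ.freeRep x) N ψ)
    (h : W ◁ Γ.extId x ≫ φ x = W ◁ Γ.extId x ≫ ψ x) (y : A) : φ y = ψ y := by
  have : hφ.curry = hψ.curry := by
    refine freeRep_hom_ext hφ.isLinear_curry hψ.isLinear_curry ?_
    change Γ.extId x ≫ MonoidalClosed.curry (φ x) = Γ.extId x ≫ MonoidalClosed.curry (ψ x)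
    rw [← MonoidalClosed.curry_natural_left, h, MonoidalClosed.curry_natural_left]
  exact MonoidalClosed.curry_injective (congrArg (fun f => RMod.Hom.app f y) this)

/-- By freeness and the Yoneda lemma, applied to the cotensor of `N`, the value at the identity can
be prescribed. With `W = N.obj x` and `a` the identity this is the source of the composition law of
the extension. -/
lemma exists_bilinear {x : A} {W : V} {N : Γ.Mod} (a : W ⟶ N.obj x) :
    ∃ φ : ∀ y, W ⊗ (Γ.freeRep x).obj y ⟶ N.obj y, BiLinear W (Γ.freeRep x) N φ ∧
      W ◁ Γ.extId x ≫ φ x = (ρ_ _).hom ≫ a := by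
  obtain ⟨d, hd, hd'⟩ := Γ.exists_free_desc (N := cotensor W N)
    (RMod.yoneda (MonoidalClosed.curry ((ρ_ _).hom ≫ a)))
  refine ⟨_, bilinear_uncurry hd, ?_⟩
  apply MonoidalClosed.curry_injective
  rw [MonoidalClosed.curry_natural_left, MonoidalClosed.curry_uncurry]
  refine Eq.trans ?_ (RMod.eId_yoneda (M := (cotensor W N).toRMod)
    (MonoidalClosed.curry ((ρ_ _).hom ≫ a)))
  rw [← hd', extId, Category.assoc]
  rfl

/-- The composition in the free extension. -/
noncomputable def extComp (x y z : A) :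
    (Γ.freeRep x).obj y ⊗ (Γ.freeRep y).obj z ⟶ (Γ.freeRep x).obj z :=
  (Γ.exists_bilinear (N := Γ.freeRep x) (𝟙 ((Γ.freeRep x).obj y))).choose z

lemma bilinear_extComp (x y : A) :
    BiLinear ((Γ.freeRep x).obj y) (Γ.freeRep y) (Γ.freeRep x) (Γ.extComp x y) :=
  (Γ.exists_bilinear (N := Γ.freeRep x) (𝟙 ((Γ.freeRep x).obj y))).choose_spec.1

lemma extId_extComp (x y : A) :
    (Γ.freeRep x).obj y ◁ Γ.extId y ≫ Γ.extComp x y y = (ρ_ _).hom :=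
  (Γ.exists_bilinear (N := Γ.freeRep x) (𝟙 ((Γ.freeRep x).obj y))).choose_spec.2.trans
    (Category.comp_id _)

lemma extId_extComp_assoc (x y : A) {Z : V} (h : (Γ.freeRep x).obj y ⟶ Z) :
    (Γ.freeRep x).obj y ◁ Γ.extId y ≫ Γ.extComp x y y ≫ h = (ρ_ _).hom ≫ h := by
  rw [reassoc_of% Γ.extId_extComp x y]

/-- The right unit law holds by the construction of `extComp`. The left unit law and associativity
compare families that are bilinear in the last variable, so they need only be checked on the
identity, where they reduce to the right unit law. -/
lemma ext_id_comp (x y : A) : (λ_ _).inv ≫ Γ.extId x ▷ _ ≫ Γ.extComp x x y = 𝟙 _ := by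
  rw [Iso.inv_comp_eq, Category.comp_id]
  refine bilinear_ext ((Γ.bilinear_extComp x x).precomp (Γ.extId x)) BiLinear.leftUnitor ?_ y
  rw [whisker_exchange_assoc, extId_extComp]
  simp [unitors_equal]

lemma ext_assoc (x y z t : A) :
    Γ.extComp x y z ▷ _ ≫ Γ.extComp x z t =
      (α_ _ _ _).hom ≫ _ ◁ Γ.extComp y z t ≫ Γ.extComp x y t := by
  refine bilinear_ext ((Γ.bilinear_extComp x z).precomp (Γ.extComp x y z))
    ((Γ.bilinear_extComp y z).comp (Γ.bilinear_extComp x y)) ?_ t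
  rw [whisker_exchange_assoc, extId_extComp, associator_naturality_right_assoc,
    ← MonoidalCategory.whiskerLeft_comp_assoc, extId_extComp]
  simp

/-- The free extension of `A` by the attaching data. -/
noncomputable def ext : VCat V where
  carrier := A
  str :=
    { Hom x y := (Γ.freeRep x).obj y
      id x := Γ.extId x
      comp x y z := Γ.extComp x y z
      id_comp x y := Γ.ext_id_comp x y
      comp_id x y := by rw [extId_extComp, Iso.inv_hom_id]
      assoc x y z t := by rw [Iso.inv_comp_eq, ext_assoc] }

/-- Composition with a morphism coming from `A` is the module action. This makes `extIncl`
functorial, and together with `extComp_t` it shows that a `V`-functor out of the extension is linear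
on each `freeRep x`. -/
lemma extComp_act (x y z : A) : (Γ.freeRep x).obj y ◁ (Γ.freeι (RMod.rep y)).app z ≫
    Γ.extComp x y z = (Γ.freeRep x).act y z := by
  rw [freeι_eq, MonoidalCategory.whiskerLeft_comp_assoc, MonoidalCategory.whiskerLeft_comp_assoc,
    (Γ.bilinear_extComp x y).act, associator_inv_naturality_middle_assoc,
    ← comp_whiskerRight_assoc, extId_extComp]
  simp

/-- The inclusion of `A` to its free extension. -/
noncomputable def extIncl : VFun A Γ.ext (fun x => x) where
  map x y := (Γ.freeι (RMod.rep x)).app y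
  map_id x := rfl
  map_comp x y z := by
    have h := Γ.extComp_act x y z
    have h' := (Γ.freeι (RMod.rep x)).act_app y z
    rw [← h] at h'
    exact h'.trans ((Category.assoc _ _ _).symm.trans (MonoidalCategory.tensorHom_def _ _ =≫ _).symm)

/-- The universal morphisms `Y s ⟶ E (src s) (tgt s)`. -/
noncomputable def extGen (s : Γ.S) : Γ.Y s ⟶ (Γ.freeRep (Γ.src s)).obj (Γ.tgt s) :=
  (λ_ _).inv ≫ Γ.extId _ ▷ _ ≫ (Γ.freeRep (Γ.src s)).t s

lemma extComp_t (x : A) (s : Γ.S) : (Γ.freeRep x).obj (Γ.src s) ◁ Γ.extGen s ≫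
    Γ.extComp x (Γ.src s) (Γ.tgt s) = (Γ.freeRep x).t s := by
  rw [extGen, MonoidalCategory.whiskerLeft_comp_assoc, MonoidalCategory.whiskerLeft_comp_assoc,
    (Γ.bilinear_extComp x _).t, associator_inv_naturality_middle_assoc,
    ← comp_whiskerRight_assoc, extId_extComp]
  simp

lemma j_extGen (s : Γ.S) : Γ.j s ≫ Γ.extGen s = Γ.g s ≫ Γ.extIncl.map (Γ.src s) (Γ.tgt s) := by
  change _ = Γ.g s ≫ (Γ.freeι (RMod.rep _)).app _
  rw [freeι_eq, extGen, leftUnitor_inv_naturality_assoc, whisker_exchange_assoc,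
    leftUnitor_inv_naturality_assoc, whisker_exchange_assoc, Mod.w]

variable {Γ}

lemma act_map (H : VFun Γ.ext B φ) (x z t : A) : (Γ.freeRep x).act z t ≫ H.map x t =
    H.map x z ▷ _ ≫ _ ◁ (Γ.extIncl.map z t ≫ H.map z t) ≫ eComp V (φ x) (φ z) (φ t) := by
  refine (Γ.extComp_act x z t =≫ H.map x t).symm.trans ((Category.assoc _ _ _).trans ?_)
  refine (_ ≫= H.map_comp x z t).trans ?_
  exact whiskerLeft_tensorHom_eq _ _ _ _

lemma t_map (H : VFun Γ.ext B φ) (x : A) (s : Γ.S) : (Γ.freeRep x).t s ≫ H.map x (Γ.tgt s) =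
    H.map x (Γ.src s) ▷ _ ≫ _ ◁ (Γ.extGen s ≫ H.map (Γ.src s) (Γ.tgt s)) ≫
      eComp V (φ x) (φ _) (φ _) := by
  refine (Γ.extComp_t x s =≫ H.map x _).symm.trans ((Category.assoc _ _ _).trans ?_)
  refine (_ ≫= H.map_comp x _ _).trans ?_
  exact whiskerLeft_tensorHom_eq _ _ _ _

/-- On `freeRep x` both functors are linear morphisms into `B(φ x, φ -)`; the hypotheses say that
`H` and `K` induce the same module structure there. Two such morphisms preserving the identity
coincide. -/
lemma ext_hom_ext {H K : VFun Γ.ext B φ}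
    (h₁ : ∀ x y : A, Γ.extIncl.map x y ≫ H.map x y = Γ.extIncl.map x y ≫ K.map x y)
    (h₂ : ∀ s, Γ.extGen s ≫ H.map (Γ.src s) (Γ.tgt s) = Γ.extGen s ≫ K.map (Γ.src s) (Γ.tgt s)) :
    H = K := by
  have hy (s : Γ.S) : Γ.j s ≫ Γ.extGen s ≫ H.map (Γ.src s) (Γ.tgt s) =
      Γ.g s ≫ (Γ.extIncl.comp H).map _ _ :=
    (Category.assoc _ _ _).symm.trans ((Γ.j_extGen s =≫ _).trans (Category.assoc _ _ _))
  refine VFun.ext (funext fun (x : A) => funext fun (z : A) => ?_)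
  let N := targetMod (Γ.extIncl.comp H) (fun s => Γ.extGen s ≫ H.map (Γ.src s) (Γ.tgt s)) hy (φ x)
  let f : (Γ.freeRep x).toRMod ⟶ N.toRMod :=
    { app := fun z => H.map x z
      act_app := fun z t => act_map H x z t }
  let g : (Γ.freeRep x).toRMod ⟶ N.toRMod :=
    { app := fun z => K.map x z
      act_app := fun z t => (act_map K x z t).trans (by rw [← h₁]; rfl) }
  have hf : IsLinear _ _ f := fun s => t_map H x s
  have hg : IsLinear _ _ g := fun s => (t_map K x s).trans (by rw [← h₂]; rfl)
  have : f = g := freeRep_hom_ext hf hg ((H.map_id x).trans (K.map_id x).symm)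
  exact congrArg (fun f => RMod.Hom.app f z) this

/-- The functor is defined on each `freeRep x` as the linear extension of `G` to the module
`targetMod`; only compatibility with composition remains to be proved. -/
lemma exists_ext_desc (G : VFun A B φ) (y : ∀ s, Γ.Y s ⟶ (φ (Γ.src s) ⟶[V] φ (Γ.tgt s)))
    (hy : ∀ s, Γ.j s ≫ y s = Γ.g s ≫ G.map _ _) :
    ∃ H : VFun Γ.ext B φ, (∀ x y : A, Γ.extIncl.map x y ≫ H.map x y = G.map x y) ∧
      ∀ s, Γ.extGen s ≫ H.map (Γ.src s) (Γ.tgt s) = y s := by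
  have (x : A) := Γ.exists_free_desc (M := RMod.rep x) (N := targetMod G y hy (φ x))
    { app := fun z => G.map x z
      act_app := fun z t => by
        rw [G.map_comp, MonoidalCategory.tensorHom_def, Category.assoc] }
  choose d hd hd' using this
  have hd'' (x y : A) : (Γ.freeι (RMod.rep x)).app y ≫ (d x).app y = G.map x y :=
    congrArg (fun f => RMod.Hom.app f y) (hd' x)
  have hid (x : A) : Γ.extId x ≫ (d x).app x = eId V (φ x) := by
    rw [extId, Category.assoc]
    exact (_ ≫= hd'' x x).trans (G.map_id x)
  -- Both sides are bilinear in the last variable and agree on the identity of `z`.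
  have hcomp (x z t : A) : Γ.extComp x z t ≫ (d x).app t =
      (d x).app z ▷ _ ≫ _ ◁ (d z).app t ≫ eComp V (φ x) (φ z) (φ t) := by
    refine bilinear_ext (φ := fun t => Γ.extComp x z t ≫ (d x).app t)
      (ψ := fun t => (d x).app z ▷ _ ≫ _ ◁ (d z).app t ≫ eComp V (φ x) (φ z) (φ t))
      ((Γ.bilinear_extComp x z).postcomp (hd x))
      (((bilinear_eComp G y hy (φ x) (φ z)).whiskerLeft (hd z)).precomp ((d x).app z)) ?_ t
    dsimp only
    rw [extId_extComp_assoc, whisker_exchange_assoc, ← MonoidalCategory.whiskerLeft_comp_assoc,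
      hid, ← rightUnitor_naturality]
    congr 1
    rw [← cancel_epi (ρ_ _).inv, Iso.inv_hom_id]
    exact (e_comp_id V _ _).symm
  refine ⟨{ map := fun x y => (d x).app y, map_id := hid, map_comp := fun x z t => ?_ }, hd'',
    fun s => ?_⟩
  · exact (hcomp x z t).trans
      ((MonoidalCategory.tensorHom_def _ _ =≫ _).trans (Category.assoc _ _ _)).symm
  · have h₁ := hd (Γ.src s) s
    refine (Category.assoc _ _ _).trans ((_ ≫= Category.assoc _ _ _).trans ?_)
    refine (_ ≫= _ ≫= h₁).trans ?_
    rw [← comp_whiskerRight_assoc, hid, ← whisker_exchange_assoc, ← leftUnitor_inv_naturality_assoc]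
    exact (_ ≫= e_id_comp V _ _).trans (Category.comp_id _)

lemma extIncl_tensoredCells {P : MorphismProperty V}
    (hP : ∀ {X Y K L : V} (i : X ⟶ Y) (j : K ⟶ L) (sq : (curriedTensor V).PushoutObjObj i j),
      P i → P j → P sq.ι) (hΓ : ∀ s, P (Γ.j s)) (x y : A) :
    (tensoredCells P).transfiniteCompositionsOfShape ℕ (Γ.extIncl.map x y) :=
  Γ.freeι_tensoredCells hP hΓ (RMod.rep x) y

end AttachingData

end EnrichedModel

namespace EnrichedModel

variable {V : Type u} [Category.{w} V] [MonoidalCategory V]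

/-! ### Transport of hom-objects along equalities -/

/-- The hom-objects of a `V`-category. -/
abbrev VCat.hm (A : VCat V) (x y : A) : V := x ⟶[V] y

/-- The identities of a `V`-category. -/
abbrev VCat.idn (A : VCat V) (x : A) : 𝟙_ V ⟶ A.hm x x := eId V x

/-- The composition of a `V`-category. -/
abbrev VCat.cmp (A : VCat V) (x y z : A) : A.hm x y ⊗ A.hm y z ⟶ A.hm x z := eComp V x y z

/-- The isomorphism between hom-objects given by equalities of objects. -/
def homCast {A : VCat V} {x x' y y' : A} (hx : x = x') (hy : y = y') :
    (x ⟶[V] y) ⟶ (x' ⟶[V] y') := eqToHom (by rw [hx, hy])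

section homCast

variable {A B : VCat V}

@[simp]
lemma homCast_rfl (x y : A) : homCast (rfl : x = x) (rfl : y = y) = 𝟙 _ := rfl

instance {x x' y y' : A} (hx : x = x') (hy : y = y') : IsIso (homCast hx hy) := by
  unfold homCast
  infer_instance

@[simp]
lemma homCast_comp {x x' x'' y y' y'' : A} (hx : x = x') (hy : y = y') (hx' : x' = x'')
    (hy' : y' = y'') : homCast hx hy ≫ homCast hx' hy' = homCast (hx.trans hx') (hy.trans hy') := by
  subst hx hy hx' hy'
  simp

lemma eId_homCast {x x' : A} (hx : x = x') : eId V x ≫ homCast hx hx = eId V x' := by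
  subst hx
  simp

lemma eComp_homCast {x x' y y' z z' : A} (hx : x = x') (hy : y = y') (hz : z = z') :
    eComp V x y z ≫ homCast hx hz = (homCast hx hy ⊗ₘ homCast hy hz) ≫ eComp V x' y' z' := by
  subst hx hy hz
  simp

lemma VFun.map_homCast {φ : A → B} (F : VFun A B φ) {x x' y y' : A} (hx : x = x') (hy : y = y') :
    homCast hx hy ≫ F.map x' y' = F.map x y ≫ homCast (congrArg φ hx) (congrArg φ hy) := by
  subst hx hy
  simp

lemma VFun.map_homCast_assoc {φ : A → B} (F : VFun A B φ) {x x' y y' : A} (hx : x = x')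
    (hy : y = y') {Z : V} (h : (φ x' ⟶[V] φ y') ⟶ Z) :
    homCast hx hy ≫ F.map x' y' ≫ h =
      F.map x y ≫ homCast (congrArg φ hx) (congrArg φ hy) ≫ h := by
  rw [reassoc_of% F.map_homCast hx hy]

/-- Changing the function underlying a `V`-functor to an equal function. -/
def VFun.copy {φ ψ : A → B} (F : VFun A B φ) (h : ∀ x, φ x = ψ x) : VFun A B ψ where
  map x y := F.map x y ≫ homCast (h x) (h y)
  map_id x := by rw [F.map_id_assoc, eId_homCast]
  map_comp x y z := by
    rw [F.map_comp_assoc, eComp_homCast (h x) (h y) (h z), tensorHom_comp_tensorHom_assoc]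

/-- The morphism of `V-Cat` given by a `V`-functor. -/
def VFun.hom {φ : A → B} (F : VFun A B φ) : A ⟶ B :=
  show EnrichedFunctor V A B from
  { obj := φ
    map := F.map
    map_id := F.map_id
    map_comp := F.map_comp }

/-- The `V`-functor underlying a morphism of `V-Cat`. -/
def VFun.of (f : A ⟶ B) : VFun A B (VCat.toFunctor f).obj where
  map := (VCat.toFunctor f).map
  map_id := (VCat.toFunctor f).map_id
  map_comp := (VCat.toFunctor f).map_comp

lemma VCat.hom_ext {f g : A ⟶ B} (h : ∀ x, (toFunctor f).obj x = (toFunctor g).obj x)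
    (h' : ∀ x y, (toFunctor f).map x y ≫ homCast (h x) (h y) = (toFunctor g).map x y) : f = g :=
  EnrichedFunctor.ext V h h'

lemma VCat.hom_congr {f g : A ⟶ B} (e : f = g) :
    ∃ h : ∀ x, (toFunctor f).obj x = (toFunctor g).obj x,
      ∀ x y, (toFunctor f).map x y ≫ homCast (h x) (h y) = (toFunctor g).map x y := by
  subst e
  exact ⟨fun _ => rfl, fun _ _ => Category.comp_id _⟩

lemma VFun.hom_eq {φ ψ : A → B} {F : VFun A B φ} {G : VFun A B ψ} (h : ∀ x, φ x = ψ x)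
    (h' : ∀ x y, F.map x y ≫ homCast (h x) (h y) = G.map x y) : F.hom = G.hom :=
  VCat.hom_ext h h'

lemma VFun.hom_of (f : A ⟶ B) : (VFun.of f).hom = f := rfl

lemma VFun.comp_hom {C : VCat V} {φ : A → B} {ψ : B → C} (F : VFun A B φ) (G : VFun B C ψ) :
    (F.comp G).hom = F.hom ≫ G.hom := rfl

lemma VFun.copy_hom {φ ψ : A → B} (F : VFun A B φ) (h : ∀ x, φ x = ψ x) :
    (F.copy h).hom = F.hom :=
  (VFun.hom_eq h (fun _ _ => rfl)).symm

lemma VFun.hom_injective {φ : A → B} {F G : VFun A B φ} (h : F.hom = G.hom) : F = G := by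
  obtain ⟨_, h⟩ := VCat.hom_congr h
  ext x y
  exact (Category.comp_id _).symm.trans (h x y)

end homCast

/-! ### Enriched categories with a fixed set of objects -/

variable (V) in
/-- The `V`-categories with set of objects `O`. -/
structure FixCat (O : Type w) where
  /-- the enriched category structure -/
  str : EnrichedCategory V O

namespace FixCat

variable {O : Type w}

/-- The associated `V`-category. -/
def toVCat (A : FixCat V O) : VCat V :=
  letI := A.str
  ⟨O⟩

instance : Category (FixCat V O) where
  Hom A B := VFun A.toVCat B.toVCat (fun x => x)
  id A := VFun.of (𝟙 A.toVCat)
  comp F G := F.comp G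
  id_comp _ := VFun.ext (funext fun _ => funext fun _ => Category.id_comp _)
  comp_id _ := VFun.ext (funext fun _ => funext fun _ => Category.comp_id _)
  assoc _ _ _ := VFun.ext (funext fun _ => funext fun _ => Category.assoc _ _ _)

/-- The `V`-functor underlying a morphism. -/
def toVFun {A B : FixCat V O} (f : A ⟶ B) : VFun A.toVCat B.toVCat (fun x => x) := f

end FixCat

/-! ### Discrete enriched categories -/

section Disc

variable [HasColimits V] (O : Type w)

/-- The hom-objects of the discrete category: coproducts of copies of the unit. -/
noncomputable abbrev discHom {O : Type w} (x y : O) : V :=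
  colimit ((Functor.const (Discrete (PLift (x = y)))).obj (𝟙_ V))

/-- The canonical morphism from the unit. -/
noncomputable def discι {O : Type w} {x y : O} (h : x = y) : 𝟙_ V ⟶ discHom x y :=
  colimit.ι ((Functor.const (Discrete (PLift (x = y)))).obj (𝟙_ V)) ⟨⟨h⟩⟩

variable {O}

lemma disc_hom_ext {x y : O} {Z : V} {f g : discHom x y ⟶ Z}
    (h : ∀ e : x = y, discι e ≫ f = discι e ≫ g) : f = g :=
  colimit.hom_ext fun j => h j.as.down

/-- Morphisms from the hom-objects of the discrete category. -/
noncomputable def discDesc {x y : O} {Z : V} (f : x = y → (𝟙_ V ⟶ Z)) : discHom x y ⟶ Z :=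
  colimit.desc _ ⟨Z, { app := fun j => f j.as.down }⟩

lemma discι_discDesc {x y : O} {Z : V} (f : x = y → (𝟙_ V ⟶ Z)) (h : x = y) :
    discι h ≫ discDesc f = f h := colimit.ι_desc _ _

variable [MonoidalClosed V] [SymmetricCategory V]

lemma disc_tensor_hom_ext {x y : O} {B Z : V} {f g : discHom x y ⊗ B ⟶ Z}
    (h : ∀ e : x = y, discι e ▷ B ≫ f = discι e ▷ B ≫ g) : f = g :=
  RMod.colimit_tensor_hom_ext fun j => h j.as.down

/-- The composition of the discrete category. -/
noncomputable def discComp (x y z : O) : discHom x y ⊗ discHom y z ⟶ (discHom x z : V) :=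
  RMod.colimitTensorDesc (fun j => (λ_ _).hom ≫ eqToHom (by rw [j.as.down]))
    (fun φ => by simp)

lemma discι_discComp (x z : O) : discι (rfl : x = x) ▷ _ ≫ discComp x x z =
    (λ_ (discHom x z : V)).hom := by
  have := RMod.ι_colimitTensorDesc
    (G := (Functor.const (Discrete (PLift (x = x)))).obj (𝟙_ V))
    (fun j => (λ_ (discHom x z : V)).hom ≫ eqToHom (by rw [j.as.down])) (fun φ => by simp) ⟨⟨rfl⟩⟩
  exact this.trans (Category.comp_id _)

variable (V O) in
/-- The discrete `V`-category. -/
noncomputable def disc : FixCat V O where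
  str :=
    { Hom x y := discHom x y
      id x := discι rfl
      comp x y z := discComp x y z
      id_comp x y := by rw [discι_discComp, Iso.inv_hom_id]
      comp_id x y := by
        rw [Iso.inv_comp_eq, Category.comp_id]
        refine disc_tensor_hom_ext fun e => ?_
        subst e
        rw [← whisker_exchange_assoc, discι_discComp]
        simp [unitors_equal]
      assoc x y z t := by
        refine disc_tensor_hom_ext fun e => ?_
        subst e
        rw [associator_inv_naturality_left_assoc, ← comp_whiskerRight_assoc, discι_discComp,
          ← whisker_exchange_assoc, discι_discComp]
        simp }

/-- `V`-functors from discrete `V`-categories. -/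
noncomputable def discVFun (B : VCat V) (φ : O → B) : VFun (disc V O).toVCat B φ where
  map x y := discDesc (fun h => eId V (φ x) ≫ homCast rfl (congrArg φ h))
  map_id x := (discι_discDesc _ rfl).trans (Category.comp_id _)
  map_comp x y z := by
    refine disc_tensor_hom_ext fun e => ?_
    subst e
    refine (reassoc_of% discι_discComp (V := V) x z) _ |>.trans ?_
    have h {f : discHom x x ⟶ (φ x ⟶[V] φ x)} (hf : discι rfl ≫ f = eId V (φ x))
        (g : discHom x z ⟶ (φ x ⟶[V] φ z)) :
        (λ_ _).hom ≫ g = discι rfl ▷ _ ≫ (f ⊗ₘ g) ≫ eComp V (φ x) (φ x) (φ z) := by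
      rw [MonoidalCategory.tensorHom_def, Category.assoc, ← comp_whiskerRight_assoc, hf,
        ← whisker_exchange_assoc]
      have := e_id_comp V (φ x) (φ z)
      rw [Iso.inv_comp_eq, Category.comp_id] at this
      rw [this, leftUnitor_naturality]
    exact h ((discι_discDesc _ rfl).trans (Category.comp_id _)) _

lemma discVFun_ext {B : VCat V} {φ : O → B} (F G : VFun (disc V O).toVCat B φ) : F = G := by
  refine VFun.ext (funext fun x => funext fun y => disc_hom_ext fun e => ?_)
  subst e
  exact (F.map_id x).trans (G.map_id x).symm

end Disc

/-! ### Generators and relations -/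

section Presentation

variable [HasColimits V] [MonoidalClosed V] [SymmetricCategory V] {O : Type w}

/-- Free `V`-categories. -/
lemma exists_freeCat {S : Type w} (src tgt : S → O) (Y : S → V) :
    ∃ (F : FixCat V O) (y : ∀ s, Y s ⟶ F.toVCat.hm (src s) (tgt s)),
      ∀ (B : VCat V) (φ : O → B),
        (∀ f : ∀ s, Y s ⟶ (φ (src s) ⟶[V] φ (tgt s)), ∃ H : VFun F.toVCat B φ,
          ∀ s, y s ≫ H.map (src s) (tgt s) = f s) ∧
        (∀ H H' : VFun F.toVCat B φ,
          (∀ s, y s ≫ H.map (src s) (tgt s) = y s ≫ H'.map (src s) (tgt s)) → H = H') := by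
  -- With initial domains the attaching maps carry no condition, so extending the discrete
  -- `V`-category adjoins the `Y s` freely.
  let Γ : AttachingData (disc V O).toVCat :=
    { S := S, src := src, tgt := tgt, X := fun _ => ⊥_ V, Y := Y, j := fun s => initial.to _
      g := fun s => initial.to _ }
  refine ⟨⟨Γ.ext.str⟩, Γ.extGen, fun B φ => ⟨fun f => ?_, fun H H' h => ?_⟩⟩
  · obtain ⟨H, -, hH⟩ := Γ.exists_ext_desc (discVFun B φ) f (fun s => initial.hom_ext _ _)
    exact ⟨H, hH⟩
  · refine Γ.ext_hom_ext (H := H) (K := H') (fun x y => ?_) h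
    exact congrArg (fun F => VFun.map F x y)
      (discVFun_ext (Γ.extIncl.comp H) (Γ.extIncl.comp H'))

/-- Quotients of `V`-categories. -/
lemma exists_quotient (A : FixCat V O) {S : Type w} (src tgt : S → O) (R : S → V)
    (r r' : ∀ s, R s ⟶ A.toVCat.hm (src s) (tgt s)) :
    ∃ (Q : FixCat V O) (p : VFun A.toVCat Q.toVCat (fun x => x)),
      (∀ s, r s ≫ p.map _ _ = r' s ≫ p.map _ _) ∧
      ∀ (B : VCat V) (φ : O → B),
        (∀ G : VFun A.toVCat B φ, (∀ s, r s ≫ G.map (src s) (tgt s) = r' s ≫ G.map _ _) →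
          ∃ H : VFun Q.toVCat B φ, p.comp H = G) ∧
        (∀ H H' : VFun Q.toVCat B φ, p.comp H = p.comp H' → H = H') := by
  -- Attaching the codiagonal of `R s` along `(r s, r' s)` identifies `r s` with `r' s`; nothing new
  -- is adjoined, since the generator `extGen s` is the common image of the two.
  let Γ : AttachingData A.toVCat :=
    { S := S, src := src, tgt := tgt, X := fun s => R s ⨿ R s, Y := R
      j := fun s => coprod.desc (𝟙 _) (𝟙 _), g := fun s => coprod.desc (r s) (r' s) }
  have h₁ (s : S) : Γ.extGen s = r s ≫ Γ.extIncl.map (src s) (tgt s) := by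
    have h : coprod.inl ≫ (coprod.desc (𝟙 _) (𝟙 _) ≫ Γ.extGen s) =
      coprod.inl ≫ coprod.desc (r s) (r' s) ≫ Γ.extIncl.map (src s) (tgt s) :=
        coprod.inl ≫= Γ.j_extGen s
    rwa [coprod.inl_desc_assoc, coprod.inl_desc_assoc, Category.id_comp] at h
  have h₂ (s : S) : Γ.extGen s = r' s ≫ Γ.extIncl.map (src s) (tgt s) := by
    have h : coprod.inr ≫ (coprod.desc (𝟙 _) (𝟙 _) ≫ Γ.extGen s) =
      coprod.inr ≫ coprod.desc (r s) (r' s) ≫ Γ.extIncl.map (src s) (tgt s) :=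
        coprod.inr ≫= Γ.j_extGen s
    rwa [coprod.inr_desc_assoc, coprod.inr_desc_assoc, Category.id_comp] at h
  refine ⟨⟨Γ.ext.str⟩, Γ.extIncl, fun s => (h₁ s).symm.trans (h₂ s),
    fun B φ => ⟨fun G hG => ?_, fun H H' h => ?_⟩⟩
  · obtain ⟨H, hH, -⟩ := Γ.exists_ext_desc G (fun s => r s ≫ G.map _ _) (fun s => by
      change coprod.desc (𝟙 _) (𝟙 _) ≫ r s ≫ G.map (src s) (tgt s) =
        coprod.desc (r s) (r' s) ≫ G.map (src s) (tgt s)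
      ext
      · rw [coprod.inl_desc_assoc, coprod.inl_desc_assoc, Category.id_comp]
      · rw [coprod.inr_desc_assoc, coprod.inr_desc_assoc, Category.id_comp, hG])
    exact ⟨H, VFun.ext (funext fun x => funext fun y => hH x y)⟩
  · have h₃ (x y : O) : Γ.extIncl.map x y ≫ H.map x y = Γ.extIncl.map x y ≫ H'.map x y :=
      congrArg (fun F => VFun.map F x y) h
    refine Γ.ext_hom_ext (H := H) (K := H') h₃ (fun s => ?_)
    refine (h₁ s =≫ H.map (src s) (tgt s)).trans ?_
    refine Eq.trans ?_ (h₁ s =≫ H'.map (src s) (tgt s)).symm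
    exact (Category.assoc _ _ _).trans ((_ ≫= h₃ _ _).trans (Category.assoc _ _ _).symm)

/-- Families of `V`-categories with functions to a set `O`, and transition functors. -/
structure CatDiagram (V : Type u) [Category.{w} V] [MonoidalCategory V] (O : Type w) where
  /-- the index set -/
  J : Type w
  /-- the `V`-categories -/
  D : J → VCat V
  /-- the functions to `O` -/
  c (j : J) : D j → O
  /-- the index set for the transition functors -/
  T : Type w
  /-- the sources -/
  src : T → J
  /-- the targets -/
  tgt : T → J
  /-- the functions underlying the transition functors -/
  φ (t : T) : D (src t) → D (tgt t)
  /-- the transition functors -/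
  f (t : T) : VFun (D (src t)) (D (tgt t)) (φ t)
  hφ (t : T) (x : D (src t)) : c (tgt t) (φ t x) = c (src t) x

namespace CatDiagram

variable (K : CatDiagram V O)

/-- The type of generators of the colimit. -/
abbrev Gen : Type w := Σ j, K.D j × K.D j

/-- The type of relations of the colimit. -/
inductive Rel : Type w
  | id (j : K.J) (x : K.D j)
  | comp (j : K.J) (x y z : K.D j)
  | map (t : K.T) (x y : K.D (K.src t))

/-- The source of a relation. -/
@[reducible] def Rel.src : K.Rel → O
  | .id j x => K.c j x
  | .comp j x _ _ => K.c j x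
  | .map t x _ => K.c _ x

/-- The target of a relation. -/
@[reducible] def Rel.tgt : K.Rel → O
  | .id j x => K.c j x
  | .comp j _ _ z => K.c j z
  | .map t _ y => K.c _ y

/-- The object of relations. -/
@[reducible] def Rel.R : K.Rel → V
  | .id _ _ => 𝟙_ V
  | .comp _ x y z => (x ⟶[V] y) ⊗ (y ⟶[V] z)
  | .map _ x y => x ⟶[V] y

variable {K}

/-- The first morphism of a relation. -/
@[reducible] def Rel.fst {B : VCat V} {φ : O → B}
    (m : ∀ j (x y : K.D j), (x ⟶[V] y) ⟶ (φ (K.c j x) ⟶[V] φ (K.c j y))) :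
    ∀ r : K.Rel, Rel.R K r ⟶ (φ (Rel.src K r) ⟶[V] φ (Rel.tgt K r))
  | .id j x => eId V x ≫ m j x x
  | .comp j x y z => eComp V x y z ≫ m j x z
  | .map _ x y => m _ x y

/-- The second morphism of a relation. -/
@[reducible] def Rel.snd {B : VCat V} {φ : O → B}
    (m : ∀ j (x y : K.D j), (x ⟶[V] y) ⟶ (φ (K.c j x) ⟶[V] φ (K.c j y))) :
    ∀ r : K.Rel, Rel.R K r ⟶ (φ (Rel.src K r) ⟶[V] φ (Rel.tgt K r))
  | .id j x => eId V (φ (K.c j x))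
  | .comp j x y z => (m j x y ⊗ₘ m j y z) ≫ eComp V _ _ _
  | .map t x y => (K.f t).map x y ≫ m _ _ _ ≫
      homCast (congrArg φ (K.hφ t x)) (congrArg φ (K.hφ t y))

variable (K)

/-- Colimits of `V`-categories, for a given cocone on sets of objects. -/
theorem exists_colimit : ∃ (Q : FixCat V O) (i : ∀ j, VFun (K.D j) Q.toVCat (K.c j)),
    (∀ t, ((K.f t).comp (i _)).copy (K.hφ t) = i (K.src t)) ∧
    ∀ (B : VCat V) (φ : O → B),
      (∀ G : ∀ j, VFun (K.D j) B (fun x => φ (K.c j x)),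
        (∀ t, ((K.f t).comp (G _)).copy (fun x => congrArg φ (K.hφ t x)) = G (K.src t)) →
        ∃ H : VFun Q.toVCat B φ, ∀ j, (i j).comp H = G j) ∧
      (∀ H H' : VFun Q.toVCat B φ, (∀ j, (i j).comp H = (i j).comp H') → H = H') := by
  -- The generators are all hom-objects of all the `V`-categories of the diagram. The relations then
  -- force functoriality of the morphisms `m j` and compatibility with the transition functors.
  obtain ⟨F, y, hF⟩ := exists_freeCat (V := V) (S := K.Gen) (fun s => K.c s.1 s.2.1)
    (fun s => K.c s.1 s.2.2) (fun s => s.2.1 ⟶[V] s.2.2)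
  let m (j) (x y' : K.D j) : (x ⟶[V] y') ⟶ F.toVCat.hm (K.c j x) (K.c j y') :=
    y ⟨j, x, y'⟩
  -- Applying a `V`-functor to a relation between the generators gives the corresponding relation
  -- between their images. Functors out of the quotient are thus the same as compatible families of
  -- functors.
  have key {B : VCat V} {φ : O → B} (G : VFun F.toVCat B φ) (r : K.Rel) :
      Rel.fst (φ := fun x => x) m r ≫ G.map _ _ =
        Rel.fst (fun j x y => m j x y ≫ G.map (K.c j x) (K.c j y)) r ∧
      Rel.snd (φ := fun x => x) m r ≫ G.map _ _ =
        Rel.snd (fun j x y => m j x y ≫ G.map (K.c j x) (K.c j y)) r := by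
    cases r with
    | id j x => exact ⟨Category.assoc _ _ _, G.map_id _⟩
    | comp j x y z =>
      refine ⟨Category.assoc _ _ _, (Category.assoc _ _ _).trans ((_ ≫= G.map_comp _ _ _).trans ?_)⟩
      exact (tensorHom_comp_tensorHom_assoc _ _ _ _ _)
    | map t x y =>
      refine ⟨rfl, ?_⟩
      refine (Category.assoc _ _ _).trans (_ ≫= (Category.assoc _ _ _).trans ?_)
      exact (_ ≫= G.map_homCast (K.hφ t x) (K.hφ t y)).trans (Category.assoc _ _ _).symm
  obtain ⟨Q, p, hp, hQ⟩ := exists_quotient F (Rel.src K) (Rel.tgt K) (Rel.R K)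
    (Rel.fst (B := F.toVCat) (φ := fun x => x) m) (Rel.snd (B := F.toVCat) (φ := fun x => x) m)
  have hp' (r : K.Rel) : Rel.fst (B := Q.toVCat) (φ := fun x => x)
        (fun j x y => m j x y ≫ p.map (K.c j x) (K.c j y)) r =
      Rel.snd (B := Q.toVCat) (φ := fun x => x) (fun j x y => m j x y ≫ p.map (K.c j x) (K.c j y)) r := by
    exact (key p r).1.symm.trans ((hp r).trans (key p r).2)
  refine ⟨Q, fun j => ⟨fun x y => m j x y ≫ p.map (K.c j x) (K.c j y), fun x => hp' (.id j x),
    fun x y z => hp' (.comp j x y z)⟩, fun t => ?_, fun B φ => ⟨fun G hG => ?_, fun H H' h => ?_⟩⟩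
  · refine VFun.ext (funext fun x => funext fun y => ?_)
    exact (Category.assoc _ _ _).trans (hp' (.map t x y)).symm
  · obtain ⟨G', hG'⟩ := (hF B φ).1 (fun s => (G s.1).map s.2.1 s.2.2)
    have hG'' : (fun j x y => m j x y ≫ G'.map (K.c j x) (K.c j y)) = fun j => (G j).map :=
      funext fun j => funext fun x => funext fun y => hG' ⟨j, x, y⟩
    obtain ⟨H, hH⟩ := (hQ B φ).1 G' (fun r => by
      refine (key G' r).1.trans (Eq.trans ?_ (key G' r).2.symm)
      rw [hG'']
      cases r with
      | id j x => exact (G j).map_id x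
      | comp j x y z => exact (G j).map_comp x y z
      | map t x y =>
        have := congrArg (fun F => VFun.map F x y) (hG t)
        exact this.symm.trans (Category.assoc _ _ _))
    refine ⟨H, fun j => VFun.ext (funext fun x => funext fun y => ?_)⟩
    refine (Category.assoc _ _ _).trans ?_
    refine (_ ≫= congrArg (fun F => VFun.map F (K.c j x) (K.c j y)) hH).trans ?_
    exact hG' ⟨j, x, y⟩
  · refine (hQ B φ).2 _ _ ((hF B φ).2 _ _ fun s => ?_)
    have := congrArg (fun F => VFun.map F s.2.1 s.2.2) (h s.1)
    exact (Category.assoc _ _ _).symm.trans (this.trans (Category.assoc _ _ _))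

end CatDiagram

end Presentation

end EnrichedModel

namespace EnrichedModel

variable {V : Type u} [Category.{w} V] [MonoidalCategory V]

/-! ### Cocompleteness -/

section FixCat

variable [HasColimits V] [MonoidalClosed V] [SymmetricCategory V] {O : Type w}

instance : HasColimitsOfSize.{w, w} (FixCat V O) where
  has_colimits_of_shape J _ := ⟨fun F => by
    let K : CatDiagram V O :=
      { J := J
        D := fun j => (F.obj j).toVCat
        c := fun _ x => x
        T := Σ i j : J, i ⟶ j
        src := fun t => t.1
        tgt := fun t => t.2.1
        φ := fun _ x => x
        f := fun t => F.map t.2.2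
        hφ := fun _ _ => rfl }
    obtain ⟨Q, i, hi, hQ⟩ := K.exists_colimit
    have hcopy {A B : FixCat V O} (G : VFun A.toVCat B.toVCat (fun x => x))
        (h : ∀ x : O, x = x) : VFun.copy (B := B.toVCat) G h = G :=
      VFun.ext (funext fun x => funext fun y => Category.comp_id (G.map x y))
    let c : Cocone F :=
      { pt := Q
        ι := { app := fun j => i j
               naturality := fun j j' φ => ((hcopy _ _).symm.trans (hi ⟨j, j', φ⟩)).trans
                  (Category.comp_id (X := F.obj j) (Y := Q) (i j)).symm } }
    have hd (s : Cocone F) := (hQ s.pt.toVCat (fun x => x)).1 (fun j => s.ι.app j)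
      (fun t => (hcopy _ _).trans (s.w t.2.2))
    choose d hd using hd
    exact ⟨c, { desc := d, fac := hd, uniq := fun s m hm => (hQ s.pt.toVCat (fun x => x)).2 _ _
                                      (fun j => (hm j).trans (hd s j).symm) }⟩⟩

end FixCat

section VCat

variable (V) in
/-- The set of objects of a `V`-category, as a functor. -/
def objects : VCat V ⥤ Type w where
  obj A := A.carrier
  map f := ↾(VCat.toFunctor f).obj

variable [HasColimits V] [MonoidalClosed V] [SymmetricCategory V]

/-- The objects form the colimit of the sets of objects; over this set, `exists_colimit` supplies
the hom-objects. A cocone `s` first determines a function `φ s` on objects, then a `V`-functor over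
it; `VFun.copy` absorbs the equalities of objects between the two. -/
instance : HasColimitsOfSize.{w, w} (VCat V) where
  has_colimits_of_shape J _ := ⟨fun F => by
    let C := colimit.cocone (F ⋙ objects V)
    have hC : IsColimit C := colimit.isColimit _
    let K : CatDiagram V C.pt :=
      { J := J
        D := F.obj
        c := fun j x => C.ι.app j x
        T := Σ i j : J, i ⟶ j
        src := fun t => t.1
        tgt := fun t => t.2.1
        φ := fun t => (VCat.toFunctor (F.map t.2.2)).obj
        f := fun t => .of (F.map t.2.2)
        hφ := fun t x => ConcreteCategory.congr_hom (C.w t.2.2) x }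
    obtain ⟨Q, i, hi, hQ⟩ := K.exists_colimit
    let c : Cocone F :=
      { pt := Q.toVCat
        ι := { app := fun j => (i j).hom
               naturality := fun j j' φ => by
                exact ((VFun.copy_hom (B := Q.toVCat) _ _).symm.trans
                  (congrArg VFun.hom (hi ⟨j, j', φ⟩))).trans (Category.comp_id _).symm } }
    have hφ (s : Cocone F) : ∃ φ : C.pt → s.pt.carrier, ∀ (j : J) (x : F.obj j),
        (VCat.toFunctor (s.ι.app j)).obj x = φ (C.ι.app j x) :=
      ⟨fun x => hC.desc ((objects V).mapCocone s) x, fun j x =>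
        (ConcreteCategory.congr_hom (hC.fac ((objects V).mapCocone s) j) x).symm⟩
    choose φ hφ using hφ
    have hd (s : Cocone F) := (hQ s.pt (φ s)).1 (fun j => (VFun.of (s.ι.app j)).copy (hφ s j))
      (fun t => VFun.hom_injective (by
        rw [VFun.copy_hom, VFun.copy_hom, VFun.comp_hom, VFun.copy_hom, VFun.hom_of]
        exact s.w t.2.2))
    choose d hd using hd
    have hd' (s : Cocone F) (j) : c.ι.app j ≫ (d s).hom = s.ι.app j := by
      have := congrArg VFun.hom (hd s j)
      rw [VFun.copy_hom] at this
      exact this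
    refine ⟨c, { desc := fun s => (d s).hom, fac := hd', uniq := fun s m hm => ?_ }⟩
    have hm' (x : C.pt) : (VCat.toFunctor (A := Q.toVCat) m).obj x = φ s x := by
      have := hC.hom_ext (f := (objects V).map m) (f' := ↾(φ s)) (fun j => by
        ext x
        refine Eq.trans ?_ (hφ s j x)
        exact ConcreteCategory.congr_hom (congrArg (objects V).map (hm j)) x)
      exact ConcreteCategory.congr_hom this x
    have h : (VFun.of (A := Q.toVCat) m).copy hm' = d s := (hQ s.pt (φ s)).2 _ _ (fun j => by
      rw [hd]
      apply VFun.hom_injective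
      exact (congrArg (fun k => c.ι.app j ≫ k)
        (VFun.copy_hom (A := Q.toVCat) (VFun.of (A := Q.toVCat) m) hm')).trans
        ((hm j).trans (VFun.copy_hom (VFun.of (s.ι.app j)) (hφ s j)).symm))
    exact (VFun.copy_hom (A := Q.toVCat) _ hm').symm.trans (congrArg VFun.hom h)⟩

instance : HasFiniteColimits (VCat V) :=
  have : HasColimitsOfSize.{0, 0} (VCat V) := hasColimitsOfSizeShrink.{0, 0, w, w} _
  inferInstance

end VCat

end EnrichedModel

namespace EnrichedModel

variable {V : Type u} [Category.{w} V] [MonoidalCategory V]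

/-! ### Directed colimits of enriched categories with a fixed set of objects -/

section Tensor

variable {J : Type*}

/-- The pointwise tensor product of two functors. -/
@[reducible]
def tensorFunctor [Category* J] (G H : J ⥤ V) : J ⥤ V where
  obj j := G.obj j ⊗ H.obj j
  map φ := G.map φ ⊗ₘ H.map φ

/-- The tensor product of cocones. -/
@[reducible]
def tensorCocone [Category* J] {G H : J ⥤ V} (c : Cocone G) (d : Cocone H) :
    Cocone (tensorFunctor G H) where
  pt := c.pt ⊗ d.pt
  ι := { app := fun j => c.ι.app j ⊗ₘ d.ι.app j
         naturality := fun i j φ => by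
           have h₁ := c.w φ
           have h₂ := d.w φ
           dsimp
           rw [tensorHom_comp_tensorHom, h₁, h₂, Category.comp_id] }

variable [LinearOrder J] [MonoidalClosed V] [SymmetricCategory V] {G H : J ⥤ V}
  {c : Cocone G} {d : Cocone H}

/-- Two colimits taken separately involve pairs `(i, j)`; in a linear order every pair lies below
the diagonal pair at `max i j`, so the diagonal suffices. -/
lemma tensorCocone_hom_ext (hc : IsColimit c) (hd : IsColimit d) {Z : V} {f g : c.pt ⊗ d.pt ⟶ Z}
    (h : ∀ j, (c.ι.app j ⊗ₘ d.ι.app j) ≫ f = (c.ι.app j ⊗ₘ d.ι.app j) ≫ g) : f = g := by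
  refine (isColimitOfPreserves (tensorRight d.pt) hc).hom_ext fun i => ?_
  refine (isColimitOfPreserves (tensorLeft (G.obj i)) hd).hom_ext fun j => ?_
  let a (i : J) : G.obj i ⟶ c.pt := c.ι.app i
  let b (j : J) : H.obj j ⟶ d.pt := d.ι.app j
  replace h (j : J) : (a j ⊗ₘ b j) ≫ f = (a j ⊗ₘ b j) ≫ g := h j
  change G.obj i ◁ b j ≫ a i ▷ d.pt ≫ f = G.obj i ◁ b j ≫ a i ▷ d.pt ≫ g
  have h₁ : G.map (homOfLE (le_max_left i j)) ≫ a _ = a i := c.w (homOfLE (le_max_left i j))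
  have h₂ : H.map (homOfLE (le_max_right i j)) ≫ b _ = b j := d.w (homOfLE (le_max_right i j))
  rw [whisker_exchange_assoc, ← tensorHom_def_assoc, whisker_exchange_assoc,
    ← tensorHom_def_assoc, ← h₁, ← h₂, ← tensorHom_comp_tensorHom_assoc, h,
    tensorHom_comp_tensorHom_assoc]

lemma exists_tensorCocone_desc (hc : IsColimit c) (hd : IsColimit d) (s : Cocone (tensorFunctor G H)) :
    ∃ f : c.pt ⊗ d.pt ⟶ s.pt, ∀ j, (c.ι.app j ⊗ₘ d.ι.app j) ≫ f = s.ι.app j := by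
  let a (i : J) : G.obj i ⟶ c.pt := c.ι.app i
  let b (j : J) : H.obj j ⟶ d.pt := d.ι.app j
  -- A family given only on the diagonal is extended to all pairs through the maximum; `hm` says
  -- that any common upper bound gives the same morphism.
  let m (i j : J) : G.obj i ⊗ H.obj j ⟶ s.pt :=
    (G.map (homOfLE (le_max_left i j)) ⊗ₘ H.map (homOfLE (le_max_right i j))) ≫ s.ι.app (max i j)
  have hm {i j k : J} (hi : i ≤ k) (hj : j ≤ k) :
      (G.map (homOfLE hi) ⊗ₘ H.map (homOfLE hj)) ≫ s.ι.app k = m i j := by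
    have := s.w (homOfLE (max_le hi hj))
    dsimp [m] at this ⊢
    rw [← this, tensorHom_comp_tensorHom_assoc, ← G.map_comp, ← H.map_comp]
    rfl
  have hm' {i i' j j' : J} (φ : i ⟶ i') (ψ : j ⟶ j') : (G.map φ ⊗ₘ H.map ψ) ≫ m i' j' = m i j := by
    dsimp [m]
    rw [tensorHom_comp_tensorHom_assoc, ← G.map_comp, ← H.map_comp]
    exact hm _ _
  let e (i : J) : G.obj i ⊗ d.pt ⟶ s.pt := (isColimitOfPreserves (tensorLeft (G.obj i)) hd).desc
    ⟨s.pt, { app := fun j => m i j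
             naturality := fun j j' φ => by
              have := hm' (𝟙 i) φ
              rw [G.map_id, id_tensorHom] at this
              exact this.trans (Category.comp_id _).symm }⟩
  have he (i j : J) : G.obj i ◁ b j ≫ e i = m i j :=
    (isColimitOfPreserves (tensorLeft (G.obj i)) hd).fac _ j
  let f : c.pt ⊗ d.pt ⟶ s.pt := (isColimitOfPreserves (tensorRight d.pt) hc).desc
    ⟨s.pt, { app := fun i => e i
             naturality := fun i i' φ => by
              refine Eq.trans ?_ (Category.comp_id _).symm
              refine (isColimitOfPreserves (tensorLeft (G.obj i)) hd).hom_ext fun j => ?_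
              change G.obj i ◁ b j ≫ G.map φ ▷ d.pt ≫ e i' = G.obj i ◁ b j ≫ e i
              rw [whisker_exchange_assoc, he, he]
              have := hm' φ (𝟙 j)
              rwa [H.map_id, tensorHom_id] at this }⟩
  have hf (i : J) : a i ▷ d.pt ≫ f = e i :=
    (isColimitOfPreserves (tensorRight d.pt) hc).fac _ i
  refine ⟨f, fun j => ?_⟩
  change (a j ⊗ₘ b j) ≫ f = _
  rw [tensorHom_def', Category.assoc, hf, he, ← hm le_rfl le_rfl]
  have h₁ := G.map_id j
  have h₂ := H.map_id j
  refine (congrArg₂ (fun a b => (a ⊗ₘ b) ≫ s.ι.app j) h₁ h₂).trans ?_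
  rw [id_tensorHom_id, Category.id_comp]

/-- In a closed monoidal category, the tensor product preserves directed colimits in
both variables. -/
noncomputable def tensorIsColimit (hc : IsColimit c) (hd : IsColimit d) :
    IsColimit (tensorCocone c d) where
  desc s := (exists_tensorCocone_desc hc hd s).choose
  fac s := (exists_tensorCocone_desc hc hd s).choose_spec
  uniq s _ hm := tensorCocone_hom_ext hc hd fun j =>
    (hm j).trans ((exists_tensorCocone_desc hc hd s).choose_spec j).symm

end Tensor

namespace FixCat

variable {O : Type w}

/-- The hom-objects. -/
def hm (A : FixCat V O) (x y : O) : V := A.toVCat.hm x y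

/-- The identities. -/
def idn (A : FixCat V O) (x : O) : 𝟙_ V ⟶ A.hm x x := A.toVCat.idn x

/-- The composition. -/
def cmp (A : FixCat V O) (x y z : O) : A.hm x y ⊗ A.hm y z ⟶ A.hm x z := A.toVCat.cmp x y z

lemma idn_cmp (A : FixCat V O) (x y : O) :
    (λ_ _).inv ≫ A.idn x ▷ A.hm x y ≫ A.cmp x x y = 𝟙 _ :=
  e_id_comp V (C := A.toVCat) x y

lemma cmp_idn (A : FixCat V O) (x y : O) :
    (ρ_ _).inv ≫ A.hm x y ◁ A.idn y ≫ A.cmp x y y = 𝟙 _ :=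
  e_comp_id V (C := A.toVCat) x y

lemma cmp_assoc (A : FixCat V O) (x y z t : O) :
    (α_ _ _ _).hom ≫ A.hm x y ◁ A.cmp y z t ≫ A.cmp x y t = A.cmp x y z ▷ _ ≫ A.cmp x z t :=
  e_assoc' V (C := A.toVCat) x y z t

/-- The morphisms on hom-objects. -/
def hom {A B : FixCat V O} (f : A ⟶ B) (x y : O) : A.hm x y ⟶ B.hm x y := (toVFun f).map x y

lemma hom_id {A B : FixCat V O} (f : A ⟶ B) (x : O) : A.idn x ≫ hom f x x = B.idn x :=
  (toVFun f).map_id x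

lemma hom_comp {A B : FixCat V O} (f : A ⟶ B) (x y z : O) :
    A.cmp x y z ≫ hom f x z = (hom f x y ⊗ₘ hom f y z) ≫ B.cmp x y z :=
  (toVFun f).map_comp x y z

@[simp]
lemma comp_hom {A B C : FixCat V O} (f : A ⟶ B) (g : B ⟶ C) (x y : O) :
    hom (f ≫ g) x y = hom f x y ≫ hom g x y := rfl

@[simp]
lemma id_hom (A : FixCat V O) (x y : O) : hom (𝟙 A) x y = 𝟙 _ := rfl

@[ext]
lemma hom_ext {A B : FixCat V O} {f g : A ⟶ B} (h : ∀ x y, hom f x y = hom g x y) : f = g :=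
  VFun.ext (funext fun x => funext fun y => h x y)

/-- The hom-object functor. -/
@[reducible]
def ev (x y : O) : FixCat V O ⥤ V where
  obj A := A.hm x y
  map f := hom f x y

section

variable [HasColimits V] {J : Type w} [LinearOrder J] (F : J ⥤ FixCat V O)

/-- The hom-objects of a directed colimit. -/
noncomputable abbrev colimHom (x y : O) : V := colimit (F ⋙ ev x y)

/-- The cocone to the hom-objects of a directed colimit. -/
noncomputable abbrev colimHomι (j : J) (x y : O) : (F.obj j).hm x y ⟶ colimHom F x y :=
  colimit.ι (F ⋙ ev x y) j

variable {F}

lemma map_colimHomι {i j : J} (φ : i ⟶ j) (x y : O) :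
    hom (F.map φ) x y ≫ colimHomι F j x y = colimHomι F i x y :=
  colimit.w (F ⋙ ev x y) φ

lemma colimHom_hom_ext {x y : O} {Z : V} {f g : colimHom F x y ⟶ Z}
    (h : ∀ j, colimHomι F j x y ≫ f = colimHomι F j x y ≫ g) : f = g :=
  colimit.hom_ext h

variable (F) [Nonempty J]

/-- The identities in a directed colimit. -/
noncomputable def colimId (x : O) : 𝟙_ V ⟶ colimHom F x x :=
  (F.obj (Classical.arbitrary J)).idn x ≫ colimHomι F _ x x

lemma idn_colimHomι (j : J) (x : O) :
    (F.obj j).idn x ≫ colimHomι F _ x x = colimId F x := by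
  have h {i j : J} (φ : i ⟶ j) : (F.obj j).idn x ≫ colimHomι F j x x =
      (F.obj i).idn x ≫ colimHomι F i x x := by
    rw [← map_colimHomι φ]
    exact (hom_id (F.map φ) x =≫ _).symm.trans (Category.assoc _ _ _)
  exact (h (homOfLE (le_max_left j (Classical.arbitrary J)))).symm.trans
    (h (homOfLE (le_max_right j (Classical.arbitrary J))))

variable [MonoidalClosed V] [SymmetricCategory V]

lemma exists_colimComp (x y z : O) : ∃ m : colimHom F x y ⊗ colimHom F y z ⟶ colimHom F x z,
    ∀ j, (colimHomι F j x y ⊗ₘ colimHomι F j y z) ≫ m =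
      (F.obj j).cmp x y z ≫ colimHomι F j x z := by
  refine exists_tensorCocone_desc (colimit.isColimit (F ⋙ ev x y)) (colimit.isColimit (F ⋙ ev y z))
    ⟨colimHom F x z, { app := fun (j : J) => (F.obj j).cmp x y z ≫ colimHomι F j x z
                       naturality := fun i j φ => ?_ }⟩
  have h₁ := hom_comp (F.map φ) x y z
  have h₂ := map_colimHomι (F := F) φ x z
  refine Eq.trans ?_ (Category.comp_id _).symm
  refine (Category.assoc _ _ _).symm.trans ((h₁.symm =≫ _).trans ?_)
  exact (Category.assoc _ _ _).trans (_ ≫= h₂)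

/-- The composition in a directed colimit. -/
noncomputable def colimComp (x y z : O) :
    colimHom F x y ⊗ colimHom F y z ⟶ colimHom F x z :=
  (exists_colimComp F x y z).choose

lemma ι_colimComp (j : J) (x y z : O) :
    (colimHomι F j x y ⊗ₘ colimHomι F j y z) ≫ colimComp F x y z =
      (F.obj j).cmp x y z ≫ colimHomι F j x z :=
  (exists_colimComp F x y z).choose_spec j

lemma ι_colimComp_assoc (j : J) (x y z : O) {Z : V} (h : colimHom F x z ⟶ Z) :
    (colimHomι F j x y ⊗ₘ colimHomι F j y z) ≫ colimComp F x y z ≫ h =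
      (F.obj j).cmp x y z ≫ colimHomι F j x z ≫ h := by
  rw [reassoc_of% ι_colimComp F j x y z]

/-- The directed colimit of `V`-categories with a fixed set of objects. -/
noncomputable def directedColim : FixCat V O where
  str :=
    { Hom := colimHom F
      id := colimId F
      comp := colimComp F
      id_comp x y := by
        refine colimHom_hom_ext fun j => ?_
        have h {X : V} (f : X ⟶ colimHom F x y) (a : 𝟙_ V ⟶ (F.obj j).hm x x) :
            f ≫ (λ_ _).inv ≫ (a ≫ colimHomι F j x x) ▷ _ ≫ colimComp F x x y =
              (λ_ _).inv ≫ a ▷ X ≫ (colimHomι F j x x ⊗ₘ f) ≫ colimComp F x x y := by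
          rw [leftUnitor_inv_naturality_assoc, tensorHom_def', Category.assoc,
            ← whisker_exchange_assoc, comp_whiskerRight_assoc]
        rw [← idn_colimHomι F j, h, ι_colimComp, Category.comp_id]
        refine Eq.trans ?_ ((F.obj j).idn_cmp x y =≫ colimHomι F j x y)|>.trans
          (Category.id_comp _)
        simp only [Category.assoc]
      comp_id x y := by
        refine colimHom_hom_ext fun j => ?_
        have h {X : V} (f : X ⟶ colimHom F x y) (a : 𝟙_ V ⟶ (F.obj j).hm y y) :
            f ≫ (ρ_ _).inv ≫ _ ◁ (a ≫ colimHomι F j y y) ≫ colimComp F x y y =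
              (ρ_ _).inv ≫ X ◁ a ≫ (f ⊗ₘ colimHomι F j y y) ≫ colimComp F x y y := by
          rw [rightUnitor_inv_naturality_assoc, MonoidalCategory.tensorHom_def, Category.assoc,
            whisker_exchange_assoc, MonoidalCategory.whiskerLeft_comp_assoc]
        rw [← idn_colimHomι F j, h, ι_colimComp, Category.comp_id]
        refine Eq.trans ?_ ((F.obj j).cmp_idn x y =≫ colimHomι F j x y)|>.trans
          (Category.id_comp _)
        simp only [Category.assoc]
      assoc x y z t := by
        refine (cancel_epi (α_ _ _ _).hom).1 ?_
        refine tensorCocone_hom_ext (tensorIsColimit (colimit.isColimit (F ⋙ ev x y))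
          (colimit.isColimit (F ⋙ ev y z))) (colimit.isColimit (F ⋙ ev z t)) fun j => ?_
        change ((colimHomι F j x y ⊗ₘ colimHomι F j y z) ⊗ₘ colimHomι F j z t) ≫ _ =
          ((colimHomι F j x y ⊗ₘ colimHomι F j y z) ⊗ₘ colimHomι F j z t) ≫ _
        rw [Iso.hom_inv_id_assoc, ← tensorHom_id, tensorHom_comp_tensorHom_assoc, ι_colimComp,
          Category.comp_id, associator_naturality_assoc, ← id_tensorHom,
          tensorHom_comp_tensorHom_assoc, ι_colimComp, Category.comp_id]
        have h₁ : ((F.obj j).cmp x y z ≫ colimHomι F j x z ⊗ₘ colimHomι F j z t) ≫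
            colimComp F x z t =
            (F.obj j).cmp x y z ▷ _ ≫ (F.obj j).cmp x z t ≫ colimHomι F j x t := by
          rw [← ι_colimComp F j x z t, ← tensorHom_id, tensorHom_comp_tensorHom_assoc, Category.id_comp]
        have h₂ : (colimHomι F j x y ⊗ₘ (F.obj j).cmp y z t ≫ colimHomι F j y t) ≫
            colimComp F x y t =
            _ ◁ (F.obj j).cmp y z t ≫ (F.obj j).cmp x y t ≫ colimHomι F j x t := by
          rw [← ι_colimComp F j x y t, ← id_tensorHom, tensorHom_comp_tensorHom_assoc, Category.id_comp]
        rw [h₁, h₂]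
        have := (F.obj j).cmp_assoc x y z t =≫ colimHomι F j x t
        simp only [Category.assoc] at this
        exact this.symm }

/-- The colimit cocone. -/
noncomputable def directedCocone : Cocone F where
  pt := directedColim F
  ι :=
    { app := fun j => show VFun (F.obj j).toVCat (directedColim F).toVCat (fun x => x) from
        { map := fun x y => colimHomι F j x y
          map_id := fun x => idn_colimHomι F j x
          map_comp := fun x y z => (ι_colimComp F j x y z).symm }
      naturality := fun i _ φ => hom_ext fun x y =>
        (map_colimHomι φ x y).trans (Category.comp_id (colimHomι F i x y)).symm }

lemma exists_directedColim_desc (s : Cocone F) :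
    ∃ d : directedColim F ⟶ s.pt, ∀ j x y, colimHomι F j x y ≫ hom d x y =
      hom (s.ι.app j) x y := by
  have h (x y : O) : ∃ d : colimHom F x y ⟶ s.pt.hm x y,
      ∀ j, colimHomι F j x y ≫ d = hom (s.ι.app j) x y :=
    ⟨colimit.desc _ ((ev x y).mapCocone s), fun j => colimit.ι_desc ((ev x y).mapCocone s) j⟩
  choose d hd using h
  have hid (x : O) : colimId F x ≫ d x x = s.pt.idn x := by
    rw [← idn_colimHomι F (Classical.arbitrary J), Category.assoc, hd]
    exact hom_id (s.ι.app _) x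
  have hcomp (x y z : O) : colimComp F x y z ≫ d x z = (d x y ⊗ₘ d y z) ≫ s.pt.cmp x y z := by
    refine tensorCocone_hom_ext (colimit.isColimit (F ⋙ ev x y)) (colimit.isColimit (F ⋙ ev y z))
      fun j => ?_
    change (colimHomι F j x y ⊗ₘ colimHomι F j y z) ≫ _ = _
    rw [ι_colimComp_assoc, hd]
    refine (hom_comp (s.ι.app j) x y z).trans ?_
    refine Eq.trans ?_ (tensorHom_comp_tensorHom_assoc _ _ _ _ _).symm
    exact congrArg₂ (fun a b => (a ⊗ₘ b) ≫ s.pt.cmp x y z) (hd x y j).symm (hd y z j).symm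
  let d' : VFun (directedColim F).toVCat s.pt.toVCat (fun x => x) :=
    { map := d, map_id := hid, map_comp := hcomp }
  exact ⟨d', fun j x y => hd x y j⟩

/-- The cocone `directedCocone F` is a colimit cocone. -/
noncomputable def directedCoconeIsColimit : IsColimit (directedCocone F) where
  desc s := (exists_directedColim_desc F s).choose
  fac s j := hom_ext fun x y => (exists_directedColim_desc F s).choose_spec j x y
  uniq s _ hm := hom_ext fun x y =>
    colimHom_hom_ext (F := F) fun j => Eq.trans
      (congrArg (fun f => hom f x y) (hm j))
        ((exists_directedColim_desc F s).choose_spec j x y).symm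

/-- Colimits of nonempty chains are computed on hom-objects. This transfers smallness and
transfinite compositions between `V` and `FixCat V O`. -/
instance preservesColimit_ev (x y : O) : PreservesColimit F (ev x y) :=
  preservesColimit_of_preserves_colimit_cocone (directedCoconeIsColimit F)
    (colimit.isColimit (F ⋙ ev x y))

end

end FixCat

end EnrichedModel

namespace EnrichedModel

variable {V : Type u} [Category.{w} V] [MonoidalCategory V]

/-! ### Free cells and the small object argument -/

namespace FixCat

variable {O : Type w}

/-- A morphism `m : X ⟶ A(x, y)` exhibiting `A` as the free `V`-category with a morphism
from `X` to the hom-object from `x` to `y`. -/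
structure IsFree {x y : O} {X : V} {A : FixCat V O} (m : X ⟶ A.hm x y) : Prop where
  exists_desc {B : FixCat V O} (f : X ⟶ B.hm x y) : ∃ d : A ⟶ B, m ≫ hom d x y = f
  hom_ext {B : FixCat V O} {f g : A ⟶ B} : m ≫ hom f x y = m ≫ hom g x y → f = g

/-- The bijection given by the universal property. -/
noncomputable def IsFree.equiv {x y : O} {X : V} {A : FixCat V O} {m : X ⟶ A.hm x y}
    (h : IsFree m) (B : FixCat V O) : (A ⟶ B) ≃ (X ⟶ B.hm x y) where
  toFun f := m ≫ hom f x y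
  invFun f := (h.exists_desc f).choose
  left_inv f := h.hom_ext (h.exists_desc (m ≫ hom f x y)).choose_spec
  right_inv f := (h.exists_desc f).choose_spec

/-- The natural isomorphism given by the universal property. -/
noncomputable def IsFree.coyonedaIso {x y : O} {X : V} {A : FixCat V O} {m : X ⟶ A.hm x y}
    (h : IsFree m) :
    coyoneda.obj (Opposite.op A) ≅ ev x y ⋙ coyoneda.obj (Opposite.op X) :=
  NatIso.ofComponents (fun B => (h.equiv B).toIso) (fun f => by
    ext g
    exact (Category.assoc m (hom g x y) (hom f x y)).symm)

/-- A free `V`-category on `X` corepresents `X ⟶ B(x, y)`, so lifting problems transpose as for an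
adjunction. -/
lemma hasLiftingProperty_iff {x y : O} {X Y : V} (i : X ⟶ Y) {A B C D : FixCat V O} {g : A ⟶ B}
    {m : X ⟶ A.hm x y} {n : Y ⟶ B.hm x y} (hm : IsFree m) (hn : IsFree n)
    (hg : m ≫ hom g x y = i ≫ n) (f : C ⟶ D) :
    HasLiftingProperty g f ↔ HasLiftingProperty i (hom f x y) := by
  refine ⟨fun h => ⟨fun {a b} sq => ?_⟩, fun h => ⟨fun {a b} sq => ?_⟩⟩
  · obtain ⟨a', rfl⟩ := hm.exists_desc a
    obtain ⟨b', rfl⟩ := hn.exists_desc b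
    have sq' : CommSq a' g f b' := ⟨hm.hom_ext (by
      have := sq.w
      rw [comp_hom, comp_hom, reassoc_of% hg, ← this, Category.assoc])⟩
    exact ⟨⟨⟨n ≫ hom sq'.lift x y, by rw [← reassoc_of% hg, ← comp_hom, sq'.fac_left],
      by rw [Category.assoc, ← comp_hom, sq'.fac_right]⟩⟩⟩
  · have sq' : CommSq (m ≫ hom a x y) i (hom f x y) (n ≫ hom b x y) := ⟨by
      rw [Category.assoc, ← comp_hom, sq.w, comp_hom, reassoc_of% hg]⟩
    obtain ⟨d, hd⟩ := hn.exists_desc sq'.lift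
    exact ⟨⟨⟨d, hm.hom_ext (by rw [comp_hom, reassoc_of% hg, hd, sq'.fac_left]),
      hn.hom_ext (by rw [comp_hom, reassoc_of% hd, sq'.fac_right])⟩⟩⟩

variable [HasColimits V] [MonoidalClosed V] [SymmetricCategory V]

lemma exists_isFree (x y : O) (X : V) : ∃ (A : FixCat V O) (m : X ⟶ A.hm x y), IsFree m := by
  obtain ⟨F, m, h⟩ := exists_freeCat (V := V) (S := PUnit.{w + 1}) (fun _ => x) (fun _ => y)
    (fun _ => X)
  exact ⟨F, m ⟨⟩, fun {B} f => ((h B.toVCat (fun x => x)).1 (fun _ => f)).imp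
    fun d hd => hd ⟨⟩, fun {B f g} hfg => (h B.toVCat (fun x => x)).2 f g (fun _ => hfg)⟩

/-- The free `V`-category with a morphism from `X` to the hom-object from `x` to `y`. -/
noncomputable def freeCell (x y : O) (X : V) : FixCat V O := (exists_isFree x y X).choose

/-- The universal morphism. -/
noncomputable def freeCellι (x y : O) (X : V) : X ⟶ (freeCell x y X).hm x y :=
  (exists_isFree x y X).choose_spec.choose

lemma isFree_freeCellι (x y : O) (X : V) : IsFree (freeCellι x y X) :=
  (exists_isFree x y X).choose_spec.choose_spec

/-- The functoriality of `freeCell`. -/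
noncomputable def freeCellMap (x y : O) {X Y : V} (i : X ⟶ Y) : freeCell x y X ⟶ freeCell x y Y :=
  ((isFree_freeCellι x y X).exists_desc (i ≫ freeCellι x y Y)).choose

lemma freeCellι_freeCellMap (x y : O) {X Y : V} (i : X ⟶ Y) :
    freeCellι x y X ≫ hom (freeCellMap x y i) x y = i ≫ freeCellι x y Y :=
  ((isFree_freeCellι x y X).exists_desc (i ≫ freeCellι x y Y)).choose_spec

variable (O) in
/-- The free cells on a class of morphisms of `V`. -/
noncomputable def freeCells (I : MorphismProperty V) : MorphismProperty (FixCat V O) :=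
  .ofHoms (fun t : (O × O) × { f : Arrow V // I f.hom } =>
    freeCellMap t.1.1 t.1.2 t.2.1.hom)

lemma freeCells_iff (I : MorphismProperty V) {A B : FixCat V O} (g : A ⟶ B) (hg : freeCells O I g) :
    ∃ (x y : O) (X Y : V) (i : X ⟶ Y) (m : X ⟶ A.hm x y) (n : Y ⟶ B.hm x y),
      I i ∧ IsFree m ∧ IsFree n ∧ m ≫ hom g x y = i ≫ n := by
  obtain ⟨⟨x, y⟩, i, hi⟩ := hg
  exact ⟨x, y, _, _, _, _, _, hi, isFree_freeCellι _ _ _, isFree_freeCellι _ _ _,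
    freeCellι_freeCellMap _ _ _⟩

lemma freeCells_mk {I : MorphismProperty V} (x y : O) {X Y : V} (i : X ⟶ Y) (hi : I i) :
    freeCells O I (freeCellMap x y i) :=
  .mk (f := fun t : (O × O) × { f : Arrow V // I f.hom } => freeCellMap t.1.1 t.1.2 t.2.1.hom)
    ⟨(x, y), Arrow.mk i, hi⟩

lemma rlp_freeCells_iff (I : MorphismProperty V) {A B : FixCat V O} (f : A ⟶ B) :
    (freeCells O I).rlp f ↔ ∀ x y, I.rlp (hom f x y) := by
  refine ⟨fun h x y X Y i hi => ?_, fun h X Y g hg => ?_⟩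
  · rw [← hasLiftingProperty_iff i (isFree_freeCellι x y X) (isFree_freeCellι x y Y)
      (freeCellι_freeCellMap x y i)]
    exact h _ (freeCells_mk x y i hi)
  · obtain ⟨x, y, X, Y, i, m, n, hi, hm, hn, hg⟩ := freeCells_iff I g hg
    rw [hasLiftingProperty_iff i hm hn hg]
    exact h x y _ hi

lemma isSmall_freeCells (I : MorphismProperty V) [MorphismProperty.IsSmall.{w} I] :
    MorphismProperty.IsSmall.{w} (freeCells O I) := by
  have h₁ : Small.{w} { f : Arrow V // I f.hom } := inferInstanceAs (Small.{w} I.toSet)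
  have h₂ : Small.{w} ((O × O) × { f : Arrow V // I f.hom }) := small_prod
  exact MorphismProperty.isSmall_ofHoms.{w} _

/-- The universal property determines the extension up to isomorphism; the last clause retains what
the module construction says about its hom-objects. -/
lemma exists_free_extension (A : FixCat V O) {S : Type w} (src tgt : S → O) {X Y : S → V}
    (i : ∀ s, X s ⟶ Y s) (g : ∀ s, X s ⟶ A.hm (src s) (tgt s)) :
    ∃ (E : FixCat V O) (e : A ⟶ E) (v : ∀ s, Y s ⟶ E.hm (src s) (tgt s)),
      (∀ s, i s ≫ v s = g s ≫ hom e _ _) ∧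
      (∀ {B : FixCat V O} (f : A ⟶ B) (y : ∀ s, Y s ⟶ B.hm (src s) (tgt s)),
        (∀ s, i s ≫ y s = g s ≫ hom f _ _) →
          ∃ p : E ⟶ B, e ≫ p = f ∧ ∀ s, v s ≫ hom p _ _ = y s) ∧
      (∀ {B : FixCat V O} {p q : E ⟶ B}, e ≫ p = e ≫ q →
        (∀ s, v s ≫ hom p _ _ = v s ≫ hom q _ _) → p = q) ∧
      ∀ {P : MorphismProperty V}
        (_ : ∀ {X Y K L : V} (i : X ⟶ Y) (j : K ⟶ L) (sq : (curriedTensor V).PushoutObjObj i j),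
          P i → P j → P sq.ι) (_ : ∀ s, P (i s)) (x y : O),
        (tensoredCells P).transfiniteCompositionsOfShape ℕ (hom e x y) := by
  let Γ : AttachingData A.toVCat :=
    { S := S, src := src, tgt := tgt, X := X, Y := Y, j := i, g := g }
  refine ⟨⟨Γ.ext.str⟩, Γ.extIncl, Γ.extGen, Γ.j_extGen, fun {B} f y hy => ?_, fun {B p q} h h' => ?_,
    fun hP hi x y => Γ.extIncl_tensoredCells hP hi x y⟩
  · obtain ⟨p, hp, hp'⟩ := Γ.exists_ext_desc (B := B.toVCat) (φ := fun x => x) f y hy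
    exact ⟨p, hom_ext hp, hp'⟩
  · exact Γ.ext_hom_ext (fun x y => congrArg (fun f => hom f x y) h) h'

/-- Free cells attachments are locally countable compositions of attachments of tensored cells. -/
lemma tensoredCells_of_pushouts {I P : MorphismProperty V} (hIP : I ≤ P)
    (hP : ∀ {X Y K L : V} (i : X ⟶ Y) (j : K ⟶ L) (sq : (curriedTensor V).PushoutObjObj i j),
      P i → P j → P sq.ι) {A B : FixCat V O} (f : A ⟶ B)
    (hf : (MorphismProperty.coproducts.{w} (freeCells O I)).pushouts f) (x y : O) :
    (tensoredCells P).transfiniteCompositionsOfShape ℕ (hom f x y) := by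
  obtain ⟨S, C, D, g, a, b, hg, h⟩ := IsCellAttachment.exists_of_mem_pushouts_coproducts hf
  choose src tgt X Y i m n hi hm hn hmn using fun s => freeCells_iff I (g s) (hg s)
  -- The free extension `E` along the same cells has the universal property of the pushout `B`. The
  -- two are isomorphic under `A`, so the cellular description of the hom-objects of `E` passes to
  -- `B`.
  obtain ⟨E, e, v, hv, hE, hE', hE''⟩ := exists_free_extension A src tgt i
    (fun s => m s ≫ hom (a s) (src s) (tgt s))
  obtain ⟨p, hp, hp'⟩ := hE f (fun s => n s ≫ hom (b s) (src s) (tgt s)) (fun s => by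
    have := h.w s
    rw [← reassoc_of% (hmn s), ← comp_hom, this, comp_hom, Category.assoc])
  choose v' hv' using fun s => (hn s).exists_desc (v s)
  obtain ⟨q, hq, hq'⟩ := h.exists_desc e v' (fun s => (hm s).hom_ext (by
    rw [comp_hom, reassoc_of% (hmn s), hv', hv, comp_hom, Category.assoc]))
  have hpq : p ≫ q = 𝟙 _ := by
    refine hE' (by rw [reassoc_of% hp, hq, Category.comp_id]) fun s => ?_
    rw [comp_hom, reassoc_of% (hp' s), ← comp_hom, hq', hv', id_hom, Category.comp_id]
  have hqp : q ≫ p = 𝟙 _ := by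
    refine h.hom_ext (by rw [reassoc_of% hq, hp, Category.comp_id]) fun s => (hn s).hom_ext ?_
    rw [reassoc_of% (hq' s), comp_hom, reassoc_of% (hv' s), hp', Category.comp_id]
  let ι : E.hm x y ≅ B.hm x y := ⟨hom p x y, hom q x y, by rw [← comp_hom, hpq]; rfl,
    by rw [← comp_hom, hqp]; rfl⟩
  have hι : hom e x y ≫ ι.hom = hom f x y := by rw [← hp]; rfl
  rw [← hι]
  have : IsIso ι.hom := ι.isIso_hom
  exact MorphismProperty.RespectsIso.postcomp _ ι.hom _
    (hE'' hP (fun s => hIP _ (hi s)) x y)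

/-! ### The small object argument for a fixed set of objects. -/

section SmallObject

instance (P : MorphismProperty V) : (cells P).RespectsIso :=
  MorphismProperty.RespectsIso.of_respects_arrow_iso _ fun f g e hf => by
    obtain ⟨J, _, _, _, _, ⟨hf⟩⟩ := (MorphismProperty.transfiniteCompositions_iff _ _).1 hf
    exact MorphismProperty.transfiniteCompositionsOfShape_le_transfiniteCompositions _ J _
      ⟨hf.ofArrowIso e⟩

instance (J : Type w) [LinearOrder J] [Nonempty J] (x y : O) :
    PreservesColimitsOfShape J (ev (V := V) x y) := ⟨fun {F} => preservesColimit_ev F x y⟩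

/-- `ev` preserves colimits of nonempty chains only, which is enough because some element lies below
a limit element. -/
instance (J : Type w) [LinearOrder J] (x y : O) :
    PreservesWellOrderContinuousOfShape J (ev (V := V) x y) where
  preservesColimitsOfShape j hj := by
    obtain ⟨i, hi⟩ := not_isMin_iff.1 hj.not_isMin
    have : Nonempty (Set.Iio j) := ⟨i, hi⟩
    infer_instance

variable {I P : MorphismProperty V}

/-- Relative free cell complexes are locally transfinite compositions of countable compositions
of attachments of tensored cells. -/
noncomputable def transfiniteCompositionOfShapeHom (hIP : I ≤ P)
    (hP : ∀ {X Y K L : V} (i : X ⟶ Y) (j : K ⟶ L) (sq : (curriedTensor V).PushoutObjObj i j),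
      P i → P j → P sq.ι) {J : Type w} [LinearOrder J] [SuccOrder J] [OrderBot J]
    [WellFoundedLT J] {A B : FixCat V O} {f : A ⟶ B}
    (hf : (MorphismProperty.coproducts.{w} (freeCells O I)).pushouts.TransfiniteCompositionOfShape
      J f) (x y : O) :
    ((tensoredCells P).transfiniteCompositionsOfShape ℕ).TransfiniteCompositionOfShape J
      (hom f x y) :=
  MorphismProperty.TransfiniteCompositionOfShape.map (F := ev x y)
    (hf.ofLE fun _ _ g hg => tensoredCells_of_pushouts hIP hP g hg x y)

/-- Each step is locally only a countable composition of attachments. Refining the whole sequence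
produces one transfinite composition of pushouts of coproducts of tensored cells, the form in which
the monoid axiom is stated. -/
lemma cells_hom (hIP : I ≤ P)
    (hP : ∀ {X Y K L : V} (i : X ⟶ Y) (j : K ⟶ L) (sq : (curriedTensor V).PushoutObjObj i j),
      P i → P j → P sq.ι) {J : Type w} [LinearOrder J] [SuccOrder J] [OrderBot J]
    [WellFoundedLT J] [NoMaxOrder J] {A B : FixCat V O} {f : A ⟶ B}
    (hf : (MorphismProperty.coproducts.{w} (freeCells O I)).pushouts.TransfiniteCompositionOfShape
      J f) (x y : O) : cells (tensored P) (hom f x y) := by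
  let h := transfiniteCompositionOfShapeHom hIP hP hf x y
  have h' := tensoredCells.cells_of_transfinite (fun j => h.map_mem j (not_isMax j)) h.isColimit
  rw [← h.fac]
  exact MorphismProperty.RespectsIso.precomp _ h.isoBot.inv _ h'

/-- Morphisms from the free cell on `X` are morphisms from `X` to a hom-object, and `ev` preserves
the colimits of the sequences in question. The steps of such a sequence are locally in `cells
(tensored P)`, so the smallness of `X` relative to that class suffices. -/
lemma isCardinalForSmallObjectArgument (hIP : I ≤ P)
    (hP : ∀ {X Y K L : V} (i : X ⟶ Y) (j : K ⟶ L) (sq : (curriedTensor V).PushoutObjObj i j),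
      P i → P j → P sq.ι) [MorphismProperty.IsSmall.{w} I]
    {κ : Cardinal.{w}} [Fact κ.IsRegular] [OrderBot κ.ord.ToType]
    (hκ : ∀ {A B : V} (i : A ⟶ B), I i → ∀ {X Y : V} (f : X ⟶ Y)
      (h : (cells (tensored P)).TransfiniteCompositionOfShape κ.ord.ToType f),
      PreservesColimit h.F (coyoneda.obj (Opposite.op A))) :
    (freeCells O I).IsCardinalForSmallObjectArgument κ where
  isSmall := isSmall_freeCells I
  preservesColimit {A B X Y} g hg f hf := by
    obtain ⟨x, y, X, Y, i, m, n, hi, hm, hn, hg⟩ := freeCells_iff I g hg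
    let hf' := hf.transfiniteCompositionOfShape.ofLE
      (W' := (MorphismProperty.coproducts.{w} (freeCells O I)).pushouts)
      (by rw [MorphismProperty.ofHoms_homFamily])
    let h := (transfiniteCompositionOfShapeHom hIP hP hf' x y).ofLE
      (fun _ _ _ => tensoredCells.cells_of_nat)
    have e : h.F = hf.F ⋙ ev x y := rfl
    have : PreservesColimit (hf.F ⋙ ev x y) (coyoneda.obj (Opposite.op X)) := by
      rw [← e]
      exact hκ i hi _ h
    exact preservesColimit_of_natIso _ hm.coyonedaIso.symm

/-- The small object argument for `V`-categories with a fixed set of objects. -/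
theorem exists_factorization (I P : MorphismProperty V) [MorphismProperty.IsSmall.{w} I]
    (hIP : I ≤ P)
    (hP : ∀ {X Y K L : V} (i : X ⟶ Y) (j : K ⟶ L) (sq : (curriedTensor V).PushoutObjObj i j),
      P i → P j → P sq.ι)
    (hI : ∀ {A B : V} (i : A ⟶ B), I i → IsSmallRelativeTo (cells (tensored P)) A)
    {A B : FixCat V O} (f : A ⟶ B) :
    ∃ (C : FixCat V O) (i : A ⟶ C) (p : C ⟶ B), i ≫ p = f ∧ (freeCells O I).rlp.llp i ∧
      (∀ x y, cells (tensored P) (hom i x y)) ∧ ∀ x y, I.rlp (hom p x y) := by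
  have : Small.{w} { f : Arrow V // I f.hom } := inferInstanceAs (Small.{w} I.toSet)
  choose κ hκ using fun t : Shrink.{w} { f : Arrow V // I f.hom } =>
    hI _ ((equivShrink { f : Arrow V // I f.hom }).symm t).2
  -- As the successor of an infinite cardinal `μ` is regular, and it bounds every `κ t`; the
  -- supremum makes sense because the smallness of `I` allows indexing by a type in the universe
  -- `w`.
  let μ : Cardinal.{w} := Order.succ (max Cardinal.aleph0 (⨆ t, κ t))
  have hμ : μ.IsRegular := Cardinal.isRegular_succ (le_max_left _ _)
  have : Fact μ.IsRegular := ⟨hμ⟩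
  let _ : OrderBot μ.ord.ToType :=
    have : Nonempty μ.ord.ToType := Ordinal.nonempty_toType_iff.2 (by simpa using hμ.pos.ne')
    WellFoundedLT.toOrderBot _
  have : NoMaxOrder μ.ord.ToType := Cardinal.noMaxOrder hμ.aleph0_le
  have : (freeCells O I).IsCardinalForSmallObjectArgument μ := by
    refine isCardinalForSmallObjectArgument hIP hP fun {A B} i hi {X Y} f h => ?_
    have := hκ (equivShrink _ ⟨Arrow.mk i, hi⟩) μ hμ
      (((le_ciSup Cardinal.bddAbove_of_small _).trans (le_max_right _ _)).trans
        (Order.le_succ _)) f h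
    rw [Equiv.symm_apply_apply] at this
    exact this
  obtain ⟨h⟩ := SmallObject.transfiniteCompositionsOfShape_ιObj (freeCells O I) μ f
  exact ⟨_, SmallObject.ιObj _ μ f, SmallObject.πObj _ μ f, SmallObject.ιObj_πObj _ μ f,
    SmallObject.llp_rlp_ιObj _ μ f, cells_hom hIP hP h,
    (rlp_freeCells_iff I _).1 (SmallObject.rlp_πObj _ μ f)⟩

end SmallObject

end FixCat

end EnrichedModel

namespace EnrichedModel

variable {V : Type u} [Category.{w} V] [MonoidalCategory V]

/-! ### Change of objects and factorizations of `V`-functors -/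

namespace FixCat

variable {O : Type w}

/-- The full image of a function to the set of objects of a `V`-category. -/
def pull (B : VCat V) (φ : O → B) : FixCat V O where
  str :=
    { Hom x y := B.hm (φ x) (φ y)
      id x := B.idn (φ x)
      comp x y z := B.cmp (φ x) (φ y) (φ z)
      id_comp _ _ := e_id_comp V _ _
      comp_id _ _ := e_comp_id V _ _
      assoc _ _ _ _ := e_assoc V _ _ _ _ }

/-- The `V`-functor from the full image. -/
def pullπ (B : VCat V) (φ : O → B) : VFun (pull B φ).toVCat B φ where
  map x y := 𝟙 (B.hm (φ x) (φ y))
  map_id x := Category.comp_id (B.idn (φ x))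
  map_comp x y z := by
    have : B.cmp (φ x) (φ y) (φ z) ≫ 𝟙 _ = (𝟙 _ ⊗ₘ 𝟙 _) ≫ B.cmp (φ x) (φ y) (φ z) := by simp
    exact this

/-- The morphism to the full image corresponding to a `V`-functor. -/
def toPull {A : FixCat V O} {B : VCat V} {φ : O → B} (F : VFun A.toVCat B φ) : A ⟶ pull B φ :=
  show VFun A.toVCat (pull B φ).toVCat (fun x => x) from
  { map := F.map
    map_id := F.map_id
    map_comp := F.map_comp }

lemma toPull_pullπ {A : FixCat V O} {B : VCat V} {φ : O → B} (F : VFun A.toVCat B φ) :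
    (toVFun (toPull F)).comp (pullπ B φ) = F :=
  VFun.ext (funext fun _ => funext fun _ => Category.comp_id _)

/-- A morphism which has the left lifting property with respect to local `Q`-morphisms for a
fixed set of objects has this property for all `V`-categories. -/
lemma hasLiftingProperty_of_fixed {Q : MorphismProperty V} {A C : FixCat V O} {i : A ⟶ C}
    (hi : ∀ {X Y : FixCat V O} (q : X ⟶ Y), (∀ x y, Q (hom q x y)) → HasLiftingProperty i q)
    {X Y : VCat V} (q : X ⟶ Y) (hq : locally Q q) : HasLiftingProperty (toVFun i).hom q where
  sq_hasLift {a b} sq := by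
    let φ : O → X := (VCat.toFunctor a).obj
    let a' : VFun A.toVCat X φ := VFun.of a
    obtain ⟨h, -⟩ := VCat.hom_congr sq.w
    let b' : VFun C.toVCat Y (fun x => (VCat.toFunctor q).obj (φ x)) :=
      (VFun.of b).copy fun x => (h x).symm
    have hb : b'.hom = b := VFun.copy_hom _ _
    -- Replacing `X` and `Y` by their full images along the functions on objects turns the lifting
    -- problem into one with set of objects `O`, with the same hom-objects.
    let q' : pull X φ ⟶ pull Y (fun x => (VCat.toFunctor q).obj (φ x)) :=
      toPull ((pullπ X φ).comp (VFun.of q))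
    have hq' : HasLiftingProperty i q' := hi q' fun x y => by
      have : hom q' x y = (VCat.toFunctor q).map (φ x) (φ y) := Category.id_comp _
      exact this ▸ hq (φ x) (φ y)
    have e : ((toVFun (toPull a')).comp (pullπ X φ)).comp (VFun.of q) =
        (toVFun i).comp b' := by
      rw [toPull_pullπ]
      apply VFun.hom_injective
      exact sq.w.trans (congrArg (fun k => (toVFun i).hom ≫ k) hb.symm)
    have sq' : CommSq (toPull a') i q' (toPull b') := ⟨by
      refine VFun.ext (funext fun x => funext fun y => ?_)
      have := congrArg (fun F => VFun.map F x y) e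
      refine Eq.trans ?_ this
      exact (((_ ≫= Category.id_comp _).trans ((Category.comp_id _).symm =≫ _)))⟩
    have h₁ : (toVFun i).comp ((toVFun sq'.lift).comp (pullπ X φ)) = a' := by
      refine Eq.trans ?_ (toPull_pullπ a')
      have e' : (toVFun i).comp ((toVFun sq'.lift).comp (pullπ X φ)) =
          (toVFun (i ≫ sq'.lift)).comp (pullπ X φ) :=
        VFun.ext (funext fun x => funext fun y => (Category.assoc _ _ _).symm)
      refine e'.trans ?_
      exact congrArg (fun F : A ⟶ pull X φ => (toVFun F).comp (pullπ X φ)) sq'.fac_left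
    have h₂ : ((toVFun sq'.lift).comp (pullπ X φ)).comp (VFun.of q) = b' := by
      refine Eq.trans ?_ (toPull_pullπ b')
      refine Eq.trans ?_ (congrArg (fun F : C ⟶ pull Y (fun x => (VCat.toFunctor q).obj (φ x)) =>
        (toVFun F).comp (pullπ Y (fun x => (VCat.toFunctor q).obj (φ x)))) sq'.fac_right)
      refine VFun.ext (funext fun x => funext fun y => ?_)
      refine (Category.assoc _ _ _).trans ?_
      exact (Category.comp_id _).symm
    exact ⟨⟨⟨((toVFun sq'.lift).comp (pullπ X φ)).hom, congrArg VFun.hom h₁,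
      (congrArg VFun.hom h₂).trans hb⟩⟩⟩

end FixCat

variable [HasColimits V] [MonoidalClosed V] [SymmetricCategory V]

/-- The small object argument is applied to `A ⟶ pull B φ`, with set of objects that of `A`. As
`pull B φ ⟶ B` is locally an identity, local properties of the second factor are unaffected, and the
first factor is the identity on objects. -/
lemma exists_factorization_locally (I P : MorphismProperty V) [MorphismProperty.IsSmall.{w} I]
    (hIP : I ≤ P)
    (hP : ∀ {X Y K L : V} (i : X ⟶ Y) (j : K ⟶ L) (sq : (curriedTensor V).PushoutObjObj i j),
      P i → P j → P sq.ι)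
    (hI : ∀ {A B : V} (i : A ⟶ B), I i → IsSmallRelativeTo (cells (tensored P)) A)
    {A B : VCat V} (f : A ⟶ B) :
    ∃ (C : FixCat V A) (i : VFun A C.toVCat (fun x => x)) (p : C.toVCat ⟶ B), i.hom ≫ p = f ∧
      (∀ x y, cells (tensored P) (i.map x y)) ∧ locally I.rlp p ∧
      ∀ {X Y : VCat V} (q : X ⟶ Y), locally I.rlp q → HasLiftingProperty i.hom q := by
  let A' : FixCat V A := ⟨A.str⟩
  let φ : A → B := (VCat.toFunctor f).obj
  let f' : VFun A'.toVCat B φ := VFun.of f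
  obtain ⟨C, i, p, fac, hi, hi', hp⟩ := FixCat.exists_factorization I P hIP hP hI
    (FixCat.toPull f')
  refine ⟨C, i, ((FixCat.toVFun p).comp (FixCat.pullπ B φ)).hom, ?_, hi', fun x y => ?_,
    fun q hq => ?_⟩
  · have h : (FixCat.toVFun (i ≫ p)).comp (FixCat.pullπ B φ) = f' := by
      rw [fac]
      exact FixCat.toPull_pullπ f'
    refine Eq.trans ?_ (congrArg VFun.hom h)
    refine VCat.hom_ext (fun _ => rfl) fun x y => ?_
    exact (Category.comp_id _).trans (Category.assoc _ _ _).symm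
  · have := hp x y
    have e : FixCat.hom p x y = (VCat.toFunctor
      ((FixCat.toVFun p).comp (FixCat.pullπ B φ)).hom).map x y :=
      (Category.comp_id _).symm
    exact e ▸ this
  · exact FixCat.hasLiftingProperty_of_fixed (A := A') (i := i)
      (fun q hq => hi q ((FixCat.rlp_freeCells_iff I q).2 hq)) q hq

/-- Adding to `A` the discrete `V`-category on the objects of `B` makes the morphism surjective on
objects. Lifting the added part against `q` only means choosing preimages of objects, since functors
out of a discrete category are functions. -/
lemma exists_factorization_surjective {A B : VCat V} (f : A ⟶ B) :
    ∃ (D : VCat V) (i : A ⟶ D) (p : D ⟶ B), i ≫ p = f ∧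
      Function.Surjective (VCat.toFunctor p).obj ∧
      ∀ {X Y : VCat V} (q : X ⟶ Y), Function.Surjective (VCat.toFunctor q).obj →
        HasLiftingProperty i q := by
  let D := (disc V B).toVCat
  let d : D ⟶ B := (discVFun B (fun x => x)).hom
  refine ⟨A ⨿ D, coprod.inl, coprod.desc f d, coprod.inl_desc _ _, fun y => ?_,
    fun {X Y} q hq => ⟨fun {a b} sq => ?_⟩⟩
  · obtain ⟨h, -⟩ := VCat.hom_congr (coprod.inr_desc f d)
    exact ⟨(VCat.toFunctor (coprod.inr : D ⟶ A ⨿ D)).obj y, h y⟩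
  · choose φ hφ using hq
    let b' : D ⟶ Y := coprod.inr ≫ b
    let β : B → Y := (VCat.toFunctor b').obj
    let c := discVFun X (fun x : B => φ (β x))
    have hc : c.hom ≫ q = b' :=
      (congrArg VFun.hom (discVFun_ext (c.comp (VFun.of q)) ((VFun.of b').copy
        fun x => (hφ (β x)).symm))).trans (VFun.copy_hom (VFun.of b') _)
    refine ⟨⟨⟨coprod.desc a c.hom, coprod.inl_desc _ _, ?_⟩⟩⟩
    apply coprod.hom_ext
    · rw [coprod.inl_desc_assoc, sq.w]
    · rw [coprod.inr_desc_assoc, hc]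

/-! ### The two factorizations obtained from the generating sets of `V`. -/

section Model

variable [ModelCategory V]

/-- Local trivial fibrations which are surjective on objects. -/
def surjTrivFibs (V : Type u) [Category.{w} V] [MonoidalCategory V] [ModelCategory V] :
    MorphismProperty (VCat V) :=
  fun _ _ f => locally (trivialFibrations V) f ∧ Function.Surjective (VCat.toFunctor f).obj

variable [IsMonoidalModel V]

/-- Objects are dealt with first; the local factorization then leaves them alone and so preserves
surjectivity. The left factor lifts because its two parts lift separately against the two halves of
the definition of `surjTrivFibs`. -/
lemma exists_factorization_surjTrivFibs (hV : IsCofibrantlyGeneratedMonoidal V) {A B : VCat V}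
    (f : A ⟶ B) :
    ∃ (C : VCat V) (i : A ⟶ C) (p : C ⟶ B), i ≫ p = f ∧ (surjTrivFibs V).llp i ∧
      surjTrivFibs V p := by
  obtain ⟨I, J, _, _, hI, -, hI', -⟩ := hV
  obtain ⟨D, i, p, rfl, hp, hi⟩ := exists_factorization_surjective f
  obtain ⟨C, j, q, rfl, -, hq, hj⟩ := exists_factorization_locally I (cofibrations V)
    (by rw [← trivialFibrations_llp, hI]; exact MorphismProperty.le_llp_rlp _)
    (fun i j sq hi hj => by
      have := (cofibration_iff _).2 hi
      have := (cofibration_iff _).2 hj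
      exact (cofibration_iff _).1 (IsMonoidalModel.cofibration i j sq)) hI' p
  refine ⟨C.toVCat, i ≫ j.hom, q, Category.assoc _ _ _, fun X Y r hr => ?_, ?_, fun y => ?_⟩
  · have := hi r hr.2
    have := hj r (by rw [← hI]; exact hr.1)
    infer_instance
  · rw [hI]
    exact hq
  · obtain ⟨x, rfl⟩ := hp y
    exact ⟨x, rfl⟩

/-- The hom-morphisms of the first factor are cell complexes on tensored trivial cofibrations; the
monoid axiom says that these are weak equivalences. -/
lemma exists_factorization_locally_fibration (hV : IsCofibrantlyGeneratedMonoidal V)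
    (hmonoid : MonoidAxiom V) {A B : VCat V} (f : A ⟶ B) :
    ∃ (C : FixCat V A) (i : VFun A C.toVCat (fun x => x)) (p : C.toVCat ⟶ B), i.hom ≫ p = f ∧
      (∀ x y, WeakEquivalence (i.map x y)) ∧ locally (fibrations V) p ∧
      ∀ {X Y : VCat V} (q : X ⟶ Y), locally (fibrations V) q → HasLiftingProperty i.hom q := by
  obtain ⟨I, J, _, _, -, hJ, -, hJ'⟩ := hV
  obtain ⟨C, j, q, h, hj, hq, hj'⟩ := exists_factorization_locally J (trivialCofibrations V)
    (by rw [← fibrations_llp, hJ]; exact MorphismProperty.le_llp_rlp _)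
    (fun i j sq hi hj => by
      obtain ⟨_, _⟩ := (mem_trivialCofibrations_iff _).1 hi
      obtain ⟨_, _⟩ := (mem_trivialCofibrations_iff _).1 hj
      rw [mem_trivialCofibrations_iff]
      exact ⟨IsMonoidalModel.cofibration i j sq, IsMonoidalModel.weakEquivalence_left i j sq⟩) hJ' f
  refine ⟨C, j, q, h, fun x y => (weakEquivalence_iff _).2 (hmonoid _ (hj x y)), ?_, ?_⟩
  · rw [hJ]
    exact hq
  · rw [hJ]
    exact hj'

end Model

end EnrichedModel

namespace EnrichedModel

variable {V : Type u} [Category.{w} V] [MonoidalCategory V]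

/-! ### Finite limits of `V`-categories -/

section Pullback

variable [HasPullbacks V] {A B C : VCat V} {φ : A → C} {ψ : B → C}
  (F : VFun A C φ) (G : VFun B C ψ)

/-- The set of objects of the pullback. -/
@[ext]
structure PbObj (φ : A → C) (ψ : B → C) : Type w where
  /-- the first component -/
  fst : A
  /-- the second component -/
  snd : B
  w : φ fst = ψ snd

/-- The hom-objects of the pullback. -/
noncomputable abbrev pbHom (p q : PbObj φ ψ) : V :=
  pullback (F.map p.fst q.fst ≫ homCast p.w q.w) (G.map p.snd q.snd)

/-- The composition of the pullback. -/
noncomputable def pbComp (p q r : PbObj φ ψ) : pbHom F G p q ⊗ pbHom F G q r ⟶ pbHom F G p r :=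
  pullback.lift ((pullback.fst _ _ ⊗ₘ pullback.fst _ _) ≫ A.cmp _ _ _)
    ((pullback.snd _ _ ⊗ₘ pullback.snd _ _) ≫ B.cmp _ _ _) (by
      rw [Category.assoc, Category.assoc, F.map_comp_assoc, eComp_homCast p.w q.w r.w, G.map_comp,
        tensorHom_comp_tensorHom_assoc, tensorHom_comp_tensorHom_assoc,
        tensorHom_comp_tensorHom_assoc, Category.assoc, Category.assoc, pullback.condition,
        pullback.condition])

lemma pbComp_fst (p q r : PbObj φ ψ) : pbComp F G p q r ≫ pullback.fst _ _ =
    (pullback.fst _ _ ⊗ₘ pullback.fst _ _) ≫ A.cmp _ _ _ := pullback.lift_fst _ _ _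

lemma pbComp_snd (p q r : PbObj φ ψ) : pbComp F G p q r ≫ pullback.snd _ _ =
    (pullback.snd _ _ ⊗ₘ pullback.snd _ _) ≫ B.cmp _ _ _ := pullback.lift_snd _ _ _

lemma tensor_pbComp_fst {X Y : V} (p q r : PbObj φ ψ) (u : X ⟶ pbHom F G p q)
    (v : Y ⟶ pbHom F G q r) {s : X ⟶ A.hm p.fst q.fst} {t : Y ⟶ A.hm q.fst r.fst}
    (hs : u ≫ pullback.fst _ _ = s) (ht : v ≫ pullback.fst _ _ = t) :
    (u ⊗ₘ v) ≫ pbComp F G p q r ≫ pullback.fst _ _ = (s ⊗ₘ t) ≫ A.cmp _ _ _ := by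
  rw [pbComp_fst, tensorHom_comp_tensorHom_assoc, hs, ht]

lemma tensor_pbComp_snd {X Y : V} (p q r : PbObj φ ψ) (u : X ⟶ pbHom F G p q)
    (v : Y ⟶ pbHom F G q r) {s : X ⟶ B.hm p.snd q.snd} {t : Y ⟶ B.hm q.snd r.snd}
    (hs : u ≫ pullback.snd _ _ = s) (ht : v ≫ pullback.snd _ _ = t) :
    (u ⊗ₘ v) ≫ pbComp F G p q r ≫ pullback.snd _ _ = (s ⊗ₘ t) ≫ B.cmp _ _ _ := by
  rw [pbComp_snd, tensorHom_comp_tensorHom_assoc, hs, ht]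

/-- The identities of the pullback. -/
noncomputable def pbId (p : PbObj φ ψ) : 𝟙_ V ⟶ pbHom F G p p :=
  pullback.lift (A.idn _) (B.idn _) (by
    rw [F.map_id_assoc, eId_homCast, G.map_id])

lemma pbId_fst (p : PbObj φ ψ) : pbId F G p ≫ pullback.fst _ _ = A.idn _ := pullback.lift_fst _ _ _

lemma pbId_snd (p : PbObj φ ψ) : pbId F G p ≫ pullback.snd _ _ = B.idn _ := pullback.lift_snd _ _ _

/-- The pullback of `V`-categories. -/
noncomputable def pb : VCat V where
  carrier := PbObj φ ψ
  str :=
    { Hom p q := pbHom F G p q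
      id p := pbId F G p
      comp p q r := pbComp F G p q r
      id_comp p q := by
        apply pullback.hom_ext
        · rw [Category.assoc, Category.assoc, pbComp_fst, ← tensorHom_id,
            tensorHom_comp_tensorHom_assoc, pbId_fst, Category.id_comp,
            MonoidalCategory.tensorHom_def', Category.assoc, ← leftUnitor_inv_naturality_assoc,
            e_id_comp, Category.comp_id]
        · rw [Category.assoc, Category.assoc, pbComp_snd, ← tensorHom_id,
            tensorHom_comp_tensorHom_assoc, pbId_snd, Category.id_comp,
            MonoidalCategory.tensorHom_def', Category.assoc, ← leftUnitor_inv_naturality_assoc,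
            e_id_comp, Category.comp_id]
      comp_id p q := by
        apply pullback.hom_ext
        · rw [Category.assoc, Category.assoc, pbComp_fst, ← id_tensorHom,
            tensorHom_comp_tensorHom_assoc, pbId_fst, Category.id_comp,
            MonoidalCategory.tensorHom_def, Category.assoc, ← rightUnitor_inv_naturality_assoc,
            e_comp_id, Category.comp_id]
        · rw [Category.assoc, Category.assoc, pbComp_snd, ← id_tensorHom,
            tensorHom_comp_tensorHom_assoc, pbId_snd, Category.id_comp,
            MonoidalCategory.tensorHom_def, Category.assoc, ← rightUnitor_inv_naturality_assoc,
            e_comp_id, Category.comp_id]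
      assoc p q r s := by
        have h₁ {X₁ X₂ X₃ Y₁ Y₂ Y₃ Z T : V} (f : X₁ ⟶ Y₁) (g : X₂ ⟶ Y₂) (h : X₃ ⟶ Y₃)
            (c : Y₁ ⊗ Y₂ ⟶ Z) (d : Z ⊗ Y₃ ⟶ T) :
            (α_ _ _ _).inv ≫ ((f ⊗ₘ g) ≫ c ⊗ₘ h) ≫ d =
              (f ⊗ₘ g ⊗ₘ h) ≫ (α_ _ _ _).inv ≫ c ▷ _ ≫ d := by
          rw [associator_inv_naturality_assoc, ← tensorHom_id, tensorHom_comp_tensorHom_assoc,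
            Category.comp_id]
        have h₂ {X₁ X₂ X₃ Y₁ Y₂ Y₃ Z T : V} (f : X₁ ⟶ Y₁) (g : X₂ ⟶ Y₂) (h : X₃ ⟶ Y₃)
            (c : Y₂ ⊗ Y₃ ⟶ Z) (d : Y₁ ⊗ Z ⟶ T) :
            (f ⊗ₘ (g ⊗ₘ h) ≫ c) ≫ d = (f ⊗ₘ g ⊗ₘ h) ≫ _ ◁ c ≫ d := by
          rw [← id_tensorHom, tensorHom_comp_tensorHom_assoc, Category.comp_id]
        apply pullback.hom_ext
        · simp only [Category.assoc, pbComp_fst]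
          rw [← tensorHom_id, ← id_tensorHom, tensorHom_comp_tensorHom_assoc,
            tensorHom_comp_tensorHom_assoc, pbComp_fst, pbComp_fst, Category.id_comp,
            Category.id_comp, h₁, h₂, e_assoc]
        · simp only [Category.assoc, pbComp_snd]
          rw [← tensorHom_id, ← id_tensorHom, tensorHom_comp_tensorHom_assoc,
            tensorHom_comp_tensorHom_assoc, pbComp_snd, pbComp_snd, Category.id_comp,
            Category.id_comp, h₁, h₂, e_assoc] }

/-- The first projection. -/
noncomputable def pbFst : VFun (pb F G) A (fun p => p.fst) where
  map _ _ := pullback.fst _ _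
  map_id p := pbId_fst F G p
  map_comp p q r := pbComp_fst F G p q r

/-- The second projection. -/
noncomputable def pbSnd : VFun (pb F G) B (fun p => p.snd) where
  map _ _ := pullback.snd _ _
  map_id p := pbId_snd F G p
  map_comp p q r := pbComp_snd F G p q r

lemma isPullback_pb_map (p q : pb F G) :
    IsPullback ((pbFst F G).map p q) ((pbSnd F G).map p q)
      (F.map p.fst q.fst ≫ homCast p.w q.w) (G.map p.snd q.snd) :=
  IsPullback.of_hasPullback _ _

lemma pb_hom_ext {T : VCat V} {m m' : T ⟶ pb F G}
    (h : m ≫ (pbFst F G).hom = m' ≫ (pbFst F G).hom)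
    (h' : m ≫ (pbSnd F G).hom = m' ≫ (pbSnd F G).hom) : m = m' := by
  obtain ⟨e, e₁⟩ := VCat.hom_congr h
  obtain ⟨e', e₂⟩ := VCat.hom_congr h'
  have e'' (x : T) : (VCat.toFunctor m).obj x = (VCat.toFunctor m').obj x :=
    PbObj.ext (e x) (e' x)
  refine VCat.hom_ext e'' fun x y => pullback.hom_ext ?_ ?_
  · refine (Category.assoc _ _ _).trans ?_
    refine Eq.trans (_ ≫= (pbFst F G).map_homCast (e'' x) (e'' y)) ?_
    exact (Category.assoc _ _ _).symm.trans (e₁ x y)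
  · refine (Category.assoc _ _ _).trans ?_
    refine Eq.trans (_ ≫= (pbSnd F G).map_homCast (e'' x) (e'' y)) ?_
    exact (Category.assoc _ _ _).symm.trans (e₂ x y)

/-- The lift to the pullback. -/
noncomputable def pbLift {T : VCat V} {α : T → A} {β : T → B} (a : VFun T A α) (b : VFun T B β)
    (h : ∀ x, φ (α x) = ψ (β x))
    (h' : ∀ x y, (a.map x y ≫ F.map (α x) (α y)) ≫ homCast (h x) (h y) =
      b.map x y ≫ G.map (β x) (β y)) :
    VFun T (pb F G) (fun x => ⟨α x, β x, h x⟩) where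
  map x y := pullback.lift (a.map x y) (b.map x y) ((Category.assoc _ _ _).symm.trans (h' x y))
  map_id x := by
    apply pullback.hom_ext
    · refine (Category.assoc _ _ _).trans ?_
      rw [pullback.lift_fst, a.map_id]
      exact (pbId_fst F G ⟨α x, β x, h x⟩).symm
    · refine (Category.assoc _ _ _).trans ?_
      rw [pullback.lift_snd, b.map_id]
      exact (pbId_snd F G ⟨α x, β x, h x⟩).symm
  map_comp x y z := by
    apply pullback.hom_ext
    · refine (Category.assoc _ _ _).trans ?_
      rw [pullback.lift_fst, a.map_comp]
      refine Eq.trans ?_ (Category.assoc _ _ _).symm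
      exact (tensor_pbComp_fst F G ⟨α x, β x, h x⟩ ⟨α y, β y, h y⟩ ⟨α z, β z, h z⟩ _ _
        (pullback.lift_fst _ _ _) (pullback.lift_fst _ _ _)).symm
    · refine (Category.assoc _ _ _).trans ?_
      rw [pullback.lift_snd, b.map_comp]
      refine Eq.trans ?_ (Category.assoc _ _ _).symm
      exact (tensor_pbComp_snd F G ⟨α x, β x, h x⟩ ⟨α y, β y, h y⟩ ⟨α z, β z, h z⟩ _ _
        (pullback.lift_snd _ _ _) (pullback.lift_snd _ _ _)).symm

lemma isPullback_pb : IsPullback (pbFst F G).hom (pbSnd F G).hom F.hom G.hom where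
  w := VFun.hom_eq (F := (pbFst F G).comp F) (G := (pbSnd F G).comp G) (fun p => p.w)
    fun p q => (Category.assoc _ _ _).trans (isPullback_pb_map F G p q).w
  isLimit' := ⟨by
    refine PullbackCone.IsLimit.mk _ (fun s => (pbLift F G (VFun.of s.fst) (VFun.of s.snd)
      (VCat.hom_congr s.condition).choose (VCat.hom_congr s.condition).choose_spec).hom)
      (fun s => ?_) (fun s => ?_) fun s m h h' => pb_hom_ext F G ?_ ?_
    · exact VCat.hom_ext (fun _ => rfl) fun x y =>
        (Category.comp_id _).trans (pullback.lift_fst _ _ _)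
    · exact VCat.hom_ext (fun _ => rfl) fun x y =>
        (Category.comp_id _).trans (pullback.lift_snd _ _ _)
    · refine h.trans (Eq.symm ?_)
      exact VCat.hom_ext (fun _ => rfl) fun x y =>
        (Category.comp_id _).trans (pullback.lift_fst _ _ _)
    · refine h'.trans (Eq.symm ?_)
      exact VCat.hom_ext (fun _ => rfl) fun x y =>
        (Category.comp_id _).trans (pullback.lift_snd _ _ _)⟩

instance : HasPullbacks (VCat V) :=
  have (A B C : VCat V) (f : A ⟶ C) (g : B ⟶ C) : HasLimit (cospan f g) :=
    (isPullback_pb (VFun.of f) (VFun.of g)).hasPullback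
  hasPullbacks_of_hasLimit_cospan _

end Pullback

section Terminal

variable [HasTerminal V]

variable (V) in
/-- The terminal `V`-category. -/
noncomputable def terminalObj : VCat V where
  carrier := PUnit
  str :=
    { Hom _ _ := ⊤_ V
      id _ := terminal.from _
      comp _ _ _ := terminal.from _ }

/-- `V`-functors to the terminal `V`-category. -/
noncomputable def terminalFrom (A : VCat V) : VFun A (terminalObj V) (fun _ => ⟨⟩) where
  map _ _ := terminal.from _
  map_id _ := terminal.hom_ext _ _
  map_comp _ _ _ := terminal.hom_ext _ _

variable (V) in
/-- `terminalObj` is terminal. -/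
noncomputable def terminalObjIsTerminal : IsTerminal (terminalObj V) :=
  IsTerminal.ofUniqueHom (fun A => (terminalFrom A).hom)
    fun _ _ => VCat.hom_ext (fun _ => rfl) fun _ _ => terminal.hom_ext _ _

instance : HasTerminal (VCat V) := (terminalObjIsTerminal V).hasTerminal

instance [HasPullbacks V] : HasFiniteLimits (VCat V) :=
  hasFiniteLimits_of_hasTerminal_and_pullbacks

end Terminal

end EnrichedModel

namespace EnrichedModel

/-! ### Complements on model categories -/

section Saturation

variable {C : Type*} [Category* C] [ModelCategory C] {H : Type*} [Category* H]
  (L : C ⥤ H) [L.IsLocalization (weakEquivalences C)]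

/-- A morphism from a cofibrant object to a fibration which is a lift up to homotopy can be
replaced by a homotopic strict lift. -/
lemma exists_strict_lift {X E B : C} [IsCofibrant X] [IsFibrant B] (p : E ⟶ B) [Fibration p]
    (u : X ⟶ E) (v : X ⟶ B) (h : L.map (u ≫ p) = L.map v) :
    ∃ u' : X ⟶ E, u' ≫ p = v ∧ L.map u' = L.map u := by
  -- Cofibrancy of `X` and fibrancy of `B` turn the equality in the localization into a left
  -- homotopy from `u ≫ p` to `v`. It lifts through `p` starting from `u`; the other end is `u'`.
  obtain ⟨P, _, ⟨h⟩⟩ := ((LeftHomotopyRel.iff_map_eq L _ _).2 h).exists_good_cylinder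
  obtain ⟨u', h', e⟩ := h.covering_homotopy p u rfl
  refine ⟨u', ?_, ?_⟩
  · rw [← h'.h₁, Category.assoc, e, h.h₁]
  · exact ((LeftHomotopyRel.factorsThroughLocalization C h'.leftHomotopyRel).map_eq L).symm

lemma isIso_map_of_weakEquivalence {X Y : C} (f : X ⟶ Y) [WeakEquivalence f] : IsIso (L.map f) :=
  Localization.inverts L (weakEquivalences C) f (mem_weakEquivalences f)

/-- A homotopy inverse of the fibration `q` can be made a strict section `g`. Then `q ≫ g` is
homotopic to the identity, hence a weak equivalence, and `q` is a retract of it. -/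
lemma weakEquivalence_of_isIso_of_fibration {X Y : C} [IsCofibrant X] [IsCofibrant Y] [IsFibrant X]
    [IsFibrant Y] (q : X ⟶ Y) [Fibration q] [IsIso (L.map q)] : WeakEquivalence q := by
  obtain ⟨g, hg⟩ := map_surjective_of_isLocalization L Y X (inv (L.map q))
  obtain ⟨g, hgq, hg'⟩ := exists_strict_lift L q g (𝟙 Y) (by
    rw [L.map_comp, hg, IsIso.inv_hom_id, L.map_id])
  obtain ⟨P, ⟨h⟩⟩ := (LeftHomotopyRel.iff_map_eq L _ _ (f := 𝟙 X) (g := q ≫ g)).2 (by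
    rw [L.map_comp, hg', hg, IsIso.hom_inv_id, L.map_id])
  have : WeakEquivalence (q ≫ g) := (Cylinder.LeftHomotopy.weakEquivalence_iff _ h).1 inferInstance
  rw [weakEquivalence_iff] at this ⊢
  exact MorphismProperty.of_retract
    { i := Arrow.homMk (𝟙 X) g
      r := Arrow.homMk (𝟙 X) q
      retract := by ext <;> simp [hgq] } this

/-- The localization functor of a model category reflects weak equivalences. -/
theorem weakEquivalence_iff_isIso_map {X Y : C} (f : X ⟶ Y) :
    WeakEquivalence f ↔ IsIso (L.map f) := by
  refine ⟨fun _ => isIso_map_of_weakEquivalence L f, fun hf => ?_⟩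
  -- Reduction to a fibration between bifibrant objects: the target is made fibrant and then
  -- resolved by a cofibrant object, the source is resolved and the morphism lifted. The fibration
  -- in a factorization of this lift has bifibrant ends, and two out of three returns to `f`.
  obtain ⟨Y₁, j, _, _, _⟩ : ∃ (Y₁ : C) (j : Y ⟶ Y₁), Cofibration j ∧ WeakEquivalence j ∧
    IsFibrant Y₁ := ⟨_, FibrantObject.HoCat.iResolutionObj Y, inferInstance, inferInstance,
      inferInstance⟩
  obtain ⟨Y₂, _, p, _, _⟩ := CofibrantObject.HoCat.exists_resolution Y₁
  obtain ⟨X₂, _, r, _, _⟩ := CofibrantObject.HoCat.exists_resolution X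
  have : IsFibrant Y₂ := isFibrant_of_fibration p
  have sq : CommSq (initial.to Y₂) (initial.to X₂) p (r ≫ f ≫ j) := ⟨by simp⟩
  let d := MorphismProperty.factorizationData (trivialCofibrations C) (fibrations C) sq.lift
  obtain ⟨_, _⟩ := (mem_trivialCofibrations_iff _).1 d.hi
  have : Fibration d.p := (fibration_iff _).2 d.hp
  have : IsFibrant d.Z := isFibrant_of_fibration d.p
  have : IsCofibrant d.Z := isCofibrant_of_cofibration d.i
  have fac : d.i ≫ d.p ≫ p = r ≫ f ≫ j := by rw [d.fac_assoc, sq.fac_right]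
  have := isIso_map_of_weakEquivalence L p
  have := isIso_map_of_weakEquivalence L d.i
  have := isIso_map_of_weakEquivalence L r
  have := isIso_map_of_weakEquivalence L j
  have : IsIso (L.map d.p) := by
    have e : L.map d.p = inv (L.map d.i) ≫ (L.map r ≫ L.map f ≫ L.map j) ≫ inv (L.map p) := by
      have h := congrArg L.map fac
      simp only [L.map_comp] at h
      rw [← h, Category.assoc, Category.assoc, IsIso.hom_inv_id, Category.comp_id,
        IsIso.inv_hom_id_assoc]
    rw [e]
    infer_instance
  have := weakEquivalence_of_isIso_of_fibration L d.p
  have : WeakEquivalence (r ≫ f ≫ j) := by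
    rw [← fac]
    infer_instance
  have := weakEquivalence_of_precomp r (f ≫ j)
  exact weakEquivalence_of_postcomp f j

end Saturation

section Gluing

variable {C : Type*} [Category* C] [ModelCategory C]

lemma fibration_of_isPullback {P X Y Z : C} {fst : P ⟶ X} {snd : P ⟶ Y} {f : X ⟶ Z} {g : Y ⟶ Z}
    (h : IsPullback fst snd f g) [Fibration f] : Fibration snd := by
  have := mem_fibrations f
  rw [fibration_iff]
  exact MorphismProperty.of_isPullback h this

/-- In a right proper model category, base changes preserve weak equivalences between
fibrations. -/
lemma weakEquivalence_baseChange
    (hC : IsRightProper (weakEquivalences C) (fibrations C)) {X T Z Y P Q : C} {f : X ⟶ Z}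
    {f' : T ⟶ Z} [Fibration f] [Fibration f'] {x : X ⟶ T} [WeakEquivalence x] (hx : x ≫ f' = f)
    {g : Y ⟶ Z} {p₁ : P ⟶ X} {p₂ : P ⟶ Y} (hP : IsPullback p₁ p₂ f g) {q₁ : Q ⟶ T} {q₂ : Q ⟶ Y}
    (hQ : IsPullback q₁ q₂ f' g) {a : P ⟶ Q} (h₁ : a ≫ q₁ = p₁ ≫ x) (h₂ : a ≫ q₂ = p₂) :
    WeakEquivalence a := by
  -- Factoring `g` as `d.i ≫ d.p` splits the base change in two. Along the fibration `d.p`, the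
  -- comparison `b` is a base change of `x` along a fibration. The morphisms `i` and `j` from the
  -- original pullbacks are base changes of `d.i` along fibrations. Right properness applies to all
  -- three.
  let d := MorphismProperty.factorizationData (trivialCofibrations C) (fibrations C) g
  obtain ⟨_, _⟩ := (mem_trivialCofibrations_iff _).1 d.hi
  have : Fibration d.p := (fibration_iff _).2 d.hp
  have hP' := IsPullback.of_hasPullback f d.p
  have hQ' := IsPullback.of_hasPullback f' d.p
  have hdi : p₁ ≫ f = (p₂ ≫ d.i) ≫ d.p := by rw [Category.assoc, d.fac, hP.w]
  have hdi' : q₁ ≫ f' = (q₂ ≫ d.i) ≫ d.p := by rw [Category.assoc, d.fac, hQ.w]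
  let i : P ⟶ pullback f d.p := pullback.lift p₁ (p₂ ≫ d.i) hdi
  let j : Q ⟶ pullback f' d.p := pullback.lift q₁ (q₂ ≫ d.i) hdi'
  let b : pullback f d.p ⟶ pullback f' d.p :=
    pullback.lift (pullback.fst _ _ ≫ x) (pullback.snd _ _)
      (by rw [Category.assoc, hx, pullback.condition])
  have hi : IsPullback i p₂ (pullback.snd f d.p) d.i :=
    IsPullback.of_right (by rw [pullback.lift_fst, d.fac]; exact hP) (pullback.lift_snd _ _ _)
      hP'
  have hj : IsPullback j q₂ (pullback.snd f' d.p) d.i :=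
    IsPullback.of_right (by rw [pullback.lift_fst, d.fac]; exact hQ) (pullback.lift_snd _ _ _)
      hQ'
  have hb : IsPullback b (pullback.fst f d.p) (pullback.fst f' d.p) x := by
    refine IsPullback.of_right ?_ (pullback.lift_fst _ _ _) hQ'.flip
    rw [pullback.lift_snd, hx]
    exact hP'.flip
  have := fibration_of_isPullback hP'
  have := fibration_of_isPullback hQ'
  have := fibration_of_isPullback hQ'.flip
  have : WeakEquivalence i :=
    (weakEquivalence_iff _).2 (hC hi (mem_fibrations _) (mem_weakEquivalences d.i))
  have : WeakEquivalence j :=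
    (weakEquivalence_iff _).2 (hC hj (mem_fibrations _) (mem_weakEquivalences d.i))
  have : WeakEquivalence b :=
    (weakEquivalence_iff _).2 (hC hb (mem_fibrations _) (mem_weakEquivalences x))
  have e : a ≫ j = i ≫ b := by
    apply pullback.hom_ext
    · rw [Category.assoc, Category.assoc, pullback.lift_fst, pullback.lift_fst,
        pullback.lift_fst_assoc, h₁]
    · rw [Category.assoc, Category.assoc, pullback.lift_snd, pullback.lift_snd,
        pullback.lift_snd, reassoc_of% h₂]
  have : WeakEquivalence (a ≫ j) := by
    rw [e]
    infer_instance
  exact weakEquivalence_of_postcomp a j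

/-- The gluing lemma in a right proper model category. -/
theorem weakEquivalence_of_isPullback
    (hC : IsRightProper (weakEquivalences C) (fibrations C)) {P X Y Z P' X' Y' Z' : C}
    {p₁ : P ⟶ X} {p₂ : P ⟶ Y} {f : X ⟶ Z} {g : Y ⟶ Z} (h : IsPullback p₁ p₂ f g)
    {p₁' : P' ⟶ X'} {p₂' : P' ⟶ Y'} {f' : X' ⟶ Z'} {g' : Y' ⟶ Z'} (h' : IsPullback p₁' p₂' f' g')
    [Fibration f] [Fibration f'] {a : P ⟶ P'} {x : X ⟶ X'} {y : Y ⟶ Y'} {z : Z ⟶ Z'}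
    [WeakEquivalence x] [WeakEquivalence y] [WeakEquivalence z] (hf : x ≫ f' = f ≫ z)
    (hg : y ≫ g' = g ≫ z) (h₁ : a ≫ p₁' = p₁ ≫ x) (h₂ : a ≫ p₂' = p₂ ≫ y) :
    WeakEquivalence a := by
  -- The base changes of `X'` along `z` and of `P'` along `y` project to `X'` and `P'` by weak
  -- equivalences. This replaces the given square by one over the same `g : Y ⟶ Z`, to which
  -- `weakEquivalence_baseChange` applies.
  have hT := IsPullback.of_hasPullback f' z
  have hQ := IsPullback.of_hasPullback p₂' y
  have hTf := fibration_of_isPullback hT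
  have hp := fibration_of_isPullback h'
  have : WeakEquivalence (pullback.fst f' z) :=
    (weakEquivalence_iff _).2 (hC hT (mem_fibrations _) (mem_weakEquivalences z))
  have : WeakEquivalence (pullback.fst p₂' y) :=
    (weakEquivalence_iff _).2 (hC hQ (mem_fibrations _) (mem_weakEquivalences y))
  let t : X ⟶ pullback f' z := pullback.lift x f hf
  have ht : t ≫ pullback.fst _ _ = x := pullback.lift_fst _ _ _
  have ht' : t ≫ pullback.snd _ _ = f := pullback.lift_snd _ _ _
  have : WeakEquivalence (t ≫ pullback.fst _ _) := by
    rw [ht]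
    infer_instance
  have : WeakEquivalence t := weakEquivalence_of_postcomp t (pullback.fst _ _)
  let q : pullback p₂' y ⟶ pullback f' z :=
    pullback.lift (pullback.fst _ _ ≫ p₁') (pullback.snd _ _ ≫ g) (by
      rw [Category.assoc, Category.assoc, h'.w, ← hg, pullback.condition_assoc])
  have hq : IsPullback q (pullback.snd p₂' y) (pullback.snd f' z) g := by
    refine IsPullback.of_right ?_ (pullback.lift_snd _ _ _) hT
    rw [pullback.lift_fst, ← hg]
    exact hQ.paste_horiz h'
  let b : P ⟶ pullback p₂' y := pullback.lift a p₂ h₂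
  have : WeakEquivalence b := by
    refine weakEquivalence_baseChange hC ht' h hq ?_ (pullback.lift_snd _ _ _)
    apply pullback.hom_ext
    · rw [Category.assoc, Category.assoc, pullback.lift_fst, pullback.lift_fst_assoc, h₁, ht]
    · rw [Category.assoc, Category.assoc, pullback.lift_snd, pullback.lift_snd_assoc, ht', h.w]
  have e : b ≫ pullback.fst _ _ = a := pullback.lift_fst _ _ _
  rw [← e]
  infer_instance

end Gluing

end EnrichedModel

namespace EnrichedModel

/-! ### Isomorphisms in the underlying category of an enriched category -/

section Underlying

variable {W : Type*} [Category* W] [MonoidalCategory W] {C D : Type*} [EnrichedCategory W C]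
  [EnrichedCategory W D]

/-- Postcomposition with a point of a hom-object. -/
def rwh {x y : C} (e : 𝟙_ W ⟶ (x ⟶[W] y)) (z : C) : (z ⟶[W] x) ⟶ (z ⟶[W] y) :=
  (ρ_ _).inv ≫ _ ◁ e ≫ eComp W z x y

/-- Precomposition with a point of a hom-object. -/
def lwh {x y : C} (e : 𝟙_ W ⟶ (x ⟶[W] y)) (z : C) : (y ⟶[W] z) ⟶ (x ⟶[W] z) :=
  (λ_ _).inv ≫ e ▷ _ ≫ eComp W x y z

lemma point_rwh {x y z : C} (g : 𝟙_ W ⟶ (z ⟶[W] x)) (e : 𝟙_ W ⟶ (x ⟶[W] y)) :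
    g ≫ rwh e z = (λ_ _).inv ≫ (g ⊗ₘ e) ≫ eComp W z x y := by
  rw [rwh, rightUnitor_inv_naturality_assoc, MonoidalCategory.tensorHom_def, Category.assoc,
    unitors_inv_equal]

lemma rwh_map (F : EnrichedFunctor W C D) {x y : C} (e : 𝟙_ W ⟶ (x ⟶[W] y)) (z : C) :
    rwh e z ≫ F.map z y = F.map z x ≫ rwh (e ≫ F.map x y) (F.obj z) := by
  rw [rwh, rwh, rightUnitor_inv_naturality_assoc, Category.assoc, Category.assoc, F.map_comp,
    MonoidalCategory.whiskerLeft_comp_assoc, ← whisker_exchange_assoc,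
    MonoidalCategory.tensorHom_def', Category.assoc, ← whisker_exchange_assoc]

lemma lwh_map (F : EnrichedFunctor W C D) {x y : C} (e : 𝟙_ W ⟶ (x ⟶[W] y)) (z : C) :
    lwh e z ≫ F.map x z = F.map y z ≫ lwh (e ≫ F.map x y) (F.obj z) := by
  rw [lwh, lwh, leftUnitor_inv_naturality_assoc, Category.assoc, Category.assoc, F.map_comp,
    comp_whiskerRight_assoc, MonoidalCategory.tensorHom_def, Category.assoc,
    whisker_exchange_assoc, whisker_exchange_assoc]

lemma isIso_rwh {x y : ForgetEnrichment W C} (e : x ⟶ y) [IsIso e] (z : C) :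
    IsIso (rwh (ForgetEnrichment.homTo W e) z) :=
  inferInstanceAs (IsIso ((eCoyoneda W (ForgetEnrichment.of W z)).map e))

lemma isIso_lwh {x y : ForgetEnrichment W C} (e : x ⟶ y) [IsIso e] (z : C) :
    IsIso (lwh (ForgetEnrichment.homTo W e) z) :=
  inferInstanceAs (IsIso (((eHomFunctor W (ForgetEnrichment W C)).map e.op).app
    (ForgetEnrichment.of W z)))

lemma comp_eq_rwh {x y z : ForgetEnrichment W C} (g : z ⟶ x) (e : x ⟶ y) :
    ForgetEnrichment.homTo W (g ≫ e) =
      ForgetEnrichment.homTo W g ≫ rwh (ForgetEnrichment.homTo W e) (ForgetEnrichment.to W z) := by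
  rw [point_rwh]
  exact Category.assoc _ _ _

/-- A Yoneda argument: the inverse of postcomposition at `z = y`, applied to the identity, gives a
right inverse of `e`; injectivity of the postcompositions makes it two-sided. -/
lemma isIso_of_isIso_rwh {x y : ForgetEnrichment W C} (e : x ⟶ y)
    (h : ∀ z : C, IsIso (rwh (ForgetEnrichment.homTo W e) z)) : IsIso e := by
  have inj {z : ForgetEnrichment W C} {g g' : z ⟶ x} (hg : g ≫ e = g' ≫ e) : g = g' := by
    have := h (ForgetEnrichment.to W z)
    have := congrArg (ForgetEnrichment.homTo W) hg
    rw [comp_eq_rwh, comp_eq_rwh, cancel_mono] at this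
    exact this
  have hy := h (ForgetEnrichment.to W y)
  let g : y ⟶ x := ForgetEnrichment.homOf W (ForgetEnrichment.homTo W (𝟙 y) ≫
    @inv _ _ _ _ _ hy)
  have hg : g ≫ e = 𝟙 y := by
    change ForgetEnrichment.homTo W (g ≫ e) = ForgetEnrichment.homTo W (𝟙 y)
    refine (comp_eq_rwh g e).trans ?_
    exact (Category.assoc _ _ _).trans
      ((_ ≫= IsIso.inv_hom_id _).trans (Category.comp_id _))
  exact ⟨g, inj (by rw [Category.assoc, hg, Category.comp_id, Category.id_comp]), hg⟩

/-- Postcomposition with `e'` and precomposition with `e` connect the two hom-morphisms by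
commutative squares whose other sides are invertible. -/
lemma isIso_map_of_iso (F : EnrichedFunctor W C D) {x x' y y' : ForgetEnrichment W C}
    (e : x ≅ x') (e' : y ≅ y')
    (h : IsIso (F.map (ForgetEnrichment.to W x) (ForgetEnrichment.to W y))) :
    IsIso (F.map (ForgetEnrichment.to W x') (ForgetEnrichment.to W y')) := by
  have h₁ := isIso_rwh e'.hom (ForgetEnrichment.to W x)
  have h₂ := isIso_rwh (F.forget.map e'.hom) (F.obj (ForgetEnrichment.to W x))
  have h₃ := isIso_lwh e.hom (ForgetEnrichment.to W y')
  have h₄ := isIso_lwh (F.forget.map e.hom) (F.obj (ForgetEnrichment.to W y'))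
  have h₅ : IsIso (F.map (ForgetEnrichment.to W x) (ForgetEnrichment.to W y')) := by
    have := rwh_map F (ForgetEnrichment.homTo W e'.hom) (ForgetEnrichment.to W x)
    exact (isIso_comp_left_iff _ _).1 (this ▸ @IsIso.comp_isIso _ _ _ _ _ _ _ h h₂)
  have := lwh_map F (ForgetEnrichment.homTo W e.hom) (ForgetEnrichment.to W y')
  have h₆ := this ▸ @IsIso.comp_isIso _ _ _ _ _ _ _ h₃ h₅
  exact @IsIso.of_isIso_comp_right _ _ _ _ _ _ _ h₄ h₆

/-- An enriched functor which is locally an isomorphism is fully faithful. -/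
noncomputable def fullyFaithfulForget (F : EnrichedFunctor W C D)
    (h : ∀ x y, IsIso (F.map x y)) : F.forget.FullyFaithful where
  preimage {x y} f := ForgetEnrichment.homOf W (ForgetEnrichment.homTo W f ≫
    @inv _ _ _ _ _ (h (ForgetEnrichment.to W x) (ForgetEnrichment.to W y)))
  map_preimage {x y} f := by
    have := h (ForgetEnrichment.to W x) (ForgetEnrichment.to W y)
    exact (Category.assoc _ _ _).trans ((_ ≫= IsIso.inv_hom_id _).trans (Category.comp_id _))
  preimage_map {x y} f := by
    have := h (ForgetEnrichment.to W x) (ForgetEnrichment.to W y)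
    exact (Category.assoc _ _ _).trans ((_ ≫= IsIso.hom_inv_id _).trans (Category.comp_id _))

end Underlying

end EnrichedModel

namespace EnrichedModel

open Functor.LaxMonoidal

/-! ### The homotopy category of a `V`-category -/

variable {V : Type u} [Category.{w} V] [MonoidalCategory V] [ModelCategory V]
  [MonoidalClosed V] [SymmetricCategory V] [IsMonoidalModel V] [IsCofibrant (𝟙_ V)]

instance : (toHo V).IsLocalization (weakEquivalences V) :=
  inferInstanceAs ((weakEquivalences V).Q.IsLocalization (weakEquivalences V))

/-- As the unit is cofibrant, it is its own derived unit. Points of `(toHo V).obj X` are therefore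
morphisms in `Ho(V)` between images of objects of `V`. -/
instance : IsIso (ε (toHo V)) := by
  have h₁ : IsIso (ε (toHoc V)) := inferInstance
  have h₂ : IsIso (elt CofibrantObject.ι (toHo V) (toHoc V) (toHocIso V)
      (Functor.OplaxMonoidal.η (CofibrantObject.ι (C := V)))) := by
    have : IsIso ((toHo V).map (Functor.OplaxMonoidal.η (CofibrantObject.ι (C := V)))) :=
      inferInstance
    have h : IsIso ((toHocIso V).app (𝟙_ (CofibrantObject V))) :=
      inferInstanceAs (IsIso (𝟙 _))
    exact IsIso.comp_isIso
  exact IsIso.comp_isIso' h₁ h₂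

/-- The point of `Ho(V)` given by a point of `V`. -/
noncomputable def hoPt {X : V} (e : 𝟙_ V ⟶ X) : 𝟙_ (Ho V) ⟶ (toHo V).obj X :=
  ε (toHo V) ≫ (toHo V).map e

lemma hoPt_comp {X Y : V} (e : 𝟙_ V ⟶ X) (f : X ⟶ Y) :
    hoPt e ≫ (toHo V).map f = hoPt (e ≫ f) := by
  rw [hoPt, hoPt, Category.assoc, Functor.map_comp]

/-- From a cofibrant to a fibrant object, every morphism of the localization comes from the model
category. -/
lemma hoPt_surjective {X : V} [IsFibrant X] (f : 𝟙_ (Ho V) ⟶ (toHo V).obj X) :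
    ∃ e : 𝟙_ V ⟶ X, hoPt e = f := by
  obtain ⟨e, he⟩ := map_surjective_of_isLocalization (toHo V) (𝟙_ V) X (inv (ε (toHo V)) ≫ f)
  exact ⟨e, by rw [hoPt, he, IsIso.hom_inv_id_assoc]⟩

lemma exists_strict_point {X Y : V} [IsFibrant Y] (p : X ⟶ Y) [Fibration p] (u : 𝟙_ V ⟶ X)
    (v : 𝟙_ V ⟶ Y) (h : hoPt (u ≫ p) = hoPt v) : ∃ u' : 𝟙_ V ⟶ X, u' ≫ p = v ∧ hoPt u' = hoPt u := by
  obtain ⟨u', h₁, h₂⟩ := exists_strict_lift (toHo V) p u v ((cancel_epi (ε (toHo V))).1 h)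
  exact ⟨u', h₁, by rw [hoPt, hoPt, h₂]⟩

variable {A B : VCat V}

/-- The morphism of `HoCat A` given by a point of a hom-object. -/
noncomputable def hoMk {x y : A} (e : 𝟙_ V ⟶ A.hm x y) :
    (show HoCat A from x) ⟶ (show HoCat A from y) :=
  ForgetEnrichment.homOf (C := TransportEnrichment (toHo V) A) (Ho V) (hoPt e)

lemma hoMk_surjective {x y : A} [IsFibrant (A.hm x y)]
    (f : (show HoCat A from x) ⟶ (show HoCat A from y)) : ∃ e : 𝟙_ V ⟶ A.hm x y, hoMk e = f :=
  hoPt_surjective (X := A.hm x y) f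

lemma hoFunctor_map_hoMk (f : A ⟶ B) {x y : A} (e : 𝟙_ V ⟶ A.hm x y) :
    (hoFunctor f).map (hoMk e) = hoMk (e ≫ (VCat.toFunctor f).map x y) :=
  hoPt_comp e _

/-- Unitality of the lax monoidal functor `toHo V` identifies postcomposition in the transported
enrichment with the image of postcomposition in `A`. Invertibility in `HoCat A` can thus be tested
in `V`. -/
lemma rwh_hoPt {x y : A} (e : 𝟙_ V ⟶ A.hm x y) (z : A) :
    rwh (C := TransportEnrichment (toHo V) A) (hoPt e) z = (toHo V).map (rwh e z) := by
  have h : (ρ_ ((toHo V).obj (A.hm z x))).inv ≫ (toHo V).obj (A.hm z x) ◁ hoPt e ≫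
      μ (toHo V) _ _ ≫ (toHo V).map (A.cmp z x y) = (toHo V).map (rwh e z) := by
    rw [hoPt, MonoidalCategory.whiskerLeft_comp_assoc, μ_natural_right_assoc,
      right_unitality_inv_assoc, rwh, Functor.map_comp, Functor.map_comp]
  exact h

/-- A point of a hom-object is an isomorphism in the homotopy category if and only if
the postcompositions with it are weak equivalences. -/
theorem isIso_hoMk_iff {x y : A} (e : 𝟙_ V ⟶ A.hm x y) :
    IsIso (hoMk e) ↔ ∀ z : A, WeakEquivalence (rwh e z) := by
  refine ⟨fun h z => ?_, fun h => isIso_of_isIso_rwh _ fun z => ?_⟩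
  · rw [weakEquivalence_iff_isIso_map (toHo V), ← rwh_hoPt]
    exact isIso_rwh (hoMk e) z
  · have := h z
    have := isIso_toHo_map (rwh e z)
    have h' : IsIso (rwh (C := TransportEnrichment (toHo V) A) (hoPt e) z) :=
      (rwh_hoPt e z).symm ▸ this
    exact h'

/-- A `V`-functor which is locally a weak equivalence induces a fully faithful functor on
homotopy categories. -/
noncomputable def fullyFaithfulHoFunctor (f : A ⟶ B) (hf : locally (weakEquivalences V) f) :
    (hoFunctor f).FullyFaithful :=
  fullyFaithfulForget _ fun x y => by
    have : WeakEquivalence ((VCat.toFunctor f).map x y) := (weakEquivalence_iff _).2 (hf x y)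
    exact isIso_toHo_map _

lemma weakEquivalence_map_of_iso (f : A ⟶ B) {x x' y y' : HoCat A} (e : x ≅ x') (e' : y ≅ y')
    (h : weakEquivalences V ((VCat.toFunctor f).map x y)) :
    weakEquivalences V ((VCat.toFunctor f).map x' y') := by
  have : WeakEquivalence ((VCat.toFunctor f).map x y) := (weakEquivalence_iff _).2 h
  have h' := isIso_toHo_map ((VCat.toFunctor f).map x y)
  have := isIso_map_of_iso (changeOfBase (toHo V) (VCat.toFunctor f)) e e' h'
  rw [← weakEquivalence_iff]
  exact (weakEquivalence_iff_isIso_map (toHo V) _).2 this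

lemma hoFunctor_id (A : VCat V) : hoFunctor (𝟙 A) = 𝟭 (HoCat A) := by
  refine CategoryTheory.Functor.ext (fun _ => rfl) fun x y f => ?_
  have h (X : V) (g : 𝟙_ (Ho V) ⟶ (toHo V).obj X) : g ≫ (toHo V).map (𝟙 X) = g := by simp
  exact (h _ f).trans ((Category.id_comp _).trans (Category.comp_id f)).symm

lemma hoFunctor_comp {C : VCat V} (f : A ⟶ B) (g : B ⟶ C) :
    hoFunctor (f ≫ g) = hoFunctor f ⋙ hoFunctor g := by
  refine CategoryTheory.Functor.ext (fun _ => rfl) fun x y k => ?_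
  have h {X Y Z : V} (k : 𝟙_ (Ho V) ⟶ (toHo V).obj X) (a : X ⟶ Y) (b : Y ⟶ Z) :
    k ≫ (toHo V).map (a ≫ b) = (k ≫ (toHo V).map a) ≫ (toHo V).map b := by simp
  exact (h k _ _).trans ((Category.id_comp _).trans
    (Category.comp_id ((hoFunctor f ⋙ hoFunctor g).map k))).symm

end EnrichedModel

namespace EnrichedModel

/-! ### Lifting of isomorphisms -/

section IsoLifting

variable {C D E C' D' : Type*} [Category* C] [Category* D] [Category* E] [Category* C']
  [Category* D']

lemma arrow_mk_eq_iff {a a' b : C} (f : a ⟶ b) (g : a' ⟶ b) :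
    Arrow.mk f = Arrow.mk g ↔ ∃ h : a = a', f = eqToHom h ≫ g := by
  refine ⟨fun h => ?_, ?_⟩
  · have e : a = a' := congrArg Comma.left h
    subst e
    exact ⟨rfl, (Arrow.mk_injective _ _ h).trans (Category.id_comp _).symm⟩
  · rintro ⟨rfl, rfl⟩
    rw [eqToHom_refl, Category.id_comp]

/-- The lifting property for isomorphisms: the functor `F` is an isofibration. -/
def IsoLifting (F : C ⥤ D) : Prop :=
  ∀ ⦃p q : D⦄ (v : p ≅ q) (x : C), F.obj x = q →
    ∃ (x' x'' : C) (u : x' ≅ x''), x'' = x ∧ Arrow.mk (F.map u.hom) = Arrow.mk v.hom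

/-- `IsoLifting` is phrased with equalities of arrows, so that functors may be applied to them
directly without transports along equalities of objects. This lemma recovers the form used in
`fibs`. -/
lemma isoLifting_iff (F : C ⥤ D) : IsoLifting F ↔ ∀ (x : C) (y' : D) (v : y' ≅ F.obj x),
    ∃ (x' : C) (u : x' ≅ x) (h : F.obj x' = y'), F.map u.hom = eqToHom h ≫ v.hom := by
  refine ⟨fun h x y' v => ?_, fun h p q v x hx => ?_⟩
  · obtain ⟨x', x'', u, rfl, hu⟩ := h v x rfl
    obtain ⟨e, he⟩ := (arrow_mk_eq_iff _ _).1 hu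
    exact ⟨x', u, e, he⟩
  · subst hx
    obtain ⟨x', u, e, he⟩ := h x p v
    exact ⟨x', x, u, rfl, (arrow_mk_eq_iff _ _).2 ⟨e, he⟩⟩

namespace IsoLifting

lemma comp {F : C ⥤ D} {G : D ⥤ E} (hF : IsoLifting F) (hG : IsoLifting G) :
    IsoLifting (F ⋙ G) := fun p q v x hx => by
  obtain ⟨y', y'', v', hy, hv⟩ := hG v (F.obj x) hx
  obtain ⟨x', x'', u, hx, hu⟩ := hF v' x hy.symm
  exact ⟨x', x'', u, hx, (congrArg G.mapArrow.obj hu).trans hv⟩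

lemma of_retract {F : C ⥤ D} {G : C' ⥤ D'} (hG : IsoLifting G) {i : C ⥤ C'} {r : C' ⥤ C}
    {j : D ⥤ D'} {s : D' ⥤ D} (h₁ : i ⋙ r = 𝟭 C) (h₂ : j ⋙ s = 𝟭 D) (h₃ : i ⋙ G = F ⋙ j)
    (h₄ : r ⋙ F = G ⋙ s) : IsoLifting F := fun p q v x hx => by
  obtain ⟨x', x'', u, hx, hu⟩ := hG (j.mapIso v) (i.obj x)
    ((Functor.congr_obj h₃ x).trans (congrArg j.obj hx))
  refine ⟨_, _, r.mapIso u, (congrArg r.obj hx).trans (Functor.congr_obj h₁ x), ?_⟩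
  change (r ⋙ F).mapArrow.obj (Arrow.mk u.hom) = _
  rw [h₄]
  refine (congrArg s.mapArrow.obj hu).trans ?_
  change (j ⋙ s).mapArrow.obj (Arrow.mk v.hom) = _
  rw [h₂]
  rfl

lemma of_essSurj {F : C ⥤ D} (hF : IsoLifting F) [F.EssSurj] : Function.Surjective F.obj :=
  fun y => by
    obtain ⟨x', _, u, -, hu⟩ := hF (F.objObjPreimageIso y).symm (F.objPreimage y) rfl
    exact ⟨x', congrArg Comma.left hu⟩

lemma of_fullyFaithful {F : C ⥤ D} (hF : F.FullyFaithful) (h : Function.Surjective F.obj) :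
    IsoLifting F := fun p q v x hx => by
  obtain ⟨x', rfl⟩ := h p
  subst hx
  exact ⟨x', x, hF.preimageIso v, rfl, congrArg Arrow.mk (hF.map_preimage v.hom)⟩

/-- Used to pass from a fibration `F` to its locally fibrant replacement `F'`: every isomorphism in
the target of `F'` comes from one in the target of `F`, and lifts can be pushed forward along `a`.
-/
lemma of_square {F : C ⥤ D} {F' : C' ⥤ D'} {a : C ⥤ C'} {c : D ⥤ D'} (h : a ⋙ F' = F ⋙ c)
    (ha : Function.Surjective a.obj) (hc : c.FullyFaithful) (hc' : Function.Bijective c.obj)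
    (hF : IsoLifting F) : IsoLifting F' := fun p q v x hx => by
  obtain ⟨p, rfl⟩ := hc'.2 p
  obtain ⟨q, rfl⟩ := hc'.2 q
  obtain ⟨x, rfl⟩ := ha x
  obtain ⟨x', x'', u, hx, hu⟩ := hF (hc.preimageIso v) x
    (hc'.1 ((Functor.congr_obj h x).symm.trans hx))
  refine ⟨_, _, a.mapIso u, congrArg a.obj hx, ?_⟩
  change (a ⋙ F').mapArrow.obj (Arrow.mk u.hom) = _
  rw [h]
  exact (congrArg c.mapArrow.obj hu).trans (congrArg Arrow.mk (hc.map_preimage v.hom))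

/-- Used in the opposite direction, to come back from the replacement: the lift found for `F'`
descends through `a`, and it is the right one because `c` is faithful and injective on objects. -/
lemma of_square' {F : C ⥤ D} {F' : C' ⥤ D'} {a : C ⥤ C'} {c : D ⥤ D'} (h : a ⋙ F' = F ⋙ c)
    (ha : a.FullyFaithful) (ha' : Function.Bijective a.obj) (hc : c.FullyFaithful)
    (hc' : Function.Injective c.obj) (hF : IsoLifting F') : IsoLifting F := fun p q v x hx => by
  obtain ⟨s, t, u, hx', hu⟩ := hF (c.mapIso v) (a.obj x)
    ((Functor.congr_obj h x).trans (congrArg c.obj hx))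
  obtain ⟨s, rfl⟩ := ha'.2 s
  obtain ⟨t, rfl⟩ := ha'.2 t
  refine ⟨s, t, ha.preimageIso u, ha'.1 hx', ?_⟩
  have e : c.mapArrow.obj (Arrow.mk (F.map (ha.preimage u.hom))) =
      c.mapArrow.obj (Arrow.mk v.hom) := by
    change (F ⋙ c).mapArrow.obj (Arrow.mk (ha.preimage u.hom)) = _
    rw [← h]
    exact (congrArg (fun k => Arrow.mk (F'.map k)) (ha.map_preimage u.hom)).trans hu
  change Arrow.mk (F.map (ha.preimage u.hom)) = _
  generalize F.map (ha.preimage u.hom) = k at e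
  have e₁ : F.obj s = p := hc' (congrArg Comma.left e)
  have e₂ : F.obj t = q := hc' (congrArg Comma.right e)
  subst e₁ e₂
  exact congrArg Arrow.mk (hc.map_injective (Arrow.mk_injective _ _ e))

end IsoLifting

end IsoLifting

/-! ### Retracts of `V`-functors. -/

section Retracts

variable {V : Type u} [Category.{w} V] [MonoidalCategory V] {A B A' B' : VCat V}

/-- The hom-objects of a retract of `V`-functors are retracts of hom-objects. -/
def VFun.retractArrow {φ : A → B} {ψ : A' → B'} {ι : A → A'} {ρ : A' → A} {κ : B → B'}
    {σ : B' → B} {f : VFun A B φ} {g : VFun A' B' ψ} {i : VFun A A' ι} {r : VFun A' A ρ}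
    {j : VFun B B' κ} {s : VFun B' B σ} (h₁ : ∀ x, ρ (ι x) = x) (h₂ : ∀ x, σ (κ x) = x)
    (h₃ : ∀ x, ψ (ι x) = κ (φ x)) (h₄ : ∀ x, φ (ρ x) = σ (ψ x))
    (h₁' : ∀ x y, (i.map x y ≫ r.map _ _) ≫ homCast (h₁ x) (h₁ y) = 𝟙 _)
    (h₂' : ∀ x y, (j.map x y ≫ s.map _ _) ≫ homCast (h₂ x) (h₂ y) = 𝟙 _)
    (h₃' : ∀ x y, (i.map x y ≫ g.map _ _) ≫ homCast (h₃ x) (h₃ y) = f.map x y ≫ j.map _ _)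
    (h₄' : ∀ x y, (r.map x y ≫ f.map _ _) ≫ homCast (h₄ x) (h₄ y) = g.map x y ≫ s.map _ _)
    (x y : A) : RetractArrow (f.map x y) (g.map (ι x) (ι y)) where
  i := Arrow.homMk (i.map x y) (j.map _ _ ≫ homCast (h₃ x).symm (h₃ y).symm) (by
    dsimp only [Arrow.mk_hom]
    rw [← reassoc_of% (h₃' x y)]
    simp)
  r := Arrow.homMk (r.map _ _ ≫ homCast (h₁ x) (h₁ y)) (s.map _ _ ≫
      homCast (((h₄ _).symm.trans (congrArg φ (h₁ x)))) ((h₄ _).symm.trans (congrArg φ (h₁ y)))) (by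
    dsimp only [Arrow.mk_hom]
    rw [← reassoc_of% (h₄' (ι x) (ι y)), Category.assoc, f.map_homCast]
    simp)
  retract := by
    ext
    · exact (Category.assoc _ _ _).symm.trans (h₁' x y)
    · refine Eq.trans ?_ (h₂' (φ x) (φ y))
      change (j.map _ _ ≫ homCast _ _) ≫ s.map _ _ ≫ homCast _ _ = _
      rw [Category.assoc, s.map_homCast_assoc]
      simp

lemma locally_of_retract {P : MorphismProperty V} [P.IsStableUnderRetracts]
    {f : A ⟶ B} {g : A' ⟶ B'} (h : RetractArrow f g) (hg : locally P g) : locally P f := by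
  intro x y
  obtain ⟨e₁, h₁⟩ := VCat.hom_congr h.left.retract
  obtain ⟨e₂, h₂⟩ := VCat.hom_congr h.right.retract
  obtain ⟨e₃, h₃⟩ := VCat.hom_congr h.i_w
  obtain ⟨e₄, h₄⟩ := VCat.hom_congr h.r_w
  exact MorphismProperty.of_retract (VFun.retractArrow (f := VFun.of f) (g := VFun.of g)
    (i := VFun.of h.i.left) (r := VFun.of h.r.left) (j := VFun.of h.i.right)
    (s := VFun.of h.r.right) e₁ e₂ e₃ e₄ h₁ h₂ h₃ h₄ x y) (hg _ _)

end Retracts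

/-! ### Closure properties of weak equivalences and fibrations. -/

section Classes

lemma locally_comp {V : Type u} [Category.{w} V] [MonoidalCategory V]
    {A B C : VCat V} {P : MorphismProperty V} [P.IsStableUnderComposition] {f : A ⟶ B} {g : B ⟶ C}
    (hf : locally P f) (hg : locally P g) : locally P (f ≫ g) :=
  fun x y => P.comp_mem _ _ (hf x y) (hg _ _)

variable {V : Type u} [Category.{w} V] [MonoidalCategory V] [ModelCategory V]
  [MonoidalClosed V] [SymmetricCategory V] [IsMonoidalModel V] [IsCofibrant (𝟙_ V)]
  {A B C : VCat V}

lemma fibs_iff (f : A ⟶ B) :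
    fibs V f ↔ locally (fibrations V) f ∧ IsoLifting (hoFunctor f) := by
  rw [isoLifting_iff]
  rfl

/-- An essentially surjective isofibration is surjective on objects. Conversely, local weak
equivalences are fully faithful on homotopy categories, and a fully faithful functor that is
surjective on objects is an isofibration. -/
lemma surjTrivFibs_eq : surjTrivFibs V = fibs V ⊓ weqs V := by
  ext A B f
  refine ⟨fun ⟨h, h'⟩ => ?_, fun ⟨h, h'⟩ => ?_⟩
  · refine ⟨(fibs_iff f).2 ⟨fun x y => (h x y).1, .of_fullyFaithful
      (fullyFaithfulHoFunctor f fun x y => (h x y).2) h'⟩, fun x y => (h x y).2, ⟨fun y => ?_⟩⟩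
    obtain ⟨x, rfl⟩ := h' y
    exact ⟨x, ⟨Iso.refl _⟩⟩
  · have := h'.2
    exact ⟨fun x y => ⟨h.1 x y, h'.1 x y⟩, ((fibs_iff f).1 h).2.of_essSurj⟩

lemma fibs_comp {f : A ⟶ B} {g : B ⟶ C} (hf : fibs V f) (hg : fibs V g) : fibs V (f ≫ g) := by
  rw [fibs_iff] at *
  refine ⟨locally_comp hf.1 hg.1, ?_⟩
  rw [hoFunctor_comp]
  exact hf.2.comp hg.2

lemma weqs_comp {f : A ⟶ B} {g : B ⟶ C} (hf : weqs V f) (hg : weqs V g) : weqs V (f ≫ g) := by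
  refine ⟨locally_comp hf.1 hg.1, ?_⟩
  have := hf.2
  have := hg.2
  rw [hoFunctor_comp]
  infer_instance

lemma weqs_of_postcomp {f : A ⟶ B} {g : B ⟶ C} (hg : weqs V g) (hfg : weqs V (f ≫ g)) :
    weqs V f := by
  refine ⟨fun x y => MorphismProperty.of_postcomp _ _ _ (hg.1 _ _) (hfg.1 x y), ⟨fun y => ?_⟩⟩
  have := hfg.2
  rw [hoFunctor_comp] at this
  let e := (hoFunctor f ⋙ hoFunctor g).objObjPreimageIso ((hoFunctor g).obj y)
  exact ⟨_, ⟨(fullyFaithfulHoFunctor g hg.1).preimageIso e⟩⟩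

/-- Two out of three in `V` controls `g` only on objects in the image of `f`. Every object of `B` is
isomorphic to such an object in `HoCat B`, and being a weak equivalence on hom-objects is invariant
under these isomorphisms. -/
lemma weqs_of_precomp {f : A ⟶ B} {g : B ⟶ C} (hf : weqs V f) (hfg : weqs V (f ≫ g)) :
    weqs V g := by
  have h₁ := hf.2
  refine ⟨fun x y => ?_, ?_⟩
  · refine weakEquivalence_map_of_iso g ((hoFunctor f).objObjPreimageIso x)
      ((hoFunctor f).objObjPreimageIso y) ?_
    exact MorphismProperty.of_precomp _ ((VCat.toFunctor f).map _ _) _ (hf.1 _ _) (hfg.1 _ _)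
  · have := hfg.2
    rw [hoFunctor_comp] at this
    exact ⟨fun z => ⟨_, ⟨(hoFunctor f ⋙ hoFunctor g).objObjPreimageIso z⟩⟩⟩

lemma weqs_of_retract {A' B' : VCat V} {f : A ⟶ B} {g : A' ⟶ B'} (h : RetractArrow f g)
    (hg : weqs V g) : weqs V f := by
  refine ⟨locally_of_retract h hg.1, ⟨fun y => ?_⟩⟩
  have := hg.2
  have e₁ := congrArg hoFunctor h.r_w
  have e₂ := congrArg hoFunctor h.right.retract
  rw [hoFunctor_comp, hoFunctor_comp] at e₁
  have e₂' : hoFunctor h.i.right ⋙ hoFunctor h.r.right = 𝟭 (HoCat B) :=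
    (hoFunctor_comp _ _).symm.trans (e₂.trans (hoFunctor_id B))
  let e := (hoFunctor h.r.right).mapIso
    ((hoFunctor g).objObjPreimageIso ((hoFunctor h.i.right).obj y))
  exact ⟨_, ⟨eqToIso (Functor.congr_obj e₁ _) ≪≫ e ≪≫ eqToIso (Functor.congr_obj e₂' y)⟩⟩

lemma fibs_of_retract {A' B' : VCat V} {f : A ⟶ B} {g : A' ⟶ B'} (h : RetractArrow f g)
    (hg : fibs V g) : fibs V f := by
  rw [fibs_iff] at *
  refine ⟨locally_of_retract h hg.1, hg.2.of_retract (i := hoFunctor h.i.left)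
    (r := hoFunctor h.r.left) (j := hoFunctor h.i.right) (s := hoFunctor h.r.right) ?_ ?_ ?_ ?_⟩
  · exact (hoFunctor_comp _ _).symm.trans ((congrArg hoFunctor h.left.retract).trans
      (hoFunctor_id A))
  · exact (hoFunctor_comp _ _).symm.trans ((congrArg hoFunctor h.right.retract).trans
      (hoFunctor_id B))
  · exact (hoFunctor_comp _ _).symm.trans ((congrArg hoFunctor h.i_w).trans
      (hoFunctor_comp _ _))
  · exact (hoFunctor_comp _ _).symm.trans ((congrArg hoFunctor h.r_w).trans
      (hoFunctor_comp _ _))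

end Classes

end EnrichedModel

namespace EnrichedModel

/-! ### Base change of fibrations of `V`-categories -/

section

variable {V : Type u} [Category.{w} V] [MonoidalCategory V] {A : VCat V}

lemma rwh_homCast {x x' y y' z z' : A} (e : 𝟙_ V ⟶ A.hm x y) (hx : x = x') (hy : y = y')
    (hz : z = z') : rwh e z ≫ homCast hz hy = homCast hz hx ≫ rwh (e ≫ homCast hx hy) z' := by
  subst hx hy hz
  simp

lemma locally_pbSnd [HasPullbacks V] {X Y Z : VCat V} {φ : X → Z} {ψ : Y → Z} (F : VFun X Z φ)
    (G : VFun Y Z ψ) {P : MorphismProperty V} [P.IsStableUnderBaseChange] [P.RespectsIso]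
    (h : locally P F.hom) : locally P (pbSnd F G).hom := fun p q =>
  MorphismProperty.of_isPullback (isPullback_pb_map F G p q)
    (MorphismProperty.RespectsIso.postcomp _ _ _ (h _ _))

lemma fibration_map_homCast [ModelCategory V] {X Z : VCat V} {φ : X → Z} (F : VFun X Z φ)
    (hF : locally (fibrations V) F.hom) {x x' : X} {z z' : Z}
    (h : φ x = z) (h' : φ x' = z') : Fibration (F.map x x' ≫ homCast h h') := by
  have : Fibration (F.map x x') := (fibration_iff _).2 (hF x x')
  infer_instance

end

variable {V : Type u} [Category.{w} V] [MonoidalCategory V] [ModelCategory V]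
  [MonoidalClosed V] [SymmetricCategory V] [IsMonoidalModel V] [IsCofibrant (𝟙_ V)]

instance : (weqs V).IsStableUnderRetracts := ⟨fun h hg => weqs_of_retract h hg⟩

instance : (fibs V).IsStableUnderRetracts := ⟨fun h hg => fibs_of_retract h hg⟩

/-! ### Lifting homotopy-invertible points of hom-objects. -/

section Point

variable {A B : VCat V}

lemma isIso_hoMk_homCast {x x' y y' : A} (e : 𝟙_ V ⟶ A.hm x y) (hx : x = x') (hy : y = y')
    (h : IsIso (hoMk e)) : IsIso (hoMk (e ≫ homCast hx hy)) := by
  subst hx hy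
  rwa [homCast_rfl, Category.comp_id]

lemma isIso_hoMk_map (f : A ⟶ B) {x y : A} (e : 𝟙_ V ⟶ A.hm x y) (h : IsIso (hoMk e)) :
    IsIso (hoMk (e ≫ (VCat.toFunctor f).map x y)) := by
  rw [← hoFunctor_map_hoMk]
  exact @Functor.map_isIso _ _ _ _ _ _ (hoFunctor f) (hoMk e) h

/-- The fibration condition lifts the isomorphism only in the homotopy category. Fibrancy represents
the lift by a point, which lies over `e` up to homotopy; `exists_strict_point` moves it within its
class to lie strictly over `e`. -/
lemma exists_point_lift {φ : A → B} (F : VFun A B φ) (hF : fibs V F.hom) (hA : IsLocallyFibrant A)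
    (hB : IsLocallyFibrant B) (x : A) (z : B) (e : 𝟙_ V ⟶ B.hm z (φ x)) (he : IsIso (hoMk e)) :
    ∃ (x' : A) (h : φ x' = z) (u : 𝟙_ V ⟶ A.hm x' x), IsIso (hoMk u) ∧
      u ≫ F.map x' x ≫ homCast h rfl = e := by
  obtain ⟨x', u', h, hu'⟩ := hF.2 x z (@asIso _ _ _ _ (hoMk e) he)
  have h' : φ x' = z := h
  subst h'
  have := hA x' x
  have := hB (φ x') (φ x)
  have : Fibration (F.map x' x) := (fibration_iff _).2 (hF.1 x' x)
  obtain ⟨u₀, hu₀⟩ := hoMk_surjective (A := A) (x := x') (y := x) u'.hom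
  have h₁ : hoMk (u₀ ≫ F.map x' x) = hoMk e := by
    refine (hoFunctor_map_hoMk F.hom u₀).symm.trans ?_
    rw [hu₀]
    exact hu'.trans (Category.id_comp _)
  obtain ⟨u, h₂, h₃⟩ := exists_strict_point (F.map x' x) u₀ e h₁
  refine ⟨x', rfl, u, ?_, by rw [homCast_rfl, Category.comp_id, h₂]⟩
  have h₄ : hoMk u = u'.hom := Eq.trans (congrArg (ForgetEnrichment.homOf (Ho V)
    (C := TransportEnrichment (toHo V) A)) h₃) hu₀
  exact h₄.symm ▸ u'.isIso_hom

end Point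

section

variable {X Y Z : VCat V} {φ : X → Z} {ψ : Y → Z} (F : VFun X Z φ) (G : VFun Y Z ψ)

/-- Fibrations between locally fibrant `V`-categories are stable under base change. -/
lemma isoLifting_pbSnd_of_isLocallyFibrant
    (hV : IsRightProper (weakEquivalences V) (fibrations V)) (hF : fibs V F.hom)
    (hX : IsLocallyFibrant X) (hY : IsLocallyFibrant Y) (hZ : IsLocallyFibrant Z) :
    IsoLifting (hoFunctor (pbSnd F G).hom) := by
  rintro y' q v p rfl
  have := hY y' p.snd
  obtain ⟨e, he⟩ := hoMk_surjective (A := Y) (x := y') (y := p.snd) v.hom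
  have he' : IsIso (hoMk e) := he.symm ▸ v.isIso_hom
  have heG : IsIso (hoMk (e ≫ G.map y' p.snd)) := isIso_hoMk_map G.hom e he'
  obtain ⟨x', h, u, hu, hu'⟩ := exists_point_lift F hF hX hZ p.fst (ψ y')
    ((e ≫ G.map y' p.snd) ≫ homCast rfl p.w.symm) (isIso_hoMk_homCast _ _ _ heG)
  let p' : pb F G := PbObj.mk x' y' h
  have huG : u ≫ F.map x' p.fst ≫ homCast h p.w = e ≫ G.map y' p.snd := by
    have := hu' =≫ homCast rfl p.w
    simpa using this
  -- Since `u` and `e` agree strictly in `Z`, they define a point of the hom-object of the pullback.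
  let t : 𝟙_ V ⟶ (pb F G).hm p' p := pullback.lift u e huG
  have ht₁ : t ≫ (pbFst F G).map p' p = u := pullback.lift_fst _ _ _
  have ht₂ : t ≫ (pbSnd F G).map p' p = e := pullback.lift_snd _ _ _
  -- Postcomposition with `t` is a morphism of pullback squares whose components are
  -- postcompositions with `u`, `e` and the image of `e` in `Z`. These are weak equivalences because
  -- the points are invertible in the homotopy categories; the gluing lemma concludes.
  have ht : IsIso (hoMk t) := by
    refine (isIso_hoMk_iff t).2 fun z => ?_
    have := (isIso_hoMk_iff u).1 hu z.fst
    have := (isIso_hoMk_iff e).1 he' z.snd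
    have := (isIso_hoMk_iff _).1 heG (ψ z.snd)
    have := fibration_map_homCast F hF.1 z.w p.w
    have := fibration_map_homCast F hF.1 z.w h
    refine weakEquivalence_of_isPullback hV (isPullback_pb_map F G z p') (isPullback_pb_map F G z p)
      (x := rwh u z.fst) (y := rwh e z.snd) (z := rwh (e ≫ G.map y' p.snd) (ψ z.snd)) ?_
      (rwh_map (VCat.toFunctor G.hom) e z.snd) ?_ ?_
    · refine (Category.assoc _ _ _).symm.trans ?_
      refine (rwh_map (VCat.toFunctor F.hom) u z.fst =≫ homCast z.w p.w).trans ?_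
      refine (Category.assoc _ _ _).trans ?_
      refine (_ ≫= rwh_homCast _ h p.w z.w).trans ?_
      refine (Category.assoc _ _ _).symm.trans ?_
      exact congrArg (fun k => (F.map z.fst x' ≫ homCast z.w h) ≫ rwh k (ψ z.snd))
        ((Category.assoc _ _ _).trans huG)
    · exact (rwh_map (VCat.toFunctor (pbFst F G).hom) t z).trans
        (congrArg (fun k => (pbFst F G).map z p' ≫ rwh k z.fst) ht₁)
    · exact (rwh_map (VCat.toFunctor (pbSnd F G).hom) t z).trans
        (congrArg (fun k => (pbSnd F G).map z p' ≫ rwh k z.snd) ht₂)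
  refine ⟨p', p, asIso (hoMk t), rfl, congrArg Arrow.mk ?_⟩
  refine (hoFunctor_map_hoMk (pbSnd F G).hom t).trans ?_
  exact (congrArg (fun k : 𝟙_ V ⟶ Y.hm y' p.snd => hoMk k) ht₂).trans he

end

end EnrichedModel

namespace EnrichedModel

/-! ### Base change of fibrations: the general case -/

section

variable {V : Type u} [Category.{w} V] [MonoidalCategory V]
  {X Y Z X' Y' Z' : VCat V} {φ : X → Z} {ψ : Y → Z} {φ' : X' → Z'} {ψ' : Y' → Z'}
  {α : X → X'} {β : Y → Y'} {γ : Z → Z'}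

variable {F : VFun X Z φ} {G : VFun Y Z ψ} {F' : VFun X' Z' φ'} {G' : VFun Y' Z' ψ'}
    {a : VFun X X' α} {b : VFun Y Y' β} {c : VFun Z Z' γ}
    (h₁ : ∀ x, φ' (α x) = γ (φ x)) (h₂ : ∀ y, ψ' (β y) = γ (ψ y))

lemma pbObj_map_w {h₁ : ∀ x, φ' (α x) = γ (φ x)} {h₂ : ∀ y, ψ' (β y) = γ (ψ y)} (p : PbObj φ ψ) :
    φ' (α p.fst) = ψ' (β p.snd) := (h₁ p.fst).trans ((congrArg γ p.w).trans (h₂ p.snd).symm)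

lemma pbMap_square_left
    (h₁' : ∀ x y, (a.map x y ≫ F'.map _ _) ≫ homCast (h₁ x) (h₁ y) = F.map x y ≫ c.map _ _)
    (p q : PbObj φ ψ) :
    a.map p.fst q.fst ≫ F'.map _ _ ≫
        homCast (pbObj_map_w (h₁ := h₁) (h₂ := h₂) p) (pbObj_map_w (h₁ := h₁) (h₂ := h₂) q) =
      (F.map p.fst q.fst ≫ homCast p.w q.w) ≫ c.map _ _ ≫
        homCast (h₂ p.snd).symm (h₂ q.snd).symm := by
  have e₁ := h₁' p.fst q.fst =≫ homCast ((congrArg γ p.w).trans (h₂ p.snd).symm)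
    ((congrArg γ q.w).trans (h₂ q.snd).symm)
  rw [Category.assoc, Category.assoc, Category.assoc, homCast_comp] at e₁
  rw [e₁, Category.assoc, c.map_homCast_assoc p.w q.w, homCast_comp]

lemma pbMap_square_right
    (h₂' : ∀ x y, (b.map x y ≫ G'.map _ _) ≫ homCast (h₂ x) (h₂ y) = G.map x y ≫ c.map _ _)
    (x y : Y) :
    b.map x y ≫ G'.map _ _ = G.map x y ≫ c.map _ _ ≫ homCast (h₂ x).symm (h₂ y).symm := by
  rw [← Category.assoc (G.map x y), ← h₂' x y, Category.assoc, Category.assoc, homCast_comp,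
    homCast_rfl, Category.comp_id]

variable [HasPullbacks V]

/-- The functoriality of pullbacks. -/
noncomputable def pbMap
    (h₁' : ∀ x y, (a.map x y ≫ F'.map _ _) ≫ homCast (h₁ x) (h₁ y) = F.map x y ≫ c.map _ _)
    (h₂' : ∀ x y, (b.map x y ≫ G'.map _ _) ≫ homCast (h₂ x) (h₂ y) = G.map x y ≫ c.map _ _) :
    VFun (pb F G) (pb F' G') (fun p => ⟨α p.fst, β p.snd,
      pbObj_map_w (h₁ := h₁) (h₂ := h₂) p⟩) :=
  pbLift F' G' ((pbFst F G).comp a) ((pbSnd F G).comp b) _ (fun p q => by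
    have w := (isPullback_pb_map F G p q).w
    have e₁ := (pbFst F G).map p q ≫= pbMap_square_left h₁ h₂ h₁' p q
    have e₂ := (pbSnd F G).map p q ≫= pbMap_square_right h₂ h₂' p.snd q.snd
    have e₃ := w =≫ (c.map _ _ ≫ homCast (h₂ p.snd).symm (h₂ q.snd).symm)
    rw [Category.assoc, Category.assoc _ (G.map _ _)] at e₃
    refine Eq.trans ?_ (e₁.trans (e₃.trans (e₂.symm.trans (Category.assoc _ _ _).symm)))
    exact (Category.assoc _ _ _).trans (Category.assoc _ _ _))

end

section

variable {V : Type u} [Category.{w} V] [MonoidalCategory V] [ModelCategory V]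

lemma isLocallyFibrant_of_locally_fibrations {X Y : VCat V} (f : X ⟶ Y)
    (hf : locally (fibrations V) f) (hY : IsLocallyFibrant Y) : IsLocallyFibrant X := fun x y => by
  have := hY ((VCat.toFunctor f).obj x) ((VCat.toFunctor f).obj y)
  have : Fibration ((VCat.toFunctor f).map x y) := (fibration_iff _).2 (hf x y)
  exact isFibrant_of_fibration ((VCat.toFunctor f).map x y)

lemma isLocallyFibrant_terminalObj : IsLocallyFibrant (terminalObj V) := fun _ _ =>
  (isFibrant_iff_of_isTerminal (𝟙 (⊤_ V)) terminalIsTerminal).2 inferInstance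

variable {X Y Z X' Y' Z' : VCat V} {φ : X → Z} {ψ : Y → Z} {φ' : X' → Z'} {ψ' : Y' → Z'}
  {α : X → X'} {β : Y → Y'} {γ : Z → Z'} {F : VFun X Z φ} {G : VFun Y Z ψ} {F' : VFun X' Z' φ'}
  {G' : VFun Y' Z' ψ'} {a : VFun X X' α} {b : VFun Y Y' β} {c : VFun Z Z' γ}

lemma locally_weakEquivalences_pbMap
    (hproper : IsRightProper (weakEquivalences V) (fibrations V))
    (h₁ : ∀ x, φ' (α x) = γ (φ x)) (h₂ : ∀ y, ψ' (β y) = γ (ψ y))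
    (h₁' : ∀ x y, (a.map x y ≫ F'.map _ _) ≫ homCast (h₁ x) (h₁ y) = F.map x y ≫ c.map _ _)
    (h₂' : ∀ x y, (b.map x y ≫ G'.map _ _) ≫ homCast (h₂ x) (h₂ y) = G.map x y ≫ c.map _ _)
    (hF : locally (fibrations V) F.hom) (hF' : locally (fibrations V) F'.hom)
    (ha : locally (weakEquivalences V) a.hom) (hb : locally (weakEquivalences V) b.hom)
    (hc : locally (weakEquivalences V) c.hom) :
    locally (weakEquivalences V) (pbMap h₁ h₂ h₁' h₂').hom := by
  intro p q
  rw [← weakEquivalence_iff]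
  have : WeakEquivalence (a.map p.fst q.fst) := (weakEquivalence_iff _).2 (ha _ _)
  have : WeakEquivalence (b.map p.snd q.snd) := (weakEquivalence_iff _).2 (hb _ _)
  have : WeakEquivalence (c.map (ψ p.snd) (ψ q.snd)) := (weakEquivalence_iff _).2 (hc _ _)
  have := fibration_map_homCast F hF p.w q.w
  have := fibration_map_homCast F' hF' (pbObj_map_w (h₁ := h₁) (h₂ := h₂) p)
    (pbObj_map_w (h₁ := h₁) (h₂ := h₂) q)
  exact weakEquivalence_of_isPullback hproper (isPullback_pb_map F G p q)
    (isPullback_pb_map F' G' ⟨α p.fst, β p.snd, pbObj_map_w (h₁ := h₁) (h₂ := h₂) p⟩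
      ⟨α q.fst, β q.snd, pbObj_map_w (h₁ := h₁) (h₂ := h₂) q⟩) (x := a.map p.fst q.fst) (y := b.map p.snd q.snd)
    (z := c.map (ψ p.snd) (ψ q.snd) ≫ homCast (h₂ p.snd).symm (h₂ q.snd).symm)
    (pbMap_square_left h₁ h₂ h₁' p q) (pbMap_square_right h₂ h₂' p.snd q.snd)
    (pullback.lift_fst _ _ _) (pullback.lift_snd _ _ _)

end

variable {V : Type u} [Category.{w} V] [MonoidalCategory V] [ModelCategory V]
  [MonoidalClosed V] [SymmetricCategory V] [IsMonoidalModel V] [IsCofibrant (𝟙_ V)]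

/-- The comparison between the two pullbacks is a local weak equivalence by the gluing lemma, and
bijective on objects because `a` and `b` are and `c` is injective. Hence `IsoLifting.of_square'`
transports the property back. -/
lemma isoLifting_pbSnd_of_square (hproper : IsRightProper (weakEquivalences V) (fibrations V))
    {X Y Z X' Y' Z' : VCat V} {f : X ⟶ Z} {g : Y ⟶ Z} {f' : X' ⟶ Z'} {g' : Y' ⟶ Z'} {a : X ⟶ X'}
    {b : Y ⟶ Y'} {c : Z ⟶ Z'} (h₁ : a ≫ f' = f ≫ c) (h₂ : b ≫ g' = g ≫ c)
    (hf : locally (fibrations V) f) (hf' : locally (fibrations V) f')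
    (ha : locally (weakEquivalences V) a) (hb : locally (weakEquivalences V) b)
    (hc : locally (weakEquivalences V) c) (ha' : Function.Bijective (VCat.toFunctor a).obj)
    (hb' : Function.Bijective (VCat.toFunctor b).obj)
    (hc' : Function.Injective (VCat.toFunctor c).obj)
    (h : IsoLifting (hoFunctor (pbSnd (VFun.of f') (VFun.of g')).hom)) :
    IsoLifting (hoFunctor (pbSnd (VFun.of f) (VFun.of g)).hom) := by
  obtain ⟨e₁, e₁'⟩ := VCat.hom_congr h₁
  obtain ⟨e₂, e₂'⟩ := VCat.hom_congr h₂
  let m := pbMap (F := VFun.of f) (G := VFun.of g) (F' := VFun.of f') (G' := VFun.of g')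
    (a := VFun.of a) (b := VFun.of b) (c := VFun.of c) e₁ e₂ e₁' e₂'
  have hm : m.hom ≫ (pbSnd (VFun.of f') (VFun.of g')).hom =
      (pbSnd (VFun.of f) (VFun.of g)).hom ≫ b :=
    VCat.hom_ext (fun _ => rfl) fun p q =>
      (Category.comp_id _).trans (pullback.lift_snd _ _ _)
  have hm' : locally (weakEquivalences V) m.hom :=
    locally_weakEquivalences_pbMap (F := VFun.of f) (G := VFun.of g) (F' := VFun.of f')
      (G' := VFun.of g') (a := VFun.of a) (b := VFun.of b) (c := VFun.of c) hproper
      e₁ e₂ e₁' e₂' hf hf' ha hb hc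
  refine IsoLifting.of_square' (a := hoFunctor m.hom) (c := hoFunctor b)
    ((hoFunctor_comp _ _).symm.trans ((congrArg hoFunctor hm).trans (hoFunctor_comp _ _)))
    (fullyFaithfulHoFunctor _ hm') ⟨fun p q hpq => ?_, fun p => ?_⟩
    (fullyFaithfulHoFunctor b hb) hb'.1 h
  · have h₃ : PbObj.mk _ _ _ = PbObj.mk _ _ _ := hpq
    rw [PbObj.mk.injEq] at h₃
    exact PbObj.ext (ha'.1 h₃.1) (hb'.1 h₃.2)
  · obtain ⟨x, y, hxy⟩ := p
    obtain ⟨x, rfl⟩ := ha'.2 x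
    obtain ⟨y, rfl⟩ := hb'.2 y
    exact ⟨⟨x, y, hc' ((e₁ x).symm.trans (hxy.trans (e₂ y)))⟩, rfl⟩

/-! ### Locally fibrant replacement and base change of fibrations. -/

section Replacement

variable [HasColimits V]

/-- Local fibrations over a locally fibrant target have locally fibrant source, so the factorization
through a local fibration is a replacement that leaves the objects unchanged. -/
lemma exists_isLocallyFibrant_over (hV : IsCofibrantlyGeneratedMonoidal V)
    (hmonoid : MonoidAxiom V) {X Z : VCat V} (f : X ⟶ Z) (hZ : IsLocallyFibrant Z) :
    ∃ (X' : VCat V) (a : X ⟶ X') (f' : X' ⟶ Z), a ≫ f' = f ∧ IsLocallyFibrant X' ∧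
      Function.Bijective (VCat.toFunctor a).obj ∧ locally (weakEquivalences V) a ∧
      locally (fibrations V) f' := by
  obtain ⟨X', a, f', h, ha, hf', -⟩ := exists_factorization_locally_fibration hV hmonoid f
  exact ⟨X'.toVCat, a.hom, f', h, isLocallyFibrant_of_locally_fibrations f' hf' hZ,
    Function.bijective_id, fun x y => (weakEquivalence_iff _).1 (ha x y), hf'⟩

lemma exists_isLocallyFibrant (hV : IsCofibrantlyGeneratedMonoidal V)
    (hmonoid : MonoidAxiom V) (X : VCat V) :
    ∃ (X' : VCat V) (a : X ⟶ X'), IsLocallyFibrant X' ∧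
      Function.Bijective (VCat.toFunctor a).obj ∧ locally (weakEquivalences V) a := by
  obtain ⟨X', a, -, -, h, h', h'', -⟩ := exists_isLocallyFibrant_over hV hmonoid
    (terminalFrom X).hom isLocallyFibrant_terminalObj
  exact ⟨X', a, h, h', h''⟩

/-- Fibrations of `V`-categories are stable under base change. -/
theorem fibs_pbSnd (hV : IsCofibrantlyGeneratedMonoidal V) (hmonoid : MonoidAxiom V)
    (hproper : IsRightProper (weakEquivalences V) (fibrations V)) {X Y Z : VCat V} (f : X ⟶ Z)
    (g : Y ⟶ Z) (hf : fibs V f) : fibs V (pbSnd (VFun.of f) (VFun.of g)).hom := by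
  have hf₁ := (fibs_iff f).1 hf
  refine (fibs_iff _).2 ⟨locally_pbSnd (VFun.of f) (VFun.of g) hf.1, ?_⟩
  -- The whole cospan is replaced by a locally fibrant one, over a common `Z'`. The replacement of
  -- `f` is again an isofibration on homotopy categories because objects are unchanged and homotopy
  -- categories agree.
  obtain ⟨Z', c, hZ', hc, hc'⟩ := exists_isLocallyFibrant hV hmonoid Z
  obtain ⟨X', a, f', hf', hX', ha, ha', hf''⟩ := exists_isLocallyFibrant_over hV hmonoid (f ≫ c) hZ'
  obtain ⟨Y', b, g', hg', hY', hb, hb', -⟩ := exists_isLocallyFibrant_over hV hmonoid (g ≫ c) hZ'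
  have h : IsoLifting (hoFunctor f') := IsoLifting.of_square (a := hoFunctor a) (c := hoFunctor c)
    ((hoFunctor_comp _ _).symm.trans ((congrArg hoFunctor hf').trans (hoFunctor_comp _ _)))
    ha.2 (fullyFaithfulHoFunctor c hc') hc hf₁.2
  exact isoLifting_pbSnd_of_square hproper hf' hg' hf.1 hf'' ha' hb' hc' ha hb hc.1
    (isoLifting_pbSnd_of_isLocallyFibrant (VFun.of f') (VFun.of g') hproper
      ((fibs_iff f').2 ⟨hf'', h⟩) hX' hY' hZ')

/-- Fibrations of `V`-categories are stable under base change. -/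
theorem isStableUnderBaseChange_fibs (hV : IsCofibrantlyGeneratedMonoidal V)
    (hmonoid : MonoidAxiom V) (hproper : IsRightProper (weakEquivalences V) (fibrations V)) :
    (fibs V).IsStableUnderBaseChange where
  of_isPullback {X Y Y' S f g f' g'} h hg := by
    have h₁ := fibs_pbSnd hV hmonoid hproper g f hg
    have h₂ : IsPullback _ _ g f := isPullback_pb (VFun.of g) (VFun.of f)
    rw [← h.isoIsPullback_hom_snd _ _ h₂]
    exact MorphismProperty.RespectsIso.precomp _ _ _ h₁

end Replacement

/-! ### Right properness for `V`-categories. -/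

section RightProper

variable {P X Y Z : VCat V} {fst : P ⟶ X} {snd : P ⟶ Y} {f : X ⟶ Z} {g : Y ⟶ Z}

/-- Locally this is right properness of `V`. For essential surjectivity, an object `x` has `f x`
isomorphic to some `g y` in the homotopy category; lifting this isomorphism through `f` replaces `x`
by an isomorphic `x'` with `f x' = g y`, and `(x', y)` is an object of the pullback. -/
lemma weqs_pbFst (hproper : IsRightProper (weakEquivalences V) (fibrations V)) (hf : fibs V f)
    (hg : weqs V g) : weqs V (pbFst (VFun.of f) (VFun.of g)).hom := by
  refine ⟨fun p q => ?_, ⟨fun x => ?_⟩⟩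
  · exact hproper (isPullback_pb_map (VFun.of f) (VFun.of g) p q)
      ((fibration_iff _).1 (fibration_map_homCast (VFun.of f) hf.1 p.w q.w)) (hg.1 _ _)
  · have := hg.2
    let e := (hoFunctor g).objObjPreimageIso ((hoFunctor f).obj x)
    obtain ⟨x', u, h, -⟩ := hf.2 x _ e
    exact ⟨PbObj.mk x' _ h, ⟨u⟩⟩

lemma isRightProper_weqs_fibs (hproper : IsRightProper (weakEquivalences V) (fibrations V)) :
    IsRightProper (weqs V) (fibs V) := fun {P X Y Z fst snd f g} h hf hg => by
  have h₁ := weqs_pbFst hproper hf hg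
  have h₂ : IsPullback _ _ f g := isPullback_pb (VFun.of f) (VFun.of g)
  rw [← h.isoIsPullback_hom_fst _ _ h₂]
  exact MorphismProperty.RespectsIso.precomp _ _ _ h₁

end RightProper

end EnrichedModel

namespace EnrichedModel

/-! ### Model structures from path objects -/

section PathObjects

variable {M : Type*} [Category* M]

lemma isPullback_prod_map_id [HasBinaryProducts M] {A B : M} (f : A ⟶ B) (C : M) :
    IsPullback (prod.map f (𝟙 C)) (prod.fst : A ⨯ C ⟶ A) (prod.fst : B ⨯ C ⟶ B) f where
  w := prod.map_fst _ _
  isLimit' := ⟨PullbackCone.IsLimit.mk _ (fun s => prod.lift s.snd (s.fst ≫ prod.snd))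
    (fun s => by
      apply prod.hom_ext
      · rw [Category.assoc, prod.map_fst, prod.lift_fst_assoc, s.condition]
      · rw [Category.assoc, prod.map_snd, Category.comp_id, prod.lift_snd])
    (fun s => prod.lift_fst _ _)
    (fun s m h₁ h₂ => by
      apply prod.hom_ext
      · rw [h₂, prod.lift_fst]
      · rw [← h₁, prod.lift_snd, Category.assoc, prod.map_snd, Category.comp_id])⟩

section

variable [HasFiniteLimits M] {F : MorphismProperty M} [F.IsStableUnderBaseChange]

lemma prod_fst_mem {B : M} (hB : F (terminal.from B)) (A : M) : F (prod.fst : A ⨯ B ⟶ A) :=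
  MorphismProperty.of_isPullback (IsPullback.of_hasBinaryProduct' A B).flip hB

lemma prod_snd_mem {A : M} (hA : F (terminal.from A)) (B : M) : F (prod.snd : A ⨯ B ⟶ B) :=
  MorphismProperty.of_isPullback (IsPullback.of_hasBinaryProduct' A B) hA

end

variable {W F : MorphismProperty M}

lemma isWeakFactorizationSystem_llp [W.IsStableUnderRetracts] [F.IsStableUnderRetracts]
    (hfac : ∀ {A B : M} (f : A ⟶ B), ∃ (C : M) (i : A ⟶ C) (p : C ⟶ B), i ≫ p = f ∧
      (F ⊓ W).llp i ∧ (F ⊓ W) p) :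
    MorphismProperty.IsWeakFactorizationSystem (F ⊓ W).llp (F ⊓ W) := by
  have : (F ⊓ W).llp.HasFactorization (F ⊓ W) := ⟨fun f => by
    obtain ⟨C, i, p, h, hi, hp⟩ := hfac f
    exact ⟨⟨C, i, p, h, hi, hp⟩⟩⟩
  exact MorphismProperty.IsWeakFactorizationSystem.mk' _ _ fun i p hi hp => hi p hp

variable [HasFiniteLimits M] [W.HasTwoOutOfThreeProperty] [F.IsStableUnderComposition]
  [F.IsStableUnderBaseChange]

/-- The factorization of a morphism between fibrant objects through the mapping path object. -/
lemma exists_factorization_of_path [W.ContainsIdentities] [(F ⊓ W).IsStableUnderBaseChange]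
    {A B P : M} (hA : F (terminal.from A)) (hB : F (terminal.from B)) {s : B ⟶ P} {p : P ⟶ B ⨯ B}
    (h : s ≫ p = diag B) (hs : W s) (hp : F p) (f : A ⟶ B) :
    ∃ (E : M) (i : A ⟶ E) (q : E ⟶ B), i ≫ q = f ∧ W i ∧ F q := by
  have hp₁ : s ≫ p ≫ prod.fst = 𝟙 B := by rw [reassoc_of% h, prod.lift_fst]
  have hp₂ : s ≫ p ≫ prod.snd = 𝟙 B := by rw [reassoc_of% h, prod.lift_snd]
  -- The projection from the path object is a fibration because `B` is fibrant, and a weak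
  -- equivalence because `s` is a section of it.
  have hp₀ : (F ⊓ W) (p ≫ prod.fst) := ⟨F.comp_mem _ _ hp (prod_fst_mem hB B),
    W.of_precomp _ _ hs (hp₁ ▸ W.id_mem B)⟩
  let E := pullback (p ≫ prod.fst) f
  have hE : (F ⊓ W) (pullback.snd (p ≫ prod.fst) f) := MorphismProperty.pullback_snd _ _ hp₀
  let i : A ⟶ E := pullback.lift (f ≫ s) (𝟙 A) (by
    rw [Category.assoc, hp₁, Category.comp_id, Category.id_comp])
  let r : E ⟶ A ⨯ B := prod.lift (pullback.snd _ _) (pullback.fst _ _ ≫ p ≫ prod.snd)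
  have hr₁ : r ≫ prod.fst = pullback.snd _ _ := prod.lift_fst _ _
  have hr₂ : r ≫ prod.snd = pullback.fst _ _ ≫ p ≫ prod.snd := prod.lift_snd _ _
  -- The morphism from the mapping path object to `A ⨯ B` is a base change of `p`, hence in `F`. Its
  -- second component is then in `F` as well, since `A` is fibrant.
  have hr : IsPullback (pullback.fst (p ≫ prod.fst) f) r p (prod.map f (𝟙 B)) := by
    refine IsPullback.of_bot ?_ ?_ (isPullback_prod_map_id f B)
    · rw [hr₁]
      exact IsPullback.of_hasPullback (p ≫ prod.fst) f
    · apply prod.hom_ext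
      · rw [Category.assoc, Category.assoc, prod.map_fst, pullback.condition, reassoc_of% hr₁]
      · rw [Category.assoc, Category.assoc, prod.map_snd, Category.comp_id, hr₂]
  refine ⟨E, i, r ≫ prod.snd, ?_, ?_, ?_⟩
  · rw [hr₂, pullback.lift_fst_assoc, Category.assoc, hp₂, Category.comp_id]
  · refine W.of_postcomp _ _ hE.2 ?_
    rw [pullback.lift_snd]
    exact W.id_mem A
  · exact F.comp_mem _ _ (MorphismProperty.of_isPullback hr hp) (prod_snd_mem hA B)

/-- The replacement `f'` is factored through its mapping path object, and the result is pulled back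
along `c : B ⟶ B'`. By right properness the pullback is weakly equivalent to the original factor, so
two out of three shows that the morphism from `A` into it is in `W`. -/
lemma exists_factorization_of_rep [W.ContainsIdentities] [(F ⊓ W).IsStableUnderBaseChange]
    (hproper : IsRightProper W F) (Q : M → Prop) (hQ : ∀ A, Q A → F (terminal.from A))
    (hrep : ∀ {X Z : M} (f : X ⟶ Z), Q Z → ∃ (X' : M) (a : X ⟶ X') (f' : X' ⟶ Z),
      a ≫ f' = f ∧ Q X' ∧ W a)
    (hrep' : ∀ X : M, ∃ (X' : M) (a : X ⟶ X'), Q X' ∧ W a)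
    (hpath : ∀ A : M, Q A → ∃ (P : M) (s : A ⟶ P) (p : P ⟶ A ⨯ A), s ≫ p = diag A ∧ W s ∧ F p)
    {A B : M} (f : A ⟶ B) :
    ∃ (E : M) (i : A ⟶ E) (p : E ⟶ B), i ≫ p = f ∧ W i ∧ F p := by
  obtain ⟨B', c, hB', hc⟩ := hrep' B
  obtain ⟨A', a, f', hf', hA', ha⟩ := hrep (f ≫ c) hB'
  obtain ⟨P, s, p, h, hs, hp⟩ := hpath B' hB'
  obtain ⟨E, i, q, hiq, hi, hq⟩ := exists_factorization_of_path (hQ _ hA') (hQ _ hB') h hs hp f'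
  refine ⟨pullback q c, pullback.lift (a ≫ i) f (by rw [Category.assoc, hiq, hf']),
    pullback.snd _ _, pullback.lift_snd _ _ _, ?_, MorphismProperty.pullback_snd _ _ hq⟩
  refine W.of_postcomp _ _ (hproper (IsPullback.of_hasPullback q c) hq hc) ?_
  rw [pullback.lift_fst]
  exact W.comp_mem _ _ ha hi

/-- If a class of weak equivalences and a class of fibrations satisfy the following conditions,
the existence of path objects for fibrant objects implies the existence of a model structure. -/
theorem isRightProperModelStructure_of_path [HasFiniteColimits M] [W.IsStableUnderRetracts]
    [F.IsStableUnderRetracts] [W.ContainsIdentities] (hproper : IsRightProper W F)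
    (hfac : ∀ {A B : M} (f : A ⟶ B), ∃ (C : M) (i : A ⟶ C) (p : C ⟶ B), i ≫ p = f ∧
      (F ⊓ W).llp i ∧ (F ⊓ W) p)
    (Q : M → Prop) (hQ : ∀ A, Q A → F (terminal.from A))
    (hrep : ∀ {X Z : M} (f : X ⟶ Z), Q Z → ∃ (X' : M) (a : X ⟶ X') (f' : X' ⟶ Z),
      a ≫ f' = f ∧ Q X' ∧ W a)
    (hrep' : ∀ X : M, ∃ (X' : M) (a : X ⟶ X'), Q X' ∧ W a)
    (hpath : ∀ A : M, Q A →
      ∃ (P : M) (s : A ⟶ P) (p : P ⟶ A ⨯ A), s ≫ p = diag A ∧ W s ∧ F p) :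
    IsRightProperModelStructure W (F ⊓ W).llp F := by
  have := isWeakFactorizationSystem_llp hfac
  -- Trivial fibrations are the right class of a weak factorization system, hence stable under base
  -- change.
  have : (F ⊓ W).IsStableUnderBaseChange := by
    rw [← MorphismProperty.rlp_eq_of_wfs (F ⊓ W).llp (F ⊓ W)]
    infer_instance
  -- The weak equivalence of the preceding factorization is factored once more as a cofibration
  -- followed by a trivial fibration, which is absorbed in the fibration; two out of three makes the
  -- cofibration trivial.
  have fac {A B : M} (f : A ⟶ B) : ∃ (E : M) (i : A ⟶ E) (p : E ⟶ B), i ≫ p = f ∧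
      ((F ⊓ W).llp ⊓ W) i ∧ F p := by
    obtain ⟨E, j, p, rfl, hj, hp⟩ := exists_factorization_of_rep hproper Q hQ hrep hrep' hpath f
    obtain ⟨C, i, q, rfl, hi, hq⟩ := hfac j
    exact ⟨C, i, q ≫ p, (Category.assoc _ _ _).symm, ⟨hi, W.of_postcomp _ _ hq.2 hj⟩,
      F.comp_mem _ _ hq.1 hp⟩
  -- The induced morphism from `A` to the pullback of `p` along `b` is factored by `fac` as `k`
  -- followed by a fibration `r`. Since `i` and `k` are in `W`, the composite of `r` with the
  -- projection to `B` is a trivial fibration, and a section of it under `A` gives the lift.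
  have lift {A B X Y : M} (i : A ⟶ B) (p : X ⟶ Y) (hi : (F ⊓ W).llp i) (hi' : W i) (hp : F p) :
      HasLiftingProperty i p := ⟨fun {t b} sq => by
    obtain ⟨E, k, r, h, hk, hr⟩ := fac (pullback.lift t i sq.w)
    have h₁ : k ≫ r ≫ pullback.fst p b = t := by rw [reassoc_of% h, pullback.lift_fst]
    have h₂ : k ≫ r ≫ pullback.snd p b = i := by rw [reassoc_of% h, pullback.lift_snd]
    have h₃ : (F ⊓ W) (r ≫ pullback.snd p b) :=
      ⟨F.comp_mem _ _ hr (MorphismProperty.pullback_snd _ _ hp),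
        W.of_precomp _ _ hk.2 (h₂ ▸ hi')⟩
    have := hi _ h₃
    have sq' : CommSq k i (r ≫ pullback.snd p b) (𝟙 B) := ⟨by rw [h₂, Category.comp_id]⟩
    exact ⟨⟨{
      l := sq'.lift ≫ r ≫ pullback.fst p b
      fac_left := by rw [sq'.fac_left_assoc, h₁]
      fac_right := by
        rw [Category.assoc, Category.assoc, pullback.condition, reassoc_of% sq'.fac_right] }⟩⟩⟩
  let _ : CategoryWithFibrations M := ⟨F⟩
  let _ : CategoryWithCofibrations M := ⟨(F ⊓ W).llp⟩
  let _ : CategoryWithWeakEquivalences M := ⟨W⟩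
  have : (weakEquivalences M).HasTwoOutOfThreeProperty := ‹W.HasTwoOutOfThreeProperty›
  have : (weakEquivalences M).IsStableUnderRetracts := ‹W.IsStableUnderRetracts›
  have : (fibrations M).IsStableUnderRetracts := ‹F.IsStableUnderRetracts›
  have : (cofibrations M).IsStableUnderRetracts :=
    inferInstanceAs ((F ⊓ W).llp.IsStableUnderRetracts)
  exact ⟨⟨
    { cm4a := fun i p hi hi' hp => lift i p ((cofibration_iff i).1 hi)
        ((weakEquivalence_iff i).1 hi') ((fibration_iff p).1 hp)
      cm4b := fun i p hi hp hp' => (cofibration_iff i).1 hi p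
        ⟨(fibration_iff p).1 hp, (weakEquivalence_iff p).1 hp'⟩
      cm5a := ⟨fun f => by
        obtain ⟨E, i, p, h, hi, hp⟩ := fac f
        exact ⟨⟨E, i, p, h, hi, hp⟩⟩⟩
      cm5b := ⟨fun f => by
        obtain ⟨E, i, p, h, hi, hp⟩ := hfac f
        exact ⟨⟨E, i, p, h, hi, hp⟩⟩⟩ }, rfl, rfl, rfl⟩, hproper⟩

end PathObjects

/-! ### The model structure on the category of `V`-categories -/

section

variable {V : Type u} [Category.{w} V] [MonoidalCategory V] [ModelCategory V]
  [MonoidalClosed V] [SymmetricCategory V] [IsMonoidalModel V] [IsCofibrant (𝟙_ V)]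

instance : (weqs V).HasTwoOutOfThreeProperty where
  comp_mem _ _ hf hg := weqs_comp hf hg
  of_postcomp _ _ hg hfg := weqs_of_postcomp hg hfg
  of_precomp _ _ hf hfg := weqs_of_precomp hf hfg

instance : (weqs V).ContainsIdentities where
  id_mem A := ⟨fun x y => (weakEquivalence_iff _).1
      (inferInstanceAs (WeakEquivalence (𝟙 (A.hm x y)))), by
    rw [hoFunctor_id]
    infer_instance⟩

instance : (fibs V).IsStableUnderComposition := ⟨fun _ _ hf hg => fibs_comp hf hg⟩

/-- Isomorphisms in the homotopy category of the terminal `V`-category are lifted by identities.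
Indeed its hom-objects are fibrant, so the morphisms there come from points of a terminal object,
and there is only one such point. -/
lemma fibs_terminalFrom {A : VCat V} (hA : IsLocallyFibrant A) : fibs V (terminalFrom A).hom := by
  refine ⟨fun x y => ?_, fun x y v => ?_⟩
  · have := hA x y
    rw [← fibration_iff]
    exact inferInstanceAs (Fibration (terminal.from (A.hm x y)))
  · refine ⟨x, Iso.refl _, rfl, ?_⟩
    have := isLocallyFibrant_terminalObj (V := V) y y
    obtain ⟨e, he⟩ := hoMk_surjective (A := terminalObj V) (x := y) (y := y) v.hom
    obtain ⟨e', he'⟩ := hoMk_surjective (A := terminalObj V) (x := y) (y := y)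
      ((hoFunctor (terminalFrom A).hom).map (𝟙 x))
    refine he'.symm.trans (Eq.trans ?_ (Category.id_comp v.hom).symm)
    refine Eq.trans ?_ he
    exact congrArg (fun k => hoMk k) (terminal.hom_ext e' e)

lemma fibs_terminal_from {A : VCat V} (hA : IsLocallyFibrant A) : fibs V (terminal.from A) := by
  have : terminal.from A = (terminalFrom A).hom ≫
    ((terminalObjIsTerminal V).uniqueUpToIso terminalIsTerminal).hom := terminal.hom_ext _ _
  rw [this]
  exact MorphismProperty.RespectsIso.postcomp _ _ _ (fibs_terminalFrom hA)

end

end EnrichedModel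

open EnrichedModel in
theorem theorem3p1 {V : Type u} [Category.{w} V] [MonoidalCategory V] [SymmetricCategory V]
    [MonoidalClosed V] [HasLimits V] [HasColimits V] [ModelCategory V] [IsMonoidalModel V]
    [IsCofibrant (𝟙_ V)]
    (hV : IsCofibrantlyGeneratedMonoidal V) (hmonoid : MonoidAxiom V)
    (hproper : IsRightProper (weakEquivalences V) (fibrations V))
    (hpath : ∀ A : VCat V, IsLocallyFibrant A →
      ∃ (P : VCat V) (s : A ⟶ P) (p : P ⟶ A ⨯ A),
        s ≫ p = diag A ∧ weqs V s ∧ fibs V p) :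
    IsRightProperModelStructure (weqs V) (cofs V) (fibs V) := by
  have := isStableUnderBaseChange_fibs hV hmonoid hproper
  have weqs_of {X X' : VCat V} {a : X ⟶ X'} (h : Function.Bijective (VCat.toFunctor a).obj)
      (h' : locally (weakEquivalences V) a) : weqs V a := ⟨h', ⟨fun y => by
    obtain ⟨x, rfl⟩ := h.2 y
    exact ⟨x, ⟨Iso.refl _⟩⟩⟩⟩
  refine isRightProperModelStructure_of_path (isRightProper_weqs_fibs hproper) (fun f => ?_)
    IsLocallyFibrant (fun A hA => fibs_terminal_from hA) (fun f hZ => ?_) (fun X => ?_) hpath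
  -- The class `cofs V` is by definition the left class of `fibs V ⊓ weqs V`, so the first
  -- factorization is the one through surjective local trivial fibrations.
  · rw [← surjTrivFibs_eq]
    exact exists_factorization_surjTrivFibs hV f
  · obtain ⟨X', a, f', h, hX', ha, ha', -⟩ := exists_isLocallyFibrant_over hV hmonoid f hZ
    exact ⟨X', a, f', h, hX', weqs_of ha ha'⟩
  · obtain ⟨X', a, hX', ha, ha'⟩ := exists_isLocallyFibrant hV hmonoid X
    exact ⟨X', a, hX', weqs_of ha ha'⟩
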